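/- **Setting.** Let $(G,\pi)$ be a parity game: $G=(V,E)$ is a non-empty finite sinkless digraph, $V=V_0\sqcup V_1$ ($V_0$ owned by Even, $V_1$ by Odd), $\pi:V\to\{1,\dots,d\}$, $d$ even; $n=|V|$, $m=|E|$. Let $\tau$ be a positional strategy for Odd and $G_\tau$ its strategy subgraph (all arcs leaving $V_0$, and the arcs $v\tau(v)$, $v\in V_1$). An *ordered tree* of height $h$ is a finite prefix-closed set of tuples over a linearly ordered set, ordered lexicographically, with all leaves at depth $h$; $T\sqsubseteq T'$ means that there is an injective order-preserving homomorphism $T\to T'$ mapping leaves to leaves; $T\equiv T'$ means $T\sqsubseteq T'\sqsubseteq T$, and $T\sqsubset T'$ means $T\sqsubseteq T'$, $T\not\equiv T'$. Let $T$ be an $(n,d/2)$-universal tree, i.e. an ordered tree of height $h=d/2$ into which every ordered tree of height $d/2$ with at most $n$ leaves embeds. Let $\bar L(T)$ be its set of leaves with a top element $\top$ added. For a leaf $\xi=(\xi_{2h-1},\xi_{2h-3},\dots,\xi_1)$, $\xi|_p$ is obtained by deleting the components of index less than $p$; $\top|_p=\top$. With respect to a labeling $\mu:V\to\bar L(T)$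 an arc $vw$ is *non-violated* if $\mu(v)|_{\pi(v)}\ge\mu(w)|_{\pi(v)}$ when $\pi(v)$ is even, and if $\mu(v)|_{\pi(v)}>\mu(w)|_{\pi(v)}$ or $\mu(v)=\mu(w)=\top$ when $\pi(v)$ is odd; a non-violated arc is *tight* if $\mu(v)$ is the smallest label for which the arc is non-violated given the label $\mu(w)$ of its head, and *loose* otherwise. $\mathrm{Tighten}(\mu,vw)$ is the label of $v$ that makes $vw$ tight; $\mathrm{lift}(\mu,vw)$ is the smallest $\xi\ge\mu(v)$ that makes $vw$ non-violated; $\mathrm{drop}(\mu,vw)$ is the largest $\xi\le\mu(v)$ for which $vw$ is not loose. $\mathcal G_\tau^\uparrow$ consists of the operators that replace $\mu(v)$ by $\min_{vw\in E(G_\tau)}\mathrm{lift}(\mu,vw)$ ($v\in V_0$) and by $\mathrm{lift}(\mu,vw)$ ($vw\in E(G_\tau)$, $v\in V_1$); $\mu^{\mathcal G_\tau^\uparrow}$ is the least simultaneous fixed point that is pointwise $\ge\mu$. A *cover* $\mathcal C=(\mathcal C_0,\dots,\mathcal C_h)$ consists of tuples $\mathcal C_j=(\mathcal C_j^0,\mathcal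 C_j^1,\dots)$ of chains $T^k_{0,j}\sqsubset T^k_{1,j}\sqsubset\cdots$ (the members of $\mathcal C_j^k$) of whole subtrees of $T$ rooted at depth $h-j$ (up to $\equiv$), such that every such subtree occurs up to $\equiv$ in some chain of $\mathcal C_j$. $\mathrm{Raise}(\xi,i,j,k)$ is the smallest leaf $\xi'\ge\xi$ of $T$ that is the smallest leaf of a whole subtree $\equiv T^k_{i',j}$ for some $i'\ge i$, and $\top$ if there is none. **Auxiliary digraph.** A cycle is *dominated* by its nodes of highest priority. A *base node* is a node of even priority that dominates a cycle of $G_\tau$. For a base node $w$, let $K_w$ be the strongly connected component of $w$ in the subgraph of $G_\tau$ induced by the nodes of priority at most $\pi(w)$, let $K_w'$ be $K_w$ without the arcs entering nodes of highest priority other than $w$, and let $J_w$ be the subgraph of $K'_w$ induced by the nodes that can reach $w$ in $K'_w$. The digraph $D$ on the base nodes has the arc $vw$ ($v\ne w$) if $v$ has highest priority in $J_w$, and the loop $ww$ if $w$ has an outgoing arc in $J_w$. For an arc $vw$ of $D$, $j=\pi(w)/2$ and a chain $\mathcal C_j^k$, let $\underline c^k(vw)$ be the least $i$ such that the greatest labeling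 of $J_w$ in $\bar L(T^k_{i,j})$ without loose arcs in $J_w$ and with value $\min L(T^k_{i,j})$ at $w$ is finite at some out-neighbour of $v$ in $J_w$; let $\overline c^k(vw)$ be the least $i$ such that some path in $J_w$ from an out-neighbour of $v$ in $J_w$ to $w$ has a labeling in $L(T^k_{i,j})$ without violated arcs ($\infty$ if there is no such $i$). **Algorithm.** The input is $(G_\tau,\pi)$, $\mathcal C$ and a labeling $\mu:V\to\bar L(T)$ with no loose arcs in $G_\tau$. Set $\nu=\top$ everywhere. For every component $H$ of $D$, of priority $2j$, and every $k<|\mathcal C_j|$: choose arc costs $\underline c^k\le c^k\le\overline c^k$ on $H$; for every $w\in V(H)$ let $i^k$ be the minimum of $\max_{e\in E(Z)}c^k(e)$ over the cycles $Z$ of $H$ through $w$, and if $i^k<\infty$, set $\nu(w)\leftarrow\min(\nu(w),\mathrm{Raise}(\mu(w),i^k,j,k))$. Finally run Bellman–Ford: $n-1$ times, for all arcs $vw$ of $G_\tau$ in any order, set $\nu(v)\leftarrow\mathrm{drop}(\nu,vw)$. Return $\nu$. **Theorem.** For all such data, $\mu^{\mathcal G_\tau^\uparrow}$ exists and every run of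 the algorithm, for all admissible choices of arc costs and arc orders, returns $\mu^{\mathcal G_\tau^\uparrow}$. Moreover the algorithm can be implemented (choosing the arc costs by running Bellman–Ford on the subgraphs $J_w$, for all trees of the chain or in a binary search, whichever is cheaper) so that it runs in time $$O\Big(mn^2\gamma\cdot\max_{j,k}|\mathcal C_j|\min\{|\mathcal C_j^k|,\,n\log|\mathcal C_j^k|\}+n\rho\cdot\max_j|\mathcal C_j|\Big),$$ where $\log x$ stands for $\max\{1,\lfloor\log_2x\rfloor\}$, $j$ ranges over $0,\dots,d/2$, the constant is absolute, $\gamma=\gamma(T)\ge1$ is the cost of a call of Tighten on $T$ or on a tree of the cover (and of comparing two labels and of reading off the smallest leaf of a tree), $\rho=\rho(T,\mathcal C)$ is the cost of a call of Raise, and every other elementary operation on words and arrays costs one step. -/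

import Mathlib

noncomputable section

/-! ### Ordered trees -/

/-- A finite ordered tree: a finite prefix-closed set of tuples over a linearly ordered set `M`,
all of whose leaves lie at depth `height`.  Tuples are compared lexicographically (the order of
`List M`), a vertex at depth `i` is a tuple of length `i`, the root is `[]`. -/
structure OrderedTree (M : Type*) where
  verts : Finset (List M)
  height : ℕ
  root_mem : [] ∈ verts
  prefix_closed : ∀ u v, u ++ v ∈ verts → u ∈ verts
  length_le : ∀ v ∈ verts, v.length ≤ height
  exists_child : ∀ v ∈ verts, v.length < height → ∃ a, v ++ [a] ∈ verts

namespace OrderedTree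

variable {M : Type*} {N : Type*}

/-- The set `L(T)` of leaves. -/
def leaves (T : OrderedTree M) : Finset (List M) := T.verts.filter fun v => v.length = T.height

/-- `L(T)` with an extra top element. -/
abbrev Label (T : OrderedTree M) := WithTop {x : List M // x ∈ T.leaves}

/-- `T` embeds into `S`: there is an injective order-preserving homomorphism which maps leaves to
leaves. -/
def Embeds [LinearOrder M] [LinearOrder N] (T : OrderedTree M) (S : OrderedTree N) : Prop :=
  ∃ f : List M → List N,
    (∀ u ∈ T.verts, f u ∈ S.verts) ∧
    (∀ u ∈ T.verts, ∀ v ∈ T.verts, f u = f v → u = v) ∧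
    (∀ u a, u ++ [a] ∈ T.verts → ∃ b, f (u ++ [a]) = f u ++ [b]) ∧
    (∀ u ∈ T.verts, ∀ v ∈ T.verts, u ≤ v → f u ≤ f v) ∧
    (∀ u ∈ T.leaves, f u ∈ S.leaves)

/-- Equivalence of ordered trees. -/
def Equivalent [LinearOrder M] [LinearOrder N] (T : OrderedTree M) (S : OrderedTree N) : Prop :=
  T.Embeds S ∧ S.Embeds T

/-- Strict embedding order. -/
def StrictEmbeds [LinearOrder M] [LinearOrder N] (T : OrderedTree M) (S : OrderedTree N) : Prop :=
  T.Embeds S ∧ ¬ T.Equivalent S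

/-- `T` is an `(ℓ, T.height)`-universal tree.  Finite ordered trees are isomorphic to trees over
a linear order in the lowest universe, so it is enough to quantify over these. -/
def IsUniversal [LinearOrder M] (T : OrderedTree M) (ℓ : ℕ) : Prop :=
  ∀ (N : Type) [LinearOrder N] (S : OrderedTree N),
    S.height = T.height → S.leaves.card ≤ ℓ → S.Embeds T

/-- The whole subtree of `T` rooted at the vertex `v`. -/
def subtree (T : OrderedTree M) (v : List M) (hv : v ∈ T.verts) : OrderedTree M where
  verts := T.verts.preimage (fun u => v ++ u) (List.append_right_injective v).injOn
  height := T.height - v.length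
  root_mem := by rw [Finset.mem_preimage]; simpa using hv
  prefix_closed u w h := by
    rw [Finset.mem_preimage] at h ⊢
    exact T.prefix_closed _ w (by simpa [List.append_assoc] using h)
  length_le u h := by
    have := T.length_le _ (Finset.mem_preimage.1 h)
    rw [List.length_append] at this
    omega
  exists_child u h hu := by
    obtain ⟨a, ha⟩ := T.exists_child _ (Finset.mem_preimage.1 h)
      (by rw [List.length_append]; omega)
    exact ⟨a, by rw [Finset.mem_preimage]; simpa [List.append_assoc] using ha⟩

/-- A cover of the poset of distinct subtrees of `T`.  For `j ≤ T.height`, the list `chain j` is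
the `j`th subcover: a tuple of chains `S₀ ⊏ S₁ ⊏ ⋯` of subtrees of `T` rooted at depth
`T.height - j` (every class of equivalent subtrees being represented by any of its members), such
that each such subtree occurs, up to equivalence, in one of these chains. -/
structure Cover [LinearOrder M] (T : OrderedTree M) where
  chain : ℕ → List (List (OrderedTree M))
  isChain : ∀ j ≤ T.height, ∀ ch ∈ chain j, ch.Pairwise StrictEmbeds
  isSubtree : ∀ j ≤ T.height, ∀ ch ∈ chain j, ∀ S ∈ ch,
    ∃ v, ∃ hv : v ∈ T.verts, v.length = T.height - j ∧ S.Equivalent (T.subtree v hv)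
  covers : ∀ j ≤ T.height, ∀ v, ∀ hv : v ∈ T.verts, v.length = T.height - j →
    ∃ ch ∈ chain j, ∃ S ∈ ch, S.Equivalent (T.subtree v hv)

/-- The `p`-truncation: delete the components of index less than `p`, where the components of a
leaf of a tree of height `h` have indices `2h-1, 2h-3, …, 1`.  So the first `h - ⌊p/2⌋`
components are kept. -/
def trunc (T : OrderedTree M) (p : ℕ) (a : T.Label) : WithTop (List M) :=
  a.map fun x => x.1.take (T.height - p / 2)

section Labels

variable [LinearOrder M] (T : OrderedTree M)

/-- The condition on an arc whose tail has priority `p` and label `a` and whose head has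
label `b`. -/
def NonViolated (p : ℕ) (a b : T.Label) : Prop :=
  if Even p then T.trunc p b ≤ T.trunc p a
  else T.trunc p b < T.trunc p a ∨ (a = ⊤ ∧ b = ⊤)

/-- `a` is the smallest label for which the arc is not violated. -/
def Tight (p : ℕ) (a b : T.Label) : Prop := IsLeast {x | T.NonViolated p x b} a

def Loose (p : ℕ) (a b : T.Label) : Prop := T.NonViolated p a b ∧ ¬ T.Tight p a b

open Classical in
/-- The label which makes the arc tight. -/
def tighten (p : ℕ) (b : T.Label) : T.Label :=
  (Finset.univ.filter fun x => T.NonViolated p x b).inf id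

open Classical in
/-- The smallest label `x ≥ a` for which the arc is not violated. -/
def lift (p : ℕ) (a b : T.Label) : T.Label :=
  (Finset.univ.filter fun x => a ≤ x ∧ T.NonViolated p x b).inf id

open Classical in
/-- The largest label `x ≤ a` for which the arc is not loose (see `drop_isGreatest`). -/
def drop (p : ℕ) (a b : T.Label) : T.Label :=
  if T.Loose p a b then T.tighten p b else a

/-- The smallest label, that is, `min L(T)`. -/
def minLabel : T.Label := Finset.univ.inf id

variable {T}

theorem trunc_mono (p : ℕ) {a b : T.Label} (h : a ≤ b) : T.trunc p a ≤ T.trunc p b := by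
  have key : ∀ (n : ℕ) (x y : List M), x ≤ y → x.take n ≤ y.take n := by
    intro n
    induction n with
    | zero => intro x y _; simp
    | succ n ih =>
      intro x y hxy
      rcases hxy.lt_or_eq with h | rfl
      · cases h with
        | nil =>
          rw [List.take_nil]
          exact not_lt.1 (List.not_lt_nil _)
        | cons h => exact List.cons_le_cons _ (ih _ _ (le_of_lt h))
        | rel h =>
          rw [List.take_succ_cons, List.take_succ_cons]
          exact le_of_lt (List.cons_lt_cons_iff.2 (Or.inl h))
      · exact le_rfl
  have hf : Monotone fun x : {x : List M // x ∈ T.leaves} => x.1.take (T.height - p / 2) :=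
    fun x y hxy => key _ x.1 y.1 hxy
  exact WithTop.monotone_map_iff.2 hf h

theorem NonViolated.mono {p : ℕ} {a a' b : T.Label} (h : T.NonViolated p a b) (ha : a ≤ a') :
    T.NonViolated p a' b := by
  unfold NonViolated at *
  split_ifs at * with hp
  · exact h.trans (trunc_mono p ha)
  · rcases h with h | ⟨h, h'⟩
    · exact Or.inl (h.trans_le (trunc_mono p ha))
    · subst h
      exact Or.inr ⟨top_le_iff.1 ha, h'⟩

theorem nonViolated_top (p : ℕ) (b : T.Label) : T.NonViolated p ⊤ b := by
  unfold NonViolated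
  split_ifs with hp
  · simp [trunc]
  · induction b using WithTop.recTopCoe with
    | top => simp
    | coe b => left; simp [trunc]

theorem tighten_isLeast (p : ℕ) (b : T.Label) :
    IsLeast {x | T.NonViolated p x b} (T.tighten p b) := by
  classical
  constructor
  · obtain ⟨x, hx, h⟩ := Finset.exists_mem_eq_inf
      (Finset.univ.filter fun x => T.NonViolated p x b) ⟨⊤, by simp [nonViolated_top]⟩ id
    have : T.tighten p b = x := by
      unfold tighten; rw [id] at h; convert h
    rw [this]
    exact (Finset.mem_filter.1 hx).2
  · intro x hx
    exact Finset.inf_le (f := id) (Finset.mem_filter.2 ⟨Finset.mem_univ _, hx⟩)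

theorem drop_isGreatest (p : ℕ) (a b : T.Label) :
    IsGreatest {x | x ≤ a ∧ ¬ T.Loose p x b} (T.drop p a b) := by
  have ht := tighten_isLeast p b
  unfold drop
  split_ifs with h
  · refine ⟨⟨ht.2 h.1, fun h' => h'.2 ht⟩, fun x hx => ?_⟩
    by_contra hlt
    rw [not_le] at hlt
    exact hx.2 ⟨NonViolated.mono ht.1 hlt.le, fun hx' => hlt.not_ge (hx'.2 ht.1)⟩
  · exact ⟨⟨le_rfl, h⟩, fun x hx => hx.1⟩

end Labels

open Classical in
/-- `Raise(ξ, i, j, k)`: the smallest leaf `x ≥ ξ` which is the smallest leaf of a whole subtree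
of `T` that is a copy of the `i'`-th tree of the chain `C_j^k` for some `i' ≥ i`; the top label
if there is none. -/
def raise [LinearOrder M] (T : OrderedTree M) (C : T.Cover) (ξ : T.Label) (i j k : ℕ) : T.Label :=
  (Finset.univ.filter fun x : T.Label => ξ ≤ x ∧
    ∃ v, ∃ hv : v ∈ T.verts,
      IsLeast {y : T.Label | ∃ l : {l // l ∈ T.leaves}, y = (l : T.Label) ∧ v <+: l.1} x ∧
      ∃ ch, (C.chain j)[k]? = some ch ∧
        ∃ i', i ≤ i' ∧ ∃ S, ch[i']? = some S ∧ S.Equivalent (T.subtree v hv)).inf id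

end OrderedTree

/-! ### Parity games -/

/-- A parity game on the node set `V`: a sinkless directed graph, the set of nodes owned by Even
(the remaining nodes are owned by Odd), and priorities in `{1, …, d}`, where `d` is even. -/
structure ParityGame (V : Type*) where
  arc : V → V → Prop
  sinkless : ∀ v, ∃ w, arc v w
  evenNodes : Set V
  d : ℕ
  even_d : Even d
  prio : V → ℕ
  one_le_prio : ∀ v, 1 ≤ prio v
  prio_le : ∀ v, prio v ≤ d

/-- `w :: l` lists the nodes of a cycle in cyclic order (a self-loop if `l` is empty). -/
def IsCycleAt {V : Type*} (A : V → V → Prop) (w : V) (l : List V) : Prop :=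
  (w :: l).Nodup ∧ (w :: (l ++ [w])).IsChain A

/-- `P` lists the nodes of a `u`-`w` path. -/
def IsPathFromTo {V : Type*} (A : V → V → Prop) (u w : V) (P : List V) : Prop :=
  P.Nodup ∧ P.IsChain A ∧ P.head? = some u ∧ P.getLast? = some w

/-- The arcs of a path. -/
def pathArc {V : Type*} (P : List V) (u v : V) : Prop := [u, v] <:+: P

namespace ParityGame

variable {V : Type*} {M : Type*} [LinearOrder M]

/-- The number `m` of arcs. -/
def numArcs (G : ParityGame V) : ℕ := {e : V × V | G.arc e.1 e.2}.ncard

/-- A (positional) strategy for Odd; the values on the nodes of Even are irrelevant. -/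
def IsOddStrategy (G : ParityGame V) (τ : V → V) : Prop :=
  ∀ v, v ∉ G.evenNodes → G.arc v (τ v)

/-- The arcs of the strategy subgraph `G_τ`. -/
def strategyArc (G : ParityGame V) (τ : V → V) (v w : V) : Prop :=
  G.arc v w ∧ (v ∉ G.evenNodes → w = τ v)

/-- There are no loose arcs in the subgraph with arc set `A`. -/
def NoLooseArcs (G : ParityGame V) (A : V → V → Prop) (T : OrderedTree M) (μ : V → T.Label) :
    Prop :=
  ∀ v w, A v w → ¬ T.Loose (G.prio v) (μ v) (μ w)

/-- `μ` is feasible in the subgraph with arc set `A`. -/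
def Feasible (G : ParityGame V) (A : V → V → Prop) (T : OrderedTree M) (μ : V → T.Label) : Prop :=
  ∃ σ : V → V, (∀ v ∈ G.evenNodes, (∃ w, A v w) → A v (σ v)) ∧
    ∀ v w, A v w → (v ∈ G.evenNodes → w = σ v) → T.NonViolated (G.prio v) (μ v) (μ w)

open Classical in
def liftNode [Fintype V] (G : ParityGame V) (A : V → V → Prop) (T : OrderedTree M) (v : V)
    (μ : V → T.Label) : V → T.Label :=
  Function.update μ v
    ((Finset.univ.filter fun w => A v w).inf fun w => T.lift (G.prio v) (μ v) (μ w))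

open Classical in
def liftArc (G : ParityGame V) (T : OrderedTree M) (v w : V) (μ : V → T.Label) : V → T.Label :=
  Function.update μ v (T.lift (G.prio v) (μ v) (μ w))

open Classical in
def dropArc (G : ParityGame V) (T : OrderedTree M) (v w : V) (μ : V → T.Label) : V → T.Label :=
  Function.update μ v (T.drop (G.prio v) (μ v) (μ w))

/-- The family of Lift operators of the subgraph with arc set `A`. -/
def liftOps [Fintype V] (G : ParityGame V) (A : V → V → Prop) (T : OrderedTree M) :
    Set ((V → T.Label) → (V → T.Label)) :=
  {φ | (∃ v ∈ G.evenNodes, φ = G.liftNode A T v) ∨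
    (∃ v w, v ∉ G.evenNodes ∧ A v w ∧ φ = G.liftArc T v w)}

/-- The family of Drop operators of the subgraph with arc set `A`. -/
def dropOps (G : ParityGame V) (A : V → V → Prop) (T : OrderedTree M) :
    Set ((V → T.Label) → (V → T.Label)) :=
  {φ | ∃ v w, A v w ∧ φ = G.dropArc T v w}

/-! ### Base nodes and the auxiliary digraph

`A` is the arc set of the 1-player game `G_τ`. -/

/-- `w` dominates an even cycle. -/
def IsBase (G : ParityGame V) (A : V → V → Prop) (w : V) : Prop :=
  Even (G.prio w) ∧ ∃ l, IsCycleAt A w l ∧ ∀ u ∈ l, G.prio u ≤ G.prio w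

/-- The arcs of the subgraph induced by the nodes of priority at most `p`. -/
def lowArc (G : ParityGame V) (A : V → V → Prop) (p : ℕ) (u v : V) : Prop :=
  A u v ∧ G.prio u ≤ p ∧ G.prio v ≤ p

/-- The nodes of `K_w`, the strongly connected component of `w` in the subgraph induced by the
nodes of priority at most `π(w)`. -/
def sccNode (G : ParityGame V) (A : V → V → Prop) (w : V) : Set V :=
  {u | Relation.ReflTransGen (G.lowArc A (G.prio w)) w u ∧
    Relation.ReflTransGen (G.lowArc A (G.prio w)) u w}

/-- The nodes of highest priority in a node set. -/
def topNodes (G : ParityGame V) (X : Set V) : Set V :=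
  {v | v ∈ X ∧ ∀ u ∈ X, G.prio u ≤ G.prio v}

/-- The arcs of `K'_w`: those of `K_w`, without the arcs entering a node of highest priority
other than `w`. -/
def sccArc' (G : ParityGame V) (A : V → V → Prop) (w u v : V) : Prop :=
  u ∈ G.sccNode A w ∧ v ∈ G.sccNode A w ∧ A u v ∧ (v ∈ G.topNodes (G.sccNode A w) → v = w)

/-- The nodes of `J_w`: those which can reach `w` in `K'_w`. -/
def jNode (G : ParityGame V) (A : V → V → Prop) (w : V) : Set V :=
  {u | u ∈ G.sccNode A w ∧ Relation.ReflTransGen (G.sccArc' A w) u w}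

/-- The arcs of `J_w`, the subgraph of `K'_w` induced by the nodes of `J_w`. -/
def jArc (G : ParityGame V) (A : V → V → Prop) (w u v : V) : Prop :=
  u ∈ G.jNode A w ∧ v ∈ G.jNode A w ∧ G.sccArc' A w u v

/-- The arcs of the auxiliary digraph `D` on the base nodes. -/
def auxArc (G : ParityGame V) (A : V → V → Prop) (v w : V) : Prop :=
  G.IsBase A v ∧ G.IsBase A w ∧
    ((v ≠ w ∧ v ∈ G.topNodes (G.jNode A w)) ∨ (v = w ∧ ∃ u, G.jArc A w w u))

/-- The width, with respect to a chain of trees, of the subgraph with arc set `B`: the least index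
of a tree of the chain for which there is a finite feasible node labeling (`⊤` if none). -/
def width (G : ParityGame V) (ch : List (OrderedTree M)) (B : V → V → Prop) : ℕ∞ :=
  sInf {x | ∃ i : ℕ, x = i ∧ ∃ S, ch[i]? = some S ∧
    ∃ ν : V → S.Label, (∀ v, ν v ≠ ⊤) ∧ G.Feasible B S ν}

/-- `ν` is the greatest simultaneous fixed point of the Drop operators of `J_w` subject to
`ν w = min L(S)`. -/
def IsLam (G : ParityGame V) (A : V → V → Prop) (S : OrderedTree M) (w : V) (ν : V → S.Label) :
    Prop :=
  IsGreatest {ν : V → S.Label | (∀ φ ∈ G.dropOps (G.jArc A w) S, φ ν = ν) ∧ ν w = S.minLabel} ν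

/-- Lower bound for the cost of the arc `vw` of `D` with respect to the chain `ch`. -/
def costLower (G : ParityGame V) (A : V → V → Prop) (ch : List (OrderedTree M)) (v w : V) : ℕ∞ :=
  sInf {x | ∃ i : ℕ, x = i ∧ ∃ S, ch[i]? = some S ∧
    ∃ ν : V → S.Label, G.IsLam A S w ν ∧ ∃ u, G.jArc A w v u ∧ ν u ≠ ⊤}

/-- Upper bound for the cost of the arc `vw` of `D` with respect to the chain `ch`. -/
def costUpper (G : ParityGame V) (A : V → V → Prop) (ch : List (OrderedTree M)) (v w : V) : ℕ∞ :=
  sInf {x | ∃ u P, G.jArc A w v u ∧ IsPathFromTo (G.jArc A w) u w P ∧ x = G.width ch (pathArc P)}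

/-- The bottleneck cost of the cycle `w :: l`. -/
def cycleCost (cost : V → V → ℕ∞) (w : V) (l : List V) : ℕ∞ :=
  (((w :: l).zip (l ++ [w])).map fun e => cost e.1 e.2).foldr max 0

/-- The minimum bottleneck cost of a cycle of `D` through `w`. -/
def minCycleCost (G : ParityGame V) (A : V → V → Prop) (cost : V → V → ℕ∞) (w : V) : ℕ∞ :=
  sInf {x | ∃ l, IsCycleAt (G.auxArc A) w l ∧ x = cycleCost cost w l}

/-! ### The label-correcting algorithm as a nondeterministic procedure -/

/-- `l` lists the arcs of the graph with arc set `A`, each of them once. -/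
def EnumeratesArcs (A : V → V → Prop) (l : List (V × V)) : Prop :=
  l.Nodup ∧ ∀ e, e ∈ l ↔ A e.1 e.2

/-- `ν'` is a possible result of Bellman–Ford started at `ν`: there are `|V| - 1` passes, each of
which applies Drop to all arcs, in an arbitrary order. -/
def IsBellmanFordOutput [Fintype V] (G : ParityGame V) (A : V → V → Prop) (T : OrderedTree M)
    (ν ν' : V → T.Label) : Prop :=
  ∃ passes : List (List (V × V)), passes.length = Fintype.card V - 1 ∧
    (∀ l ∈ passes, EnumeratesArcs A l) ∧
    ν' = passes.foldl (fun ν l => l.foldl (fun ν e => G.dropArc T e.1 e.2 ν) ν) ν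

open Classical in
/-- The initial label of `w`: for a base node the minimum, over the chains `C_j^k` with
`j = π(w)/2`, of `Raise(μ(w), i^k, j, k)`, where `i^k` is the minimum `cost^k`-cost of a cycle of
`D` through `w` and the chains with `i^k = ∞` are skipped; top for the other nodes. -/
def initialLabel (G : ParityGame V) (A : V → V → Prop) (T : OrderedTree M) (C : T.Cover)
    (μ : V → T.Label) (cost : ℕ → V → V → ℕ∞) (w : V) : T.Label :=
  if G.IsBase A w then
    (Finset.range (C.chain (G.prio w / 2)).length).inf fun k =>
      if G.minCycleCost A (cost k) w = ⊤ then ⊤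
      else T.raise C (μ w) (G.minCycleCost A (cost k) w).toNat (G.prio w / 2) k
  else ⊤

/-- `ν` is a possible result of the label-correcting algorithm: the arc costs are chosen
arbitrarily between the two bounds, the base nodes are initialized accordingly, and
Bellman–Ford is run on `G_τ`. -/
def IsLabelCorrectingOutput [Fintype V] (G : ParityGame V) (A : V → V → Prop)
    (T : OrderedTree M) (C : T.Cover) (μ ν : V → T.Label) : Prop :=
  ∃ cost : ℕ → V → V → ℕ∞,
    (∀ v w, G.auxArc A v w → ∀ k ch, (C.chain (G.prio w / 2))[k]? = some ch →
      G.costLower A ch v w ≤ cost k v w ∧ cost k v w ≤ G.costUpper A ch v w) ∧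
    G.IsBellmanFordOutput A T (G.initialLabel A T C μ cost) ν

end ParityGame

/-! ### Counting steps -/

/-- A value together with the number of steps spent on computing it. -/
structure Timed (α : Type) where
  val : α
  time : ℕ

instance : Monad Timed where
  pure a := ⟨a, 0⟩
  bind x f := ⟨(f x.val).val, x.time + (f x.val).time⟩

namespace Timed

/-- Spend `c` steps on obtaining `a`. -/
def charge {α : Type} (c : ℕ) (a : α) : Timed α := ⟨a, c⟩

/-- One elementary operation on machine words (arithmetic, comparison, moving a word, adding an
element to the front of a list, testing whether a label is top). -/
def step {α : Type} (a : α) : Timed α := charge 1 a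

/-- Arrays are functions on their index set; reading an entry is one step. -/
def read {ι α : Type} (f : ι → α) (i : ι) : Timed α := charge 1 (f i)

/-- Writing one entry of an array is one step. -/
def write {ι α : Type} [DecidableEq ι] (f : ι → α) (i : ι) (a : α) : Timed (ι → α) :=
  charge 1 (Function.update f i a)

/-- Allocating an array with one entry per element of `l`. -/
def alloc {ι α : Type} (l : List ι) (a : α) : Timed (ι → α) := charge (l.length + 1) fun _ => a

/-- `for i in l do s ← body i s`; every iteration has an overhead of one step, and so has leaving
the loop. -/
def loop {ι σ : Type} (l : List ι) (s : σ) (body : ι → σ → Timed σ) : Timed σ :=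
  match l with
  | [] => step s
  | i :: l => do
    let s ← body i s
    let s ← step s
    loop l s body

/-- The sublist of the elements that pass a test. -/
def select {ι : Type} (l : List ι) (test : ι → Timed Bool) : Timed (List ι) :=
  match l with
  | [] => step []
  | i :: l => do
    let b ← test i
    let r ← select l test
    if b then step (i :: r) else step r

end Timed

/-! ### The label-correcting algorithm as a program

Nodes are array indices, `nodes` and `arcs` list the nodes and the arcs of `G_τ`, `prio` is the
array of priorities.  Each call of Tighten, each comparison of two labels and each access to the
smallest leaf of a tree costs `γ` steps, each call of Raise costs `ρ` steps; every other
operation is built from the unit-cost operations above. -/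

namespace LabelCorrecting

open Timed

variable {V M : Type} [DecidableEq V] [LinearOrder M]

open Classical in
/-- Strict comparison of two labels. -/
def labelLt (γ : ℕ) {T : OrderedTree M} (a b : T.Label) : Timed Bool := charge γ (decide (a < b))

/-- Bellman–Ford: `n - 1` passes over the arcs; the tail label of each arc is replaced by its
drop, that is, by the value of Tighten if this is smaller. -/
def bellmanFord (γ n : ℕ) (prio : V → ℕ) (arcs : List (V × V)) (T : OrderedTree M)
    (ν : V → T.Label) : Timed (V → T.Label) :=
  loop (List.range (n - 1)) ν fun _ ν =>
    loop arcs ν fun e ν => do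
      let p ← read prio e.1
      let a ← read ν e.1
      let b ← read ν e.2
      let t ← charge γ (T.tighten p b)
      let lt ← labelLt γ t a
      if lt then write ν e.1 t else step ν

/-- Mark all nodes from which a marked node can be reached. -/
def closure (n : ℕ) (arcs : List (V × V)) (mark : V → Bool) : Timed (V → Bool) :=
  loop (List.range n) mark fun _ mark =>
    loop arcs mark fun e mark => do
      let b ← read mark e.2
      if b then write mark e.1 true else step mark

/-- The data of a node `w` in the auxiliary digraph: is `w` a base node, which nodes lie
in `K_w`, and the list of arcs of `J_w`. -/
structure AuxData (V : Type) where
  isBase : Bool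
  scc : V → Bool
  jArcs : List (V × V)

def auxData (n : ℕ) (nodes : List V) (arcs : List (V × V)) (prio : V → ℕ) (w : V) :
    Timed (AuxData V) := do
  let p ← read prio w
  -- the arcs between nodes of priority at most `p`
  let low ← select arcs fun e => do
    let q ← read prio e.1
    let r ← read prio e.2
    let b₁ ← step (decide (q ≤ p))
    let b₂ ← step (decide (r ≤ p))
    step (b₁ && b₂)
  let rev ← loop low [] fun e l => step ((e.2, e.1) :: l)
  let mark ← alloc nodes false
  let mark ← write mark w true
  -- the nodes which can reach `w`, and the nodes which can be reached from `w`
  let bwd ← closure n low mark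
  let fwd ← closure n rev mark
  let scc ← alloc nodes false
  let scc ← loop nodes scc fun v scc => do
    let b₁ ← read bwd v
    let b₂ ← read fwd v
    let b ← step (b₁ && b₂)
    write scc v b
  -- the arcs of `K'_w`
  let arcs' ← select low fun e => do
    let b₁ ← read scc e.1
    let b₂ ← read scc e.2
    let r ← read prio e.2
    let b₃ ← step (decide (r < p))
    let b₄ ← step (decide (e.2 = w))
    let b₅ ← step (b₁ && b₂)
    let b₆ ← step (b₃ || b₄)
    step (b₅ && b₆)
  -- the nodes and arcs of `J_w`
  let jNode ← closure n arcs' mark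
  let jArcs ← select arcs' fun e => read jNode e.2
  -- `w` is a base node if its priority is even and it lies on a cycle of low nodes
  let onCycle ← loop low false fun e b => do
    let b₁ ← step (decide (e.1 = w))
    let b₂ ← read bwd e.2
    let b₃ ← step (b₁ && b₂)
    step (b || b₃)
  let ev ← step (decide (p % 2 = 0))
  let isBase ← step (ev && onCycle)
  step ⟨isBase, scc, jArcs⟩

/-- Construction of the auxiliary digraph. -/
def construct (n : ℕ) (nodes : List V) (arcs : List (V × V)) (prio : V → ℕ) :
    Timed (V → AuxData V) := do
  let aux ← alloc nodes ⟨false, fun _ => false, []⟩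
  loop nodes aux fun w aux => do
    let a ← auxData n nodes arcs prio w
    write aux w a

/-- Run Bellman–Ford on `J_w`, with labels from the `i`-th tree of the chain `ch`, from the
labeling which is minimal at `w` and top elsewhere; return the nodes whose label becomes finite. -/
def probe (γ n : ℕ) (nodes : List V) (prio : V → ℕ) (jArcs : List (V × V)) (w : V)
    (ch : List (OrderedTree M)) (i : ℕ) : Timed (V → Bool) := do
  let S ← step (ch[i]?)
  let fin ← alloc nodes false
  match S with
  | none => step fin
  | some S => do
    let ν ← alloc nodes (⊤ : S.Label)
    let bot ← charge γ S.minLabel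
    let ν ← write ν w bot
    let ν ← bellmanFord γ n prio jArcs S ν
    loop nodes fin fun u fin => do
      let a ← read ν u
      let b ← step (decide (a ≠ ⊤))
      write fin u b

/-- Binary search in `[lo, hi)` for the least index at which the label of `u` is finite
(`hi` if there is none). -/
def binarySearch (γ n : ℕ) (nodes : List V) (prio : V → ℕ) (jArcs : List (V × V)) (w : V)
    (ch : List (OrderedTree M)) (u : V) : ℕ → ℕ → ℕ → Timed ℕ
  | 0, lo, _ => step lo
  | fuel + 1, lo, hi => do
    let b ← step (decide (lo < hi))
    if b then
      let s ← step (lo + hi)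
      let mid ← step (s / 2)
      let fin ← probe γ n nodes prio jArcs w ch mid
      let f ← read fin u
      if f then binarySearch γ n nodes prio jArcs w ch u fuel lo mid
      else do
        let lo' ← step (mid + 1)
        binarySearch γ n nodes prio jArcs w ch u fuel lo' hi
    else step lo

/-- For each node, the index of the first tree of the chain `ch` for which `probe` is finite at this
node: by going through the whole chain if it is short, by one binary search per node otherwise. -/
def firstFinite (γ n : ℕ) (nodes : List V) (prio : V → ℕ) (jArcs : List (V × V)) (w : V)
    (ch : List (OrderedTree M)) : Timed (V → ℕ∞) := do
  let len ← step ch.length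
  let bits ← charge (Nat.log 2 len + 1) (Nat.log 2 len + 1)
  let bound ← step (n * bits)
  let short ← step (decide (len ≤ bound))
  let idx ← alloc nodes (⊤ : ℕ∞)
  if short then
    loop (List.range len) idx fun i idx => do
      let fin ← probe γ n nodes prio jArcs w ch i
      loop nodes idx fun u idx => do
        let f ← read fin u
        let x ← read idx u
        let new ← step (decide (x = ⊤))
        let b ← step (f && new)
        if b then write idx u (i : ℕ∞) else step idx
  else
    loop nodes idx fun u idx => do
      let i ← binarySearch γ n nodes prio jArcs w ch u bits 0 len
      let b ← step (decide (i < len))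
      if b then write idx u (i : ℕ∞) else step idx

/-- The costs of the arcs of `D` which enter `w`. -/
def arcCosts (γ n : ℕ) (nodes : List V) (prio : V → ℕ) (jArcs : List (V × V)) (w : V)
    (ch : List (OrderedTree M)) : Timed (V → ℕ∞) := do
  let idx ← firstFinite γ n nodes prio jArcs w ch
  let cost ← alloc nodes (⊤ : ℕ∞)
  loop jArcs cost fun e cost => do
    let x ← read idx e.2
    let y ← read cost e.1
    let b ← step (decide (x < y))
    if b then write cost e.1 x else step cost

/-- Minimum bottleneck costs of walks inside the component `H` of `D`, by the Floyd–Warshall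
method; `dist w v` is the cost of the arc `vw` at the start and that of a best `v`-`w` walk at the
end. -/
def bottleneck (H : List V) (dist : V → V → ℕ∞) : Timed (V → V → ℕ∞) :=
  loop H dist fun x dist =>
    loop H dist fun w dist =>
      loop H dist fun v dist => do
        let rw ← read dist w
        let rx ← read dist x
        let a ← read rw x
        let b ← read rx v
        let c ← read rw v
        let ab ← step (max a b)
        let lt ← step (decide (ab < c))
        if lt then do
          let rw ← write rw v ab
          write dist w rw
        else step dist

/-- The part of the main loop for the component `H` of `D` and the `k`th chain `ch` of the subcover
`C_j`. -/
def processChain (γ ρ n : ℕ) (nodes : List V) (prio : V → ℕ) (aux : V → AuxData V)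
    (T : OrderedTree M) (C : T.Cover) (μ : V → T.Label) (H : List V) (j k : ℕ)
    (ch : List (OrderedTree M)) (ν : V → T.Label) : Timed (V → T.Label) := do
  let noCost ← alloc nodes (⊤ : ℕ∞)
  let dist ← alloc nodes noCost
  let dist ← loop H dist fun w dist => do
    let a ← read aux w
    let col ← arcCosts γ n nodes prio a.jArcs w ch
    write dist w col
  let dist ← bottleneck H dist
  loop H ν fun w ν => do
    let row ← read dist w
    let i ← read row w
    match i with
    | ⊤ => step ν
    | (i : ℕ) => do
      let a ← read μ w
      let r ← charge ρ (T.raise C a i j k)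
      let cur ← read ν w
      let lt ← labelLt γ r cur
      if lt then write ν w r else step ν

/-- The main loop over the chains of the subcover `C_j`, starting with the `k`th one. -/
def processChains (γ ρ n : ℕ) (nodes : List V) (prio : V → ℕ) (aux : V → AuxData V)
    (T : OrderedTree M) (C : T.Cover) (μ : V → T.Label) (H : List V) (j : ℕ) :
    ℕ → List (List (OrderedTree M)) → (V → T.Label) → Timed (V → T.Label)
  | _, [], ν => step ν
  | k, ch :: chs, ν => do
    let ν ← processChain γ ρ n nodes prio aux T C μ H j k ch ν
    let k' ← step (k + 1)
    processChains γ ρ n nodes prio aux T C μ H j k' chs ν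

/-- The label-correcting algorithm. -/
def run (γ ρ : ℕ) (nodes : List V) (arcs : List (V × V)) (prio : V → ℕ) (T : OrderedTree M)
    (C : T.Cover) (μ : V → T.Label) : Timed (V → T.Label) := do
  let n ← charge (nodes.length + 1) nodes.length
  let ν ← alloc nodes (⊤ : T.Label)
  let aux ← construct n nodes arcs prio
  let visited ← alloc nodes false
  -- one iteration per component of `D`; the nodes already visited are skipped
  let (ν, _) ← loop nodes (ν, visited) fun w (ν, visited) => do
    let a ← read aux w
    let seen ← read visited w
    let unseen ← step (!seen)
    let b ← step (a.isBase && unseen)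
    if b then
      let p ← read prio w
      let H ← select nodes fun v => do
        let b₁ ← read a.scc v
        let q ← read prio v
        let b₂ ← step (decide (q = p))
        step (b₁ && b₂)
      let visited ← loop H visited fun v visited => write visited v true
      let j ← step (p / 2)
      let chains ← step (C.chain j)
      let ν ← processChains γ ρ n nodes prio aux T C μ H j 0 chains ν
      step (ν, visited)
    else step (ν, visited)
  bellmanFord γ n prio arcs T ν

/-- The bound `m n² γ · max_{j,k} |C_j| min{|C_j^k|, n log |C_j^k|} + n ρ · max_j |C_j|`, where the
logarithm is rounded down to an integer and replaced by `1` if it is smaller than `1`. -/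
def timeBound (n m γ ρ : ℕ) (T : OrderedTree M) (C : T.Cover) : ℕ :=
  m * n ^ 2 * γ *
      ((Finset.range (T.height + 1)).sup fun j =>
        (Finset.univ : Finset (Fin (C.chain j).length)).sup fun k =>
          (C.chain j).length *
            min (C.chain j)[k].length (n * max 1 (Nat.log 2 (C.chain j)[k].length))) +
    n * ρ * (Finset.range (T.height + 1)).sup fun j => (C.chain j).length

end LabelCorrecting

end

/-!
Write `A` for the arc relation of `G_τ`. Two formulas reduce everything to the operator Tighten: an
arc is non-violated iff `tighten ≤` the label of its tail, hence Lift is a maximum with it and Drop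
a minimum. As nodes of Odd have one outgoing arc in `G_τ`, the simultaneous fixed points of the Lift
operators are the labelings for which every node has a non-violated outgoing arc
(`ParityGame.fixed_liftOps_iff`). They are closed under pointwise minima, so a least one `μ'` above
`μ` exists; since `μ` has no loose arcs, neither has `μ'` (`ParityGame.exists_isLeast_stable`).

Bellman–Ford never goes below a labeling without loose arcs (`ParityGame.le_relaxAll`), and it
propagates bounds along paths without violated arcs (`ParityGame.relaxAll_apply_le`). It therefore
returns `μ'` as soon as the initial labels are at least `μ'` everywhere, and at most `μ'` at some
node reached from each node with finite `μ'` by tight arcs.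

* Upper bound: following arcs which are tight for `μ'` leads to a cycle. Its top priority must be
  even, so its nodes of top priority are base nodes, and its labels lie in one whole subtree of `T`,
  a copy of the `i`th tree of some chain. Cut at the nodes of top priority, the cycle becomes a
  closed walk of `D` whose arcs have `costUpper ≤ i`, so Raise is called with an index at most `i`
  and finds a leaf at most `μ'` (`ParityGame.exists_initialLabel_le`).
* Lower bound: if a closed walk of `D` through `w` has arcs with `costLower ≤ i`, and `x ≥ μ w` is
  the smallest leaf of a copy of the `i`th tree, then transporting the greatest labelings of the
  digraphs `J` to this copy and taking minima yields a labeling above `μ` which is `x` at `w`, and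
  for which every node has a non-violated outgoing arc. Hence `μ' w ≤ x`
  (`ParityGame.apply_le_of_transGen_costLower`).

Labels are moved between trees by label maps (`OrderedTree.IsLabelMap`): embeddings of trees of the
same height, and inclusions of whole subtrees.

As to the program, Bellman–Ford on `J_w` discovers all paths to `w` and stays above the greatest
labeling, so the computed arc costs lie between the two bounds (`LabelCorrecting.arcCosts_bounds`);
whether its result is finite at a node is monotone along a chain, which justifies the binary search.
A Floyd–Warshall computation on a component gives the minimum costs of cycles
(`LabelCorrecting.bottleneck_le_iff`). The time bound is amortized: a component with `h` nodes is
processed once, at a cost proportional to `h` (`LabelCorrecting.run_time_le`).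
-/


/-! ### Ordered trees and label maps -/

namespace OrderedTree

section

variable {M : Type*} {N : Type*} {T : OrderedTree M} {S : OrderedTree N}

theorem mem_leaves {x : List M} : x ∈ T.leaves ↔ x ∈ T.verts ∧ x.length = T.height :=
  Finset.mem_filter

/-- Every vertex lies above a leaf. -/
theorem exists_leaf_append {v : List M} (hv : v ∈ T.verts) : ∃ u, v ++ u ∈ T.leaves := by
  obtain ⟨n, hn⟩ : ∃ n, n = T.height - v.length := ⟨_, rfl⟩
  induction n generalizing v with
  | zero =>
    exact ⟨[], mem_leaves.2 ⟨by simpa using hv, by have := T.length_le v hv; simp; omega⟩⟩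
  | succ n ih =>
    obtain ⟨a, ha⟩ := T.exists_child v hv (by omega)
    obtain ⟨u, hu⟩ := ih ha (by simp; omega)
    exact ⟨a :: u, by simpa using hu⟩

theorem take_mem_verts {x : List M} (hx : x ∈ T.verts) (n : ℕ) : x.take n ∈ T.verts :=
  T.prefix_closed _ (x.drop n) (by rwa [List.take_append_drop])

/-- A homomorphism shifts depths by a constant; it is not assumed to preserve the root. -/
theorem length_of_hom {f : List N → List M}
    (h : ∀ u a, u ++ [a] ∈ S.verts → ∃ b, f (u ++ [a]) = f u ++ [b]) {u : List N}
    (hu : u ∈ S.verts) : (f u).length = (f []).length + u.length := by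
  induction u using List.reverseRecOn with
  | nil => simp
  | append_singleton u a ih =>
    obtain ⟨b, hb⟩ := h u a hu
    rw [hb, List.length_append, ih (S.prefix_closed _ _ hu)]
    simp [add_assoc]

theorem append_mem_leaves {v : List M} {hv : v ∈ T.verts} {u : List M} :
    v ++ u ∈ T.leaves ↔ u ∈ (T.subtree v hv).leaves := by
  have := T.length_le v hv
  rw [mem_leaves, mem_leaves]
  simp only [subtree, Finset.mem_preimage, List.length_append]
  constructor <;> rintro ⟨h1, h2⟩ <;> exact ⟨h1, by omega⟩

/-- Truncation of labels commutes with the inclusion of a whole subtree, for the priorities which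
belong to levels inside the subtree. -/
theorem take_append_subtree {v : List M} (hv : v ∈ T.verts) {p : ℕ}
    (hp : p / 2 ≤ T.height - v.length) (x : List M) :
    (v ++ x).take (T.height - p / 2) = v ++ x.take ((T.subtree v hv).height - p / 2) := by
  have := T.length_le v hv
  rw [List.take_append, List.take_of_length_le (by omega)]
  simp only [subtree]
  congr 2
  omega

/-- The inclusion of the labels of a whole subtree; top is sent to top. -/
def subtreeLabel (T : OrderedTree M) (v : List M) (hv : v ∈ T.verts) :
    (T.subtree v hv).Label → T.Label :=
  WithTop.map fun x => ⟨v ++ x.1, append_mem_leaves.2 x.2⟩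

theorem exists_subtreeLabel_eq {v : List M} (hv : v ∈ T.verts) {l : {l // l ∈ T.leaves}}
    (h : v <+: l.1) : ∃ a, a ≠ ⊤ ∧ T.subtreeLabel v hv a = l := by
  obtain ⟨l, hl⟩ := l
  obtain ⟨u, rfl⟩ := h
  exact ⟨((⟨u, append_mem_leaves.1 hl⟩ : {x // x ∈ (T.subtree v hv).leaves}) : WithTop _),
    WithTop.coe_ne_top, rfl⟩

theorem exists_of_subtreeLabel {v : List M} (hv : v ∈ T.verts) {a : (T.subtree v hv).Label}
    (ha : a ≠ ⊤) : ∃ l : {l // l ∈ T.leaves}, T.subtreeLabel v hv a = l ∧ v <+: l.1 := by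
  obtain ⟨x, rfl⟩ := WithTop.ne_top_iff_exists.1 ha
  exact ⟨_, rfl, List.prefix_append _ _⟩

end

variable {M : Type*} {N : Type*} {L : Type*} [LinearOrder M] [LinearOrder N] [LinearOrder L]
variable {T : OrderedTree M} {S : OrderedTree N} {R : OrderedTree L}

theorem nonViolated_iff {p : ℕ} {a b : T.Label} : T.NonViolated p a b ↔ T.tighten p b ≤ a :=
  ⟨fun h => (tighten_isLeast p b).2 h, fun h => (tighten_isLeast p b).1.mono h⟩

theorem NonViolated.anti {p : ℕ} {a b b' : T.Label} (h : T.NonViolated p a b) (hb : b' ≤ b) :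
    T.NonViolated p a b' := by
  unfold NonViolated at *
  split_ifs at * with hp
  · exact (trunc_mono p hb).trans h
  · rcases h with h | ⟨rfl, h'⟩
    · exact Or.inl ((trunc_mono p hb).trans_lt h)
    · have := nonViolated_top (T := T) p b'
      rwa [NonViolated, if_neg hp] at this

theorem tighten_mono (p : ℕ) : Monotone (T.tighten p) := fun _ b h =>
  nonViolated_iff.1 ((nonViolated_iff.2 (le_refl (T.tighten p b))).anti h)

theorem not_loose_iff {p : ℕ} {a b : T.Label} : ¬ T.Loose p a b ↔ a ≤ T.tighten p b := by
  unfold Loose Tight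
  rw [nonViolated_iff]
  constructor
  · intro h
    by_contra hlt
    rw [not_le] at hlt
    exact h ⟨hlt.le, fun h' => hlt.ne ((tighten_isLeast p b).unique h')⟩
  · rintro h ⟨h1, h2⟩
    exact h2 (le_antisymm h h1 ▸ tighten_isLeast p b)

theorem drop_eq_min (p : ℕ) (a b : T.Label) : T.drop p a b = min a (T.tighten p b) := by
  refine (drop_isGreatest p a b).unique ⟨⟨min_le_left _ _, ?_⟩, ?_⟩
  · exact not_loose_iff.2 (min_le_right _ _)
  · rintro x ⟨h1, h2⟩
    exact le_min h1 (not_loose_iff.1 h2)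

theorem lift_eq_max (p : ℕ) (a b : T.Label) : T.lift p a b = max a (T.tighten p b) := by
  classical
  apply le_antisymm
  · refine Finset.inf_le (f := id) (Finset.mem_filter.2 ⟨Finset.mem_univ _, le_max_left _ _, ?_⟩)
    exact nonViolated_iff.2 (le_max_right _ _)
  · refine Finset.le_inf fun x hx => ?_
    obtain ⟨-, h1, h2⟩ := Finset.mem_filter.1 hx
    exact max_le h1 (nonViolated_iff.1 h2)

theorem minLabel_le (a : T.Label) : T.minLabel ≤ a := Finset.inf_le (f := id) (Finset.mem_univ a)

theorem nonViolated_coe {p : ℕ} {x y : {x : List M // x ∈ T.leaves}} :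
    T.NonViolated p (x : T.Label) (y : T.Label) ↔
      if Even p then y.1.take (T.height - p / 2) ≤ x.1.take (T.height - p / 2)
      else y.1.take (T.height - p / 2) < x.1.take (T.height - p / 2) := by
  unfold NonViolated trunc
  split_ifs with hp
  · simp only [WithTop.map_coe, WithTop.coe_le_coe]
  · simp only [WithTop.map_coe, WithTop.coe_lt_coe, WithTop.coe_ne_top, false_and, or_false]

theorem not_nonViolated_coe_top {p : ℕ} {x : {x : List M // x ∈ T.leaves}} :
    ¬ T.NonViolated p (x : T.Label) ⊤ := by
  unfold NonViolated trunc
  split_ifs with hp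
  · simp
  · simp

theorem NonViolated.ne_top {p : ℕ} {a b : T.Label} (h : T.NonViolated p a b) (ha : a ≠ ⊤) :
    b ≠ ⊤ := by
  rintro rfl
  lift a to {x : List M // x ∈ T.leaves} using ha
  exact not_nonViolated_coe_top h

/-- A map between label sets which transports labelings of graphs with priorities at most `q`:
it is monotone, detects the top label, and takes non-violated arcs to non-violated arcs. -/
structure IsLabelMap (q : ℕ) (g : S.Label → T.Label) : Prop where
  mono : Monotone g
  eq_top : ∀ {a}, g a = ⊤ ↔ a = ⊤
  nonViolated : ∀ {p a b}, p ≤ q → S.NonViolated p a b → T.NonViolated p (g a) (g b)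

theorem IsLabelMap.comp {q : ℕ} {g : S.Label → T.Label} {h : R.Label → S.Label}
    (hg : IsLabelMap q g) (hh : IsLabelMap q h) : IsLabelMap q (g ∘ h) where
  mono := hg.mono.comp hh.mono
  eq_top := hg.eq_top.trans hh.eq_top
  nonViolated hp H := hg.nonViolated hp (hh.nonViolated hp H)

theorem IsLabelMap.tighten_le {q p : ℕ} {g : S.Label → T.Label} (hg : IsLabelMap q g)
    (hp : p ≤ q) (b : S.Label) : T.tighten p (g b) ≤ g (S.tighten p b) :=
  nonViolated_iff.1 (hg.nonViolated hp (nonViolated_iff.2 le_rfl))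

/-- The criterion for a map of leaves to induce a label map: it preserves and reflects comparisons
of truncations. -/
theorem isLabelMap_map {q : ℕ} (f : {x : List N // x ∈ S.leaves} → {x : List M // x ∈ T.leaves})
    (hf : StrictMono f)
    (h : ∀ p ≤ q, ∀ x y, (x.1.take (S.height - p / 2) ≤ y.1.take (S.height - p / 2) →
        (f x).1.take (T.height - p / 2) ≤ (f y).1.take (T.height - p / 2)) ∧
      (x.1.take (S.height - p / 2) < y.1.take (S.height - p / 2) →
        (f x).1.take (T.height - p / 2) < (f y).1.take (T.height - p / 2))) :
    IsLabelMap q (WithTop.map f : S.Label → T.Label) where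
  mono := hf.monotone.withTop_map
  eq_top := WithTop.map_eq_top_iff
  nonViolated {p a b} hp H := by
    induction a using WithTop.recTopCoe with
    | top => exact nonViolated_top _ _
    | coe x =>
      obtain ⟨y, rfl⟩ := WithTop.ne_top_iff_exists.1 (H.ne_top (WithTop.coe_ne_top))
      rw [nonViolated_coe] at H
      rw [WithTop.map_coe, WithTop.map_coe, nonViolated_coe]
      split_ifs at * with he
      · exact (h p hp y x).1 H
      · exact (h p hp y x).2 H

theorem Embeds.height_le (h : S.Embeds T) : S.height ≤ T.height := by
  obtain ⟨f, -, -, hc, -, hl⟩ := h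
  obtain ⟨u, hu⟩ := S.exists_leaf_append S.root_mem
  have h1 := length_of_hom hc (mem_leaves.1 hu).1
  have h2 := (mem_leaves.1 (hl _ hu)).2
  have h3 := (mem_leaves.1 hu).2
  omega

theorem Equivalent.height_eq (h : S.Equivalent T) : S.height = T.height :=
  le_antisymm h.1.height_le h.2.height_le

theorem Embeds.refl (T : OrderedTree M) : T.Embeds T :=
  ⟨id, fun _ h => h, fun _ _ _ _ h => h, fun _ a _ => ⟨a, rfl⟩, fun _ _ _ _ h => h, fun _ h => h⟩

/-- Embeddings between trees of the same height induce label maps. -/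
theorem Embeds.exists_isLabelMap (h : S.Embeds T) (hh : S.height = T.height) :
    ∃ g : S.Label → T.Label, ∀ q, IsLabelMap q g := by
  obtain ⟨f, hv, hi, hc, hm, hl⟩ := h
  have hlen : ∀ u ∈ S.verts, (f u).length = u.length := by
    obtain ⟨u, hu⟩ := S.exists_leaf_append S.root_mem
    have h1 := length_of_hom hc (mem_leaves.1 hu).1
    have h2 := (mem_leaves.1 (hl _ hu)).2
    have h3 := (mem_leaves.1 hu).2
    intro w hw
    have := length_of_hom hc hw
    omega
  have hpre : ∀ u w, u ++ w ∈ S.verts → f u <+: f (u ++ w) := by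
    intro u w
    induction w using List.reverseRecOn with
    | nil => intro _; simp
    | append_singleton w a ih =>
      intro hw
      rw [← List.append_assoc] at hw ⊢
      obtain ⟨b, hb⟩ := hc _ _ hw
      rw [hb]
      exact (ih (S.prefix_closed _ _ hw)).trans (List.prefix_append _ _)
  have htake : ∀ x ∈ S.verts, ∀ n, (f x).take n = f (x.take n) := by
    intro x hx n
    have h1 := hpre (x.take n) (x.drop n) (by rwa [List.take_append_drop])
    rw [List.take_append_drop, List.prefix_iff_eq_take,
      hlen _ (take_mem_verts hx n), List.length_take] at h1
    rw [h1]
    rcases le_total n x.length with h | h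
    · rw [min_eq_left h]
    · rw [min_eq_right h, List.take_of_length_le (by rw [hlen x hx]; exact h),
        List.take_of_length_le (by rw [hlen x hx])]
  have hlt : ∀ u ∈ S.verts, ∀ v ∈ S.verts, u < v → f u < f v := fun u hu v hv h =>
    lt_of_le_of_ne (hm u hu v hv h.le) fun he => h.ne (hi u hu v hv he)
  refine ⟨WithTop.map fun x => ⟨f x.1, hl _ x.2⟩, fun q => isLabelMap_map _ ?_ ?_⟩
  · intro x y hxy
    exact hlt _ (mem_leaves.1 x.2).1 _ (mem_leaves.1 y.2).1 hxy
  · intro p _ x y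
    have hx := (mem_leaves.1 x.2).1
    have hy := (mem_leaves.1 y.2).1
    dsimp only
    rw [← hh, htake _ hx, htake _ hy]
    exact ⟨hm _ (take_mem_verts hx _) _ (take_mem_verts hy _),
      hlt _ (take_mem_verts hx _) _ (take_mem_verts hy _)⟩

theorem append_lt_append_left_iff (v x y : List M) : v ++ x < v ++ y ↔ x < y := by
  induction v with
  | nil => simp
  | cons a v ih => simp [ih]

theorem append_le_append_left_iff (v x y : List M) : v ++ x ≤ v ++ y ↔ x ≤ y := by
  rw [← not_lt, ← not_lt, append_lt_append_left_iff]

theorem isLabelMap_subtreeLabel {v : List M} (hv : v ∈ T.verts) {q : ℕ}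
    (hq : q / 2 ≤ T.height - v.length) : IsLabelMap q (T.subtreeLabel v hv) := by
  refine isLabelMap_map _ ?_ ?_
  · intro x y hxy
    exact (append_lt_append_left_iff v x.1 y.1).2 hxy
  · intro p hp x y
    dsimp only
    have hp' : p / 2 ≤ T.height - v.length := (Nat.div_le_div_right hp).trans hq
    rw [take_append_subtree hv hp', take_append_subtree hv hp', append_lt_append_left_iff,
      append_le_append_left_iff]
    exact ⟨id, id⟩

theorem nonViolated_of_subtreeLabel {v : List M} (hv : v ∈ T.verts) {p : ℕ}
    (hp : p / 2 ≤ T.height - v.length) {a b : (T.subtree v hv).Label} (ha : a ≠ ⊤) (hb : b ≠ ⊤)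
    (h : T.NonViolated p (T.subtreeLabel v hv a) (T.subtreeLabel v hv b)) :
    (T.subtree v hv).NonViolated p a b := by
  obtain ⟨x, rfl⟩ := WithTop.ne_top_iff_exists.1 ha
  obtain ⟨y, rfl⟩ := WithTop.ne_top_iff_exists.1 hb
  simp only [subtreeLabel, WithTop.map_coe] at h
  rw [nonViolated_coe] at h ⊢
  rwa [take_append_subtree hv hp, take_append_subtree hv hp, append_lt_append_left_iff,
    append_le_append_left_iff] at h

/-- If the head of an arc has a label below `v` and the tail has the even priority belonging to the
depth of `v`, then the label which makes the arc tight is the smallest leaf below `v`. -/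
theorem tighten_isLeast_prefix {v : List M} {p : ℕ} (hp : Even p)
    (hv : v.length = T.height - p / 2) {l : {l // l ∈ T.leaves}} (hl : v <+: l.1) :
    IsLeast {y : T.Label | ∃ l : {l // l ∈ T.leaves}, y = (l : T.Label) ∧ v <+: l.1}
      (T.tighten p l) := by
  have key : ∀ l : {l // l ∈ T.leaves}, v <+: l.1 ↔ l.1.take (T.height - p / 2) = v := by
    intro l
    rw [List.prefix_iff_eq_take, hv, eq_comm]
  have hup : ∀ y : {l // l ∈ T.leaves}, T.NonViolated p y l ↔
      v ≤ y.1.take (T.height - p / 2) := by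
    intro y
    rw [nonViolated_coe, if_pos hp, (key l).1 hl]
  have hle : T.tighten p l ≤ l := nonViolated_iff.1 ((hup l).2 ((key l).1 hl).ge)
  obtain ⟨t, ht⟩ := WithTop.ne_top_iff_exists.1 (ne_top_of_le_ne_top WithTop.coe_ne_top hle)
  constructor
  · refine ⟨t, ht.symm, (key t).2 (le_antisymm ?_ ?_)⟩
    · have := trunc_mono p hle
      rw [← ht] at this
      simp only [trunc, WithTop.map_coe, WithTop.coe_le_coe] at this
      exact this.trans ((key l).1 hl).le
    · exact (hup t).1 (nonViolated_iff.2 ht.ge)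
  · rintro y ⟨y, rfl, hy⟩
    exact nonViolated_iff.1 ((hup y).2 ((key y).1 hy).ge)

end OrderedTree


/-! ### Paths and cycles -/

section Paths

variable {V : Type*} {A B : V → V → Prop}

theorem exists_path_of_reflTransGen {u w : V} (h : Relation.ReflTransGen A u w) :
    ∃ P, IsPathFromTo A u w P := by
  induction h using Relation.ReflTransGen.head_induction_on with
  | refl => exact ⟨[w], by simp [IsPathFromTo]⟩
  | @head a b hab _ ih =>
    obtain ⟨P, hnd, hch, hh, hl⟩ := ih
    by_cases ha : a ∈ P
    · obtain ⟨P₁, P₂, rfl⟩ := List.append_of_mem ha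
      refine ⟨a :: P₂, (List.nodup_append.1 hnd).2.1, (List.isChain_append.1 hch).2.1, rfl, ?_⟩
      rwa [List.getLast?_append_of_ne_nil _ (by simp)] at hl
    · cases P with
      | nil => simp at hh
      | cons c P =>
        obtain rfl : c = b := by simpa using hh
        exact ⟨a :: c :: P, List.nodup_cons.2 ⟨ha, hnd⟩, List.isChain_cons_cons.2 ⟨hab, hch⟩, rfl,
          by simpa using hl⟩

theorem exists_cycle_of_transGen {w : V} (h : Relation.TransGen A w w) :
    ∃ l, IsCycleAt A w l := by
  obtain ⟨u, hu, h⟩ := Relation.TransGen.head'_iff.1 h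
  obtain ⟨P, hnd, hch, hh, hl⟩ := exists_path_of_reflTransGen h
  obtain ⟨l, rfl⟩ := List.getLast?_eq_some_iff.1 hl
  refine ⟨l, ?_, ?_⟩
  · exact ((List.perm_append_singleton w l).nodup_iff).1 hnd
  · cases hP : l ++ [w] with
    | nil => simp at hP
    | cons c P =>
      rw [hP] at hh hch
      obtain rfl : c = u := by simpa using hh
      exact List.isChain_cons_cons.2 ⟨hu, hch⟩

theorem transGen_of_isChain_cons {u w : V} {l : List V} (h : (u :: (l ++ [w])).IsChain A) :
    Relation.TransGen A u w := by
  induction l generalizing u with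
  | nil => exact .single (by simpa using h)
  | cons a l ih =>
    obtain ⟨h1, h2⟩ := List.isChain_cons_cons.1 h
    exact .head h1 (ih h2)

theorem IsCycleAt.transGen {w : V} {l : List V} (h : IsCycleAt A w l) :
    Relation.TransGen A w w := transGen_of_isChain_cons h.2

theorem exists_cycle_iff_transGen {w : V} : (∃ l, IsCycleAt A w l) ↔ Relation.TransGen A w w :=
  ⟨fun ⟨_, h⟩ => h.transGen, exists_cycle_of_transGen⟩

theorem rel_of_pathArc {P : List V} (h : P.IsChain A) {u v : V} (huv : pathArc P u v) : A u v := by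
  obtain ⟨s, t, rfl⟩ := huv
  have := (List.isChain_append.1 (List.isChain_append.1 h).1).2.1
  simpa using this

theorem pathArc_unique {P : List V} (hP : P.Nodup) {u v w : V} (hv : pathArc P u v)
    (hw : pathArc P u w) : v = w := by
  obtain ⟨s, t, hs⟩ := hv
  obtain ⟨s', t', hs'⟩ := hw
  have e1 : P[s.length]? = some u := by simp [← hs]
  have e2 : P[s'.length]? = some u := by simp [← hs']
  have e3 : P[s.length + 1]? = some v := by simp [← hs]
  have e4 : P[s'.length + 1]? = some w := by simp [← hs']
  have h1 := (List.getElem?_eq_some_iff.1 e1).1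
  have : s.length = s'.length := (List.getElem?_inj h1 hP).1 (e1.trans e2.symm)
  rw [this] at e3
  exact Option.some.inj (e3.symm.trans e4)

theorem isChain_pathArc (P : List V) : P.IsChain (pathArc P) := by
  suffices H : ∀ (Q s : List V), s ++ Q = P → Q.IsChain (pathArc P) from H P [] rfl
  intro Q
  induction Q with
  | nil => intro _ _; exact List.isChain_nil
  | cons a Q ih =>
    intro s hs
    cases Q with
    | nil => exact List.isChain_singleton a
    | cons b Q =>
      exact List.isChain_cons_cons.2 ⟨⟨s, Q, by simpa using hs⟩, ih (s ++ [a]) (by simpa using hs)⟩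

end Paths

/-! ### Bellman–Ford -/

namespace ParityGame

open OrderedTree

variable {V : Type*} {M N : Type*} [LinearOrder M] [LinearOrder N] (G : ParityGame V)
  {A : V → V → Prop} {T : OrderedTree M} {S : OrderedTree N}

/-- One pass of Bellman–Ford over a list of arcs. -/
noncomputable def relax (T : OrderedTree M) (l : List (V × V)) (ν : V → T.Label) : V → T.Label :=
  l.foldl (fun ν e => G.dropArc T e.1 e.2 ν) ν

/-- Bellman–Ford with a given list of passes. -/
noncomputable def relaxAll (T : OrderedTree M) (passes : List (List (V × V))) (ν : V → T.Label) :
    V → T.Label :=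
  passes.foldl (fun ν l => G.relax T l ν) ν

variable {G}

theorem dropArc_le (v w : V) (ν : V → T.Label) : G.dropArc T v w ν ≤ ν := by
  classical
  intro x
  unfold dropArc
  by_cases hx : x = v
  · subst hx; simp [drop_eq_min]
  · simp [Function.update_of_ne hx]

theorem dropArc_self (v w : V) (ν : V → T.Label) :
    G.dropArc T v w ν v = min (ν v) (T.tighten (G.prio v) (ν w)) := by
  simp [dropArc, drop_eq_min]

theorem dropArc_of_ne {v x : V} (h : x ≠ v) (w : V) (ν : V → T.Label) :
    G.dropArc T v w ν x = ν x := by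
  classical
  simp [dropArc, Function.update_of_ne h]

theorem le_dropArc {κ ν : V → T.Label} {v w : V} (h : κ ≤ ν)
    (hκ : κ v ≤ T.tighten (G.prio v) (κ w)) : κ ≤ G.dropArc T v w ν := by
  intro x
  by_cases hx : x = v
  · subst hx
    rw [dropArc_self]
    exact le_min (h x) (hκ.trans (tighten_mono _ (h w)))
  · rw [dropArc_of_ne hx]; exact h x

theorem relax_le (l : List (V × V)) (ν : V → T.Label) : G.relax T l ν ≤ ν := by
  induction l generalizing ν with
  | nil => exact le_rfl
  | cons e l ih => exact (ih _).trans (dropArc_le _ _ _)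

theorem relaxAll_le (ps : List (List (V × V))) (ν : V → T.Label) : G.relaxAll T ps ν ≤ ν := by
  induction ps generalizing ν with
  | nil => exact le_rfl
  | cons l ps ih => exact (ih _).trans (relax_le _ _)

theorem le_relax {κ ν : V → T.Label} {l : List (V × V)} (h : κ ≤ ν)
    (hκ : ∀ e ∈ l, κ e.1 ≤ T.tighten (G.prio e.1) (κ e.2)) : κ ≤ G.relax T l ν := by
  induction l generalizing ν with
  | nil => exact h
  | cons e l ih =>
    exact ih (le_dropArc h (hκ e (by simp))) fun e he => hκ e (by simp [he])

/-- A labeling without loose arcs remains a lower bound during Bellman–Ford. -/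
theorem le_relaxAll {κ ν : V → T.Label} {ps : List (List (V × V))} (h : κ ≤ ν)
    (hκ : ∀ l ∈ ps, ∀ e ∈ l, κ e.1 ≤ T.tighten (G.prio e.1) (κ e.2)) :
    κ ≤ G.relaxAll T ps ν := by
  induction ps generalizing ν with
  | nil => exact h
  | cons l ps ih =>
    exact ih (le_relax h (hκ l (by simp))) fun l hl => hκ l (by simp [hl])

theorem relax_apply_le {u v : V} {l : List (V × V)} (h : (u, v) ∈ l) {ν : V → T.Label}
    {b : T.Label} (hb : ν v ≤ b) : G.relax T l ν u ≤ T.tighten (G.prio u) b := by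
  induction l generalizing ν with
  | nil => simp at h
  | cons e l ih =>
    rcases List.mem_cons.1 h with rfl | h
    · refine (relax_le (G := G) l _ u).trans ?_
      change G.dropArc T u v ν u ≤ _
      rw [dropArc_self]
      exact (min_le_right _ _).trans (tighten_mono _ hb)
    · exact ih h ((dropArc_le (G := G) _ _ _ v).trans hb)

/-- Along a path without violated arcs, labels propagate from its end to its start within as many
passes of Bellman–Ford as the path has arcs. -/
theorem relaxAll_apply_le {u w : V} {P : List V} {κ ν : V → T.Label}
    {ps : List (List (V × V))}
    (hP : P.IsChain fun x y => (∀ l ∈ ps, (x, y) ∈ l) ∧ T.NonViolated (G.prio x) (κ x) (κ y))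
    (hu : P.head? = some u) (hw : P.getLast? = some w) (hν : ν w ≤ κ w)
    (hlen : P.length ≤ ps.length + 1) : G.relaxAll T ps ν u ≤ κ u := by
  induction P generalizing u ps with
  | nil => simp at hu
  | cons a P ih =>
    obtain rfl : a = u := by simpa using hu
    cases P with
    | nil =>
      obtain rfl : a = w := by simpa using hw
      exact (relaxAll_le _ _ _).trans hν
    | cons b P =>
      obtain ⟨h1, h2⟩ := List.isChain_cons_cons.1 hP
      rcases List.eq_nil_or_concat ps with rfl | ⟨ps, l, rfl⟩
      · simp at hlen
      have hb : G.relaxAll T ps ν b ≤ κ b := by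
        refine ih (h2.imp fun x y h => ⟨fun l hl => h.1 l ?_, h.2⟩) rfl (by simpa using hw) ?_
        · simpa using hlen
        · simp [hl]
      have : G.relaxAll T (ps.concat l) ν = G.relax T l (G.relaxAll T ps ν) := by
        simp [relaxAll]
      rw [this]
      exact (relax_apply_le (h1.1 l (by simp)) hb).trans (nonViolated_iff.1 h1.2)

/-- Bellman–Ford commutes, up to an inequality, with a label map. -/
theorem relax_le_comp {q : ℕ} {g : S.Label → T.Label} (hg : IsLabelMap q g) {l : List (V × V)}
    (hl : ∀ e ∈ l, G.prio e.1 ≤ q) {ν : V → S.Label} {ν' : V → T.Label} (h : ν' ≤ g ∘ ν) :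
    G.relax T l ν' ≤ g ∘ G.relax S l ν := by
  induction l generalizing ν ν' with
  | nil => exact h
  | cons e l ih =>
    refine ih (fun e he => hl e (by simp [he])) fun x => ?_
    change G.dropArc T e.1 e.2 ν' x ≤ g (G.dropArc S e.1 e.2 ν x)
    by_cases hx : x = e.1
    · subst hx
      rw [dropArc_self, dropArc_self, hg.mono.map_min]
      exact min_le_min (h _) ((tighten_mono _ (h _)).trans (hg.tighten_le (hl e (by simp)) _))
    · rw [dropArc_of_ne hx, dropArc_of_ne hx]
      exact h x

theorem relaxAll_le_comp {q : ℕ} {g : S.Label → T.Label} (hg : IsLabelMap q g)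
    {ps : List (List (V × V))} (hl : ∀ l ∈ ps, ∀ e ∈ l, G.prio e.1 ≤ q) {ν : V → S.Label}
    {ν' : V → T.Label} (h : ν' ≤ g ∘ ν) : G.relaxAll T ps ν' ≤ g ∘ G.relaxAll S ps ν := by
  induction ps generalizing ν ν' with
  | nil => exact h
  | cons l ps ih =>
    exact ih (fun l hl' => hl l (by simp [hl'])) (relax_le_comp hg (hl l (by simp)) h)

/-! ### The least stable labeling -/

theorem noLooseArcs_iff {μ : V → T.Label} : G.NoLooseArcs A T μ ↔
    ∀ v w, A v w → μ v ≤ T.tighten (G.prio v) (μ w) := by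
  unfold NoLooseArcs
  simp only [not_loose_iff]

theorem exists_strategyArc {τ : V → V} (hτ : G.IsOddStrategy τ) (v : V) :
    ∃ w, G.strategyArc τ v w := by
  by_cases hv : v ∈ G.evenNodes
  · obtain ⟨w, hw⟩ := G.sinkless v
    exact ⟨w, hw, fun h => absurd hv h⟩
  · exact ⟨τ v, hτ v hv, fun _ => rfl⟩

/-- As each node of Odd has only one outgoing arc in `G_τ`, the simultaneous fixed points of the
Lift operators are the labelings for which every node has a non-violated outgoing arc. -/
theorem fixed_liftOps_iff [Fintype V] {τ : V → V} (hτ : G.IsOddStrategy τ) {ν : V → T.Label} :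
    (∀ φ ∈ G.liftOps (G.strategyArc τ) T, φ ν = ν) ↔
      ∀ v, ∃ w, G.strategyArc τ v w ∧ T.NonViolated (G.prio v) (ν v) (ν w) := by
  classical
  constructor
  · intro h v
    by_cases hv : v ∈ G.evenNodes
    · have h1 := congr_fun (h _ (Or.inl ⟨v, hv, rfl⟩)) v
      simp only [liftNode, Function.update_self] at h1
      obtain ⟨w₀, hw₀⟩ := exists_strategyArc hτ v
      obtain ⟨w, hw, he⟩ := Finset.exists_mem_eq_inf
        (Finset.univ.filter fun w => G.strategyArc τ v w) ⟨w₀, by simpa using hw₀⟩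
        fun w => T.lift (G.prio v) (ν v) (ν w)
      refine ⟨w, (Finset.mem_filter.1 hw).2, nonViolated_iff.2 ?_⟩
      have h2 : T.lift (G.prio v) (ν v) (ν w) = ν v := by
        rw [← he, ← h1]
        simp only [h1]
      rw [lift_eq_max] at h2
      exact (le_max_right _ _).trans h2.le
    · obtain ⟨w, hw⟩ := exists_strategyArc hτ v
      have h1 := congr_fun (h _ (Or.inr ⟨v, w, hv, hw, rfl⟩)) v
      simp only [liftArc, Function.update_self, lift_eq_max] at h1
      exact ⟨w, hw, nonViolated_iff.2 ((le_max_right _ _).trans h1.le)⟩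
  · rintro h φ (⟨v, hv, rfl⟩ | ⟨v, w, hv, hw, rfl⟩)
    · unfold liftNode
      rw [Function.update_eq_self_iff]
      obtain ⟨w, hw, hvw⟩ := h v
      apply le_antisymm
      · refine (Finset.inf_le (Finset.mem_filter.2 ⟨Finset.mem_univ w, hw⟩)).trans ?_
        rw [lift_eq_max]
        exact max_le le_rfl (nonViolated_iff.1 hvw)
      · refine Finset.le_inf fun w _ => ?_
        rw [lift_eq_max]
        exact le_max_left _ _
    · unfold liftArc
      rw [Function.update_eq_self_iff]
      obtain ⟨w', hw', hvw⟩ := h v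
      rw [hw.2 hv, ← hw'.2 hv, lift_eq_max, max_eq_left (nonViolated_iff.1 hvw)]

/-- Above a labeling without loose arcs, there is a least labeling for which every node has a
non-violated outgoing arc, and it has no loose arcs either. -/
theorem exists_isLeast_stable [Finite V] (hA : ∀ v, ∃ w, A v w) {μ : V → T.Label}
    (hμ : G.NoLooseArcs A T μ) :
    ∃ μ' : V → T.Label,
      IsLeast {ν | μ ≤ ν ∧ ∀ v, ∃ w, A v w ∧ T.NonViolated (G.prio v) (ν v) (ν w)} μ' ∧
      G.NoLooseArcs A T μ' := by
  classical
  have := Fintype.ofFinite V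
  set F : Finset (V → T.Label) := Finset.univ.filter fun ν =>
    μ ≤ ν ∧ ∀ v, ∃ w, A v w ∧ T.NonViolated (G.prio v) (ν v) (ν w) with hF
  have htop : (fun _ => ⊤) ∈ F := by
    simp only [hF, Finset.mem_filter, Finset.mem_univ, true_and]
    exact ⟨fun _ => le_top, fun v => (hA v).imp fun w hw => ⟨hw, nonViolated_top _ _⟩⟩
  let μ' : V → T.Label := fun v => F.inf fun ν => ν v
  have hle : ∀ ν ∈ F, μ' ≤ ν := fun ν hν v => Finset.inf_le (f := fun ν : V → T.Label => ν v) hν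
  have hμ' : μ ≤ μ' := fun v => Finset.le_inf fun ν hν => (Finset.mem_filter.1 hν).2.1 v
  have hst : ∀ v, ∃ w, A v w ∧ T.NonViolated (G.prio v) (μ' v) (μ' w) := by
    intro v
    obtain ⟨ν, hν, he⟩ := Finset.exists_mem_eq_inf F ⟨_, htop⟩ fun ν => ν v
    obtain ⟨w, hw, hvw⟩ := (Finset.mem_filter.1 hν).2.2 v
    have he' : μ' v = ν v := he
    exact ⟨w, hw, he' ▸ hvw.anti (hle ν hν w)⟩
  refine ⟨μ', ⟨⟨hμ', hst⟩, fun ν hν => hle ν (by simpa [hF] using hν)⟩, ?_⟩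
  rw [noLooseArcs_iff] at hμ ⊢
  intro v w hvw
  -- lowering the label of `v` to the one which makes `vw` tight would yield a smaller labeling
  by_contra hlt
  rw [not_le] at hlt
  set ν := Function.update μ' v (T.tighten (G.prio v) (μ' w)) with hν
  have hνle : ν ≤ μ' := by
    rw [hν, update_le_iff]
    exact ⟨hlt.le, fun _ _ => le_rfl⟩
  have hmem : ν ∈ F := by
    simp only [hF, Finset.mem_filter, Finset.mem_univ, true_and]
    constructor
    · rw [hν, le_update_iff]
      exact ⟨(hμ v w hvw).trans (tighten_mono _ (hμ' w)), fun x _ => hμ' x⟩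
    · intro x
      by_cases hx : x = v
      · subst hx
        refine ⟨w, hvw, NonViolated.anti (nonViolated_iff.2 ?_) (hνle w)⟩
        simp [hν]
      · obtain ⟨y, hy, hxy⟩ := hst x
        refine ⟨y, hy, NonViolated.anti ?_ (hνle y)⟩
        rwa [hν, Function.update_of_ne hx]
  have := hle ν hmem v
  rw [hν, Function.update_self] at this
  exact absurd this (not_le.2 hlt)

end ParityGame


/-! ### Covers and the auxiliary digraph -/

namespace OrderedTree

variable {M : Type*} [LinearOrder M] {T : OrderedTree M}

theorem Cover.height_eq (C : T.Cover) {j : ℕ} (hj : j ≤ T.height) {ch : List (OrderedTree M)}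
    (hch : ch ∈ C.chain j) {S : OrderedTree M} (hS : S ∈ ch) : S.height = j := by
  obtain ⟨v, hv, hl, he⟩ := C.isSubtree j hj ch hch S hS
  rw [he.height_eq]
  simp only [subtree]
  omega

theorem embeds_of_pairwise {ch : List (OrderedTree M)} (h : ch.Pairwise StrictEmbeds) {a b : ℕ}
    (hab : a ≤ b) {S S' : OrderedTree M} (hS : ch[a]? = some S) (hS' : ch[b]? = some S') :
    S.Embeds S' := by
  rcases hab.eq_or_lt with rfl | hab
  · rw [hS] at hS'
    obtain rfl := Option.some.inj hS'
    exact Embeds.refl S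
  · obtain ⟨ha, rfl⟩ := List.getElem?_eq_some_iff.1 hS
    obtain ⟨hb, rfl⟩ := List.getElem?_eq_some_iff.1 hS'
    exact (List.pairwise_iff_getElem.1 h a b ha hb hab).1

/-- Along a non-violated arc, truncations at the priority of the tail or a higher one do not
increase. -/
theorem NonViolated.trunc_le {p q : ℕ} (hpq : q ≤ p) {a b : T.Label} (h : T.NonViolated q a b) :
    T.trunc p b ≤ T.trunc p a := by
  have hle : T.trunc q b ≤ T.trunc q a := by
    unfold NonViolated at h
    split_ifs at h
    · exact h
    · rcases h with h | ⟨rfl, rfl⟩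
      · exact h.le
      · exact le_rfl
  rcases hle.lt_or_eq with hlt | heq
  · refine trunc_mono p (le_of_not_gt fun hab => ?_)
    exact hlt.not_ge (trunc_mono q hab.le)
  -- the coarser truncation factors through the finer one
  · have key : ∀ c : T.Label,
        T.trunc p c = (T.trunc q c).map fun x => x.take (T.height - p / 2) := by
      intro c
      induction c using WithTop.recTopCoe with
      | top => rfl
      | coe c =>
        simp only [trunc, WithTop.map_coe, List.take_take]
        rw [min_eq_left (Nat.sub_le_sub_left (Nat.div_le_div_right hpq) _)]
    rw [key, key, heq]

end OrderedTree

theorem ENat.exists_mem_le_of_sInf_le {s : Set ℕ∞} {n : ℕ} (h : sInf s ≤ n) :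
    ∃ m : ℕ, (m : ℕ∞) ∈ s ∧ m ≤ n := by
  rcases s.eq_empty_or_nonempty with rfl | hs
  · simp at h
  · obtain ⟨m, hm⟩ := ENat.ne_top_iff_exists.1 (ne_top_of_le_ne_top (ENat.natCast_ne_top n) h)
    refine ⟨m, hm ▸ csInf_mem hs, ?_⟩
    rw [← hm] at h
    exact_mod_cast h

theorem List.IsChain.exists_rel_of_mem {V : Type*} {A : V → V → Prop} {a : V} {l : List V}
    (h : (a :: l).IsChain A) {x : V} (hx : x ∈ l) : ∃ y, A y x := by
  induction l generalizing a with
  | nil => simp at hx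
  | cons b l ih =>
    obtain ⟨h1, h2⟩ := List.isChain_cons_cons.1 h
    rcases List.mem_cons.1 hx with rfl | hx
    · exact ⟨a, h1⟩
    · exact ih h2 hx

theorem List.IsChain.and {V : Type*} {A B : V → V → Prop} {l : List V} (hA : l.IsChain A)
    (hB : l.IsChain B) : l.IsChain fun a b => A a b ∧ B a b := by
  induction l with
  | nil => exact List.isChain_nil
  | cons a l ih =>
    cases l with
    | nil => exact List.isChain_singleton a
    | cons b l =>
      rw [List.isChain_cons_cons] at *
      exact ⟨⟨hA.1, hB.1⟩, ih hA.2 hB.2⟩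

namespace ParityGame

open OrderedTree Relation

variable {V : Type*} {M N : Type*} [LinearOrder M] [LinearOrder N] {G : ParityGame V}
  {A : V → V → Prop} {T : OrderedTree M} {S : OrderedTree N}

theorem cycleCost_le_iff {cost : V → V → ℕ∞} {w : V} {l : List V} {c : ℕ∞} :
    cycleCost cost w l ≤ c ↔ (w :: (l ++ [w])).IsChain fun a b => cost a b ≤ c := by
  suffices H : ∀ u : V, (((u :: l).zip (l ++ [w])).map fun e => cost e.1 e.2).foldr max 0 ≤ c ↔
      (u :: (l ++ [w])).IsChain fun a b => cost a b ≤ c from H w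
  induction l with
  | nil => intro u; simp
  | cons a l ih =>
    intro u
    rw [List.cons_append, List.isChain_cons_cons, ← ih a]
    simp only [List.zip_cons_cons, List.map_cons, List.foldr_cons, max_le_iff]

/-- The minimum cost of a cycle through `w` is at most `c` if and only if there is a closed walk
through `w` whose arcs have cost at most `c`. -/
theorem minCycleCost_le_iff {cost : V → V → ℕ∞} {w : V} {c : ℕ} :
    G.minCycleCost A cost w ≤ c ↔
      TransGen (fun a b => G.auxArc A a b ∧ cost a b ≤ c) w w := by
  constructor
  · intro h
    obtain ⟨m, ⟨l, hl, hm⟩, hmc⟩ := ENat.exists_mem_le_of_sInf_le h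
    have hc : cycleCost cost w l ≤ c := by rw [← hm]; exact_mod_cast hmc
    exact transGen_of_isChain_cons (hl.2.and (cycleCost_le_iff.1 hc))
  · intro h
    obtain ⟨l, hl⟩ := exists_cycle_of_transGen h
    have hle : G.minCycleCost A cost w ≤ cycleCost cost w l :=
      sInf_le ⟨l, ⟨hl.1, hl.2.imp fun _ _ h => h.1⟩, rfl⟩
    exact hle.trans (cycleCost_le_iff.2 (hl.2.imp fun _ _ h => h.2))

theorem isBase_iff {w : V} : G.IsBase A w ↔
    Even (G.prio w) ∧ TransGen (G.lowArc A (G.prio w)) w w := by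
  unfold IsBase
  refine and_congr_right fun _ => ?_
  rw [← exists_cycle_iff_transGen]
  refine exists_congr fun l => ⟨?_, ?_⟩
  · rintro ⟨⟨h1, h2⟩, h3⟩
    suffices H : ∀ x ∈ w :: (l ++ [w]), G.prio x ≤ G.prio w from
      ⟨h1, h2.imp_of_mem_imp fun x y hx hy h => ⟨h, H x hx, H y hy⟩⟩
    intro x hx
    simp only [List.mem_cons, List.mem_append, List.not_mem_nil, or_false] at hx
    rcases hx with rfl | hx | rfl
    · exact le_rfl
    · exact h3 x hx
    · exact le_rfl
  · rintro ⟨h1, h2⟩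
    refine ⟨⟨h1, h2.imp fun _ _ h => h.1⟩, fun u hu => ?_⟩
    obtain ⟨y, hy⟩ := h2.exists_rel_of_mem (x := u) (by simp [hu])
    exact hy.2.2

theorem mem_sccNode_self (w : V) : w ∈ G.sccNode A w := ⟨.refl, .refl⟩

theorem prio_le_of_mem_sccNode {u w : V} (h : u ∈ G.sccNode A w) : G.prio u ≤ G.prio w := by
  rcases ReflTransGen.cases_tail h.1 with rfl | ⟨_, _, h⟩
  · exact le_rfl
  · exact h.2.2

theorem mem_topNodes_iff {X : Set V} {w v : V} (hw : w ∈ X) (hX : ∀ u ∈ X, G.prio u ≤ G.prio w) :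
    v ∈ G.topNodes X ↔ v ∈ X ∧ G.prio v = G.prio w :=
  ⟨fun h => ⟨h.1, le_antisymm (hX v h.1) (h.2 w hw)⟩, fun h => ⟨h.1, fun u hu => h.2 ▸ hX u hu⟩⟩

theorem mem_topNodes_sccNode {w v : V} :
    v ∈ G.topNodes (G.sccNode A w) ↔ v ∈ G.sccNode A w ∧ G.prio v = G.prio w :=
  mem_topNodes_iff (mem_sccNode_self w) fun _ => prio_le_of_mem_sccNode

theorem mem_jNode_self (w : V) : w ∈ G.jNode A w := ⟨mem_sccNode_self w, .refl⟩

theorem mem_topNodes_jNode {w v : V} :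
    v ∈ G.topNodes (G.jNode A w) ↔ v ∈ G.jNode A w ∧ G.prio v = G.prio w :=
  mem_topNodes_iff (mem_jNode_self w) fun _ h => prio_le_of_mem_sccNode h.1

theorem jArc_of_sccArc' {u v w : V} (h : G.sccArc' A w u v)
    (hv : ReflTransGen (G.sccArc' A w) v w) : G.jArc A w u v :=
  ⟨⟨h.1, hv.head h⟩, ⟨h.2.1, hv⟩, h⟩

theorem jArc.prio_le {u v w : V} (h : G.jArc A w u v) : G.prio u ≤ G.prio w :=
  prio_le_of_mem_sccNode h.1.1

theorem jArc.arc {u v w : V} (h : G.jArc A w u v) : A u v := h.2.2.2.2.1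

/-- In terms of the arcs of `J_w`, loops and other arcs of `D` admit the same description. -/
theorem auxArc_iff {v w : V} : G.auxArc A v w ↔
    G.IsBase A v ∧ G.IsBase A w ∧ G.prio v = G.prio w ∧ ∃ u, G.jArc A w v u := by
  unfold auxArc
  refine and_congr_right fun _ => and_congr_right fun _ => ?_
  rw [mem_topNodes_jNode]
  constructor
  · rintro (⟨hne, hv, hp⟩ | ⟨rfl, h⟩)
    · refine ⟨hp, ?_⟩
      rcases ReflTransGen.cases_head hv.2 with h | ⟨u, hu, h⟩
      · exact absurd h hne
      · exact ⟨u, jArc_of_sccArc' hu h⟩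
    · exact ⟨rfl, h⟩
  · rintro ⟨hp, u, hu⟩
    by_cases h : v = w
    · subst h; exact Or.inr ⟨rfl, u, hu⟩
    · exact Or.inl ⟨h, hu.1, hp⟩

end ParityGame


/-! ### Initial labels are not too small -/

namespace ParityGame

open OrderedTree Relation

variable {V : Type*} {M N : Type*} [LinearOrder M] [LinearOrder N] {G : ParityGame V}
  {A : V → V → Prop} {T : OrderedTree M} {S : OrderedTree N}

theorem fixed_dropOps_iff {ν : V → T.Label} :
    (∀ φ ∈ G.dropOps A T, φ ν = ν) ↔ ∀ v w, A v w → ν v ≤ T.tighten (G.prio v) (ν w) := by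
  constructor
  · intro h v w hvw
    have := congr_fun (h _ ⟨v, w, hvw, rfl⟩) v
    rw [dropArc_self] at this
    exact min_eq_left_iff.1 this
  · rintro h φ ⟨v, w, hvw, rfl⟩
    exact le_antisymm (dropArc_le v w ν) (le_dropArc le_rfl (h v w hvw))

theorem isLam_iff {w : V} {ν : V → T.Label} : G.IsLam A T w ν ↔
    IsGreatest {ν : V → T.Label | (∀ u v, G.jArc A w u v → ν u ≤ T.tighten (G.prio u) (ν v)) ∧
      ν w = T.minLabel} ν := by
  unfold IsLam
  simp only [fixed_dropOps_iff]

theorem exists_isLam [Finite V] (A : V → V → Prop) (T : OrderedTree M) (w : V) :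
    ∃ ν, G.IsLam A T w ν := by
  classical
  have := Fintype.ofFinite V
  simp only [isLam_iff]
  set F : Finset (V → T.Label) := Finset.univ.filter fun ν =>
    (∀ u v, G.jArc A w u v → ν u ≤ T.tighten (G.prio u) (ν v)) ∧ ν w = T.minLabel with hF
  have hmem : ∀ ν, ν ∈ F ↔
      (∀ u v, G.jArc A w u v → ν u ≤ T.tighten (G.prio u) (ν v)) ∧ ν w = T.minLabel := by
    simp [hF]
  have hbot : (fun _ => T.minLabel) ∈ F := (hmem _).2 ⟨fun _ _ _ => minLabel_le _, rfl⟩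
  refine ⟨fun v => F.sup' ⟨_, hbot⟩ fun ν => ν v, ⟨fun u v huv => ?_, ?_⟩, fun ν hν v => ?_⟩
  · refine Finset.sup'_le _ _ fun ν hν => (((hmem ν).1 hν).1 u v huv).trans (tighten_mono _ ?_)
    exact Finset.le_sup' (fun ν : V → T.Label => ν v) hν
  · exact le_antisymm (Finset.sup'_le _ _ fun ν hν => ((hmem ν).1 hν).2.le) (minLabel_le _)
  · exact Finset.le_sup' (fun ν : V → T.Label => ν v) ((hmem ν).2 hν)

/-- The greatest labeling of `J_w` is tight: every node other than `w` whose label is finite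
has a non-violated outgoing arc in `J_w`. -/
theorem IsLam.exists_nonViolated [Finite V] {w : V} {ν : V → T.Label} (h : G.IsLam A T w ν) {v : V}
    (hv : v ≠ w) (hfin : ν v ≠ ⊤) :
    ∃ v', G.jArc A w v v' ∧ T.NonViolated (G.prio v) (ν v) (ν v') := by
  classical
  have := Fintype.ofFinite V
  rw [isLam_iff] at h
  by_contra! hno
  simp only [nonViolated_iff, not_le] at hno
  -- otherwise the label of `v` could be raised
  set b := (Finset.univ.filter fun v' => G.jArc A w v v').inf
    fun v' => T.tighten (G.prio v) (ν v') with hb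
  have hlt : ν v < b := by
    rw [hb, Finset.lt_inf_iff (lt_top_iff_ne_top.2 hfin)]
    intro v' hv'
    exact hno v' (Finset.mem_filter.1 hv').2
  have hle : ν ≤ Function.update ν v b := by
    rw [le_update_iff]
    exact ⟨hlt.le, fun _ _ => le_rfl⟩
  have hmem : (∀ x y, G.jArc A w x y → Function.update ν v b x ≤
      T.tighten (G.prio x) (Function.update ν v b y)) ∧ Function.update ν v b w = T.minLabel := by
    refine ⟨fun x y hxy => le_trans ?_ (tighten_mono _ (hle y)), ?_⟩
    · by_cases hx : x = v
      · subst hx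
        rw [Function.update_self]
        exact Finset.inf_le (f := fun v' => T.tighten (G.prio x) (ν v'))
          (Finset.mem_filter.2 ⟨Finset.mem_univ y, hxy⟩)
      · rw [Function.update_of_ne hx]
        exact h.1.1 x y hxy
    · rw [Function.update_of_ne hv.symm]
      exact h.1.2
  have := h.2 hmem v
  rw [Function.update_self] at this
  exact hlt.not_ge this

/-- A labeling of `J_w` without loose arcs lies below the image of the greatest labeling by labels
of another tree, as soon as it does so at `w`: it can be pulled back along the label map. -/
theorem IsLam.le_comp {w : V} {ν : V → S.Label} (h : G.IsLam A S w ν) {q : ℕ}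
    {g : S.Label → T.Label} (hg : IsLabelMap q g) (hq : G.prio w ≤ q) {μ : V → T.Label}
    (hμ : ∀ u v, G.jArc A w u v → μ u ≤ T.tighten (G.prio u) (μ v))
    (hw : μ w ≤ g S.minLabel) : μ ≤ g ∘ ν := by
  classical
  rw [isLam_iff] at h
  -- the pulled back labeling: `κ v` is the least label whose image is at least `μ v`
  let κ : V → S.Label := fun v => (Finset.univ.filter fun a => μ v ≤ g a).inf id
  have hκ : ∀ v, μ v ≤ g (κ v) := by
    intro v
    obtain ⟨a, ha, he⟩ := Finset.exists_mem_eq_inf (Finset.univ.filter fun a => μ v ≤ g a)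
      ⟨⊤, by simp [hg.eq_top.2 rfl]⟩ id
    have : κ v = a := he
    rw [this]
    exact (Finset.mem_filter.1 ha).2
  have hκ' : ∀ v a, μ v ≤ g a → κ v ≤ a := fun v a ha =>
    Finset.inf_le (f := id) (Finset.mem_filter.2 ⟨Finset.mem_univ a, ha⟩)
  have hκν : κ ≤ ν := by
    refine h.2 ⟨fun u v huv => hκ' u _ ?_, ?_⟩
    · exact ((hμ u v huv).trans (tighten_mono _ (hκ v))).trans
        (hg.tighten_le (huv.prio_le.trans hq) _)
    · exact le_antisymm (hκ' w _ hw) (minLabel_le _)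
  exact fun v => (hκ v).trans (hg.mono (hκν v))

/-- Let `w` be a base node and let `x ≥ μ(w)` be the smallest leaf of a whole subtree of `T` which
is a copy of a tree of the chain.  If there is a closed walk of `D` through `w` whose arcs have
lower bounds at most the index of this tree, then the least stable labeling above `μ` is at most
`x` at `w`: it lies below the labeling which is `x` at the nodes of the walk and the minimum of the
(transported) greatest labelings of the digraphs `J` elsewhere. -/
theorem apply_le_of_transGen_costLower [Finite V] (hA : ∀ v, ∃ w, A v w) {μ μ' : V → T.Label}
    (hμ : G.NoLooseArcs A T μ)
    (hμ' : μ' ∈ lowerBounds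
      {ν | μ ≤ ν ∧ ∀ v, ∃ w, A v w ∧ T.NonViolated (G.prio v) (ν v) (ν w)})
    {C : T.Cover} {w : V} (heven : Even (G.prio w)) (hprio : G.prio w / 2 ≤ T.height)
    {ch : List (OrderedTree M)} (hch : ch ∈ C.chain (G.prio w / 2)) {i : ℕ} {S : OrderedTree M}
    (hS : ch[i]? = some S) {r : List M} {hr : r ∈ T.verts} (hSr : S.Equivalent (T.subtree r hr))
    {x : T.Label}
    (hx : IsLeast {y : T.Label | ∃ l : {l // l ∈ T.leaves}, y = (l : T.Label) ∧ r <+: l.1} x)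
    (hwx : μ w ≤ x)
    (hcyc : TransGen (fun a b => G.auxArc A a b ∧ G.costLower A ch a b ≤ i) w w) :
    μ' w ≤ x := by
  classical
  have := Fintype.ofFinite V
  set R : V → V → Prop := fun a b => G.auxArc A a b ∧ G.costLower A ch a b ≤ i with hR
  -- the nodes which can reach `w` by such arcs; the labeling to be constructed is `x` on them
  set K : Set V := {a | ReflTransGen R a w} with hK
  have hSh : S.height = G.prio w / 2 := C.height_eq hprio hch (List.mem_of_getElem? hS)
  have hrlen : r.length = T.height - G.prio w / 2 := by
    have h1 := hSr.height_eq
    have h2 := T.length_le r hr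
    simp only [subtree] at h1
    omega
  have hKprio : ∀ a ∈ K, G.prio a = G.prio w := by
    intro a ha
    induction ha using ReflTransGen.head_induction_on with
    | refl => rfl
    | head h _ ih => exact (auxArc_iff.1 h.1).2.2.1.trans ih
  have hKsucc : ∀ a ∈ K, ∃ b ∈ K, R a b := by
    intro a ha
    rcases ReflTransGen.cases_head ha with rfl | ⟨b, hab, hb⟩
    · obtain ⟨b, hab, hb⟩ := TransGen.head'_iff.1 hcyc
      exact ⟨b, hb, hab⟩
    · exact ⟨b, hb, hab⟩
  -- the transported greatest labeling belonging to an arc of `D`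
  have key : ∀ a b, R a b → b ∈ K → ∃ θ : V → T.Label, (∀ v, x ≤ θ v) ∧
      (∀ v, v ≠ b → θ v ≠ ⊤ → ∃ v', A v v' ∧ T.NonViolated (G.prio v) (θ v) (θ v')) ∧
      (μ b ≤ x → μ ≤ θ) ∧ ∃ u, A a u ∧ T.NonViolated (G.prio a) x (θ u) := by
    rintro a b ⟨hab, hcost⟩ hb
    have hbw := hKprio b hb
    have haw := (auxArc_iff.1 hab).2.2.1.trans hbw
    obtain ⟨i₀, ⟨i₁, hi₁, S₀, hS₀, lam, hlam, u, hu, hufin⟩, hi₀⟩ :=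
      ENat.exists_mem_le_of_sInf_le hcost
    obtain rfl : i₀ = i₁ := by exact_mod_cast hi₁
    have hS₀h : S₀.height = G.prio w / 2 := C.height_eq hprio hch (List.mem_of_getElem? hS₀)
    obtain ⟨g₁, hg₁⟩ := (embeds_of_pairwise (C.isChain _ hprio ch hch) hi₀ hS₀ hS).exists_isLabelMap
      (hS₀h.trans hSh.symm)
    obtain ⟨g₂, hg₂⟩ := hSr.1.exists_isLabelMap hSr.height_eq
    have hsub := isLabelMap_subtreeLabel hr (q := G.prio w) (by omega)
    set g : S₀.Label → T.Label := T.subtreeLabel r hr ∘ g₂ ∘ g₁ with hgdef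
    have hg : IsLabelMap (G.prio w) g := hsub.comp ((hg₂ _).comp (hg₁ _))
    have hpre : ∀ y, y ≠ ⊤ → ∃ l : {l // l ∈ T.leaves}, g y = l ∧ r <+: l.1 := by
      intro y hy
      exact exists_of_subtreeLabel hr fun h => hy ((hg₁ 0).eq_top.1 ((hg₂ 0).eq_top.1 h))
    have hxg : ∀ y, x ≤ g y := by
      intro y
      by_cases hy : y = ⊤
      · rw [hg.eq_top.2 hy]; exact le_top
      · obtain ⟨l, hl, hrl⟩ := hpre y hy
        exact hx.2 ⟨l, hl, hrl⟩
    refine ⟨g ∘ lam, fun v => hxg _, ?_, ?_, u, hu.arc, ?_⟩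
    · intro v hv hfin
      obtain ⟨v', hvv', hn⟩ := hlam.exists_nonViolated hv fun h => hfin (hg.eq_top.2 h)
      exact ⟨v', hvv'.arc, hg.nonViolated (hvv'.prio_le.trans hbw.le) hn⟩
    · intro hbx
      exact hlam.le_comp hg hbw.le (fun u v huv => noLooseArcs_iff.1 hμ u v huv.arc)
        (hbx.trans (hxg _))
    · obtain ⟨l, hl, hrl⟩ := hpre _ hufin
      rw [haw, nonViolated_iff, Function.comp, hl]
      exact ((tighten_isLeast_prefix heven hrlen hrl).unique hx).le
  -- `μ ≤ x` spreads from `w` backwards along the walk, as `μ` has no loose arcs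
  have hμx : ∀ a ∈ K, μ a ≤ x := by
    intro a ha
    induction ha using ReflTransGen.head_induction_on with
    | refl => exact hwx
    | @head a b hab hb ih =>
      obtain ⟨θ, -, -, h3, u, hu, hun⟩ := key a b hab hb
      exact ((noLooseArcs_iff.1 hμ a u hu).trans (tighten_mono _ (h3 ih u))).trans
        (nonViolated_iff.1 hun)
  choose! s hsK hsR using hKsucc
  have key' : ∀ a ∈ K, ∃ θ : V → T.Label, (∀ v, x ≤ θ v) ∧
      (∀ v, v ∉ K → θ v ≠ ⊤ → ∃ v', A v v' ∧ T.NonViolated (G.prio v) (θ v) (θ v')) ∧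
      μ ≤ θ ∧ ∃ u, A a u ∧ T.NonViolated (G.prio a) x (θ u) := by
    intro a ha
    obtain ⟨θ, h1, h2, h3, h4⟩ := key a (s a) (hsR a ha) (hsK a ha)
    exact ⟨θ, h1, fun v hv => h2 v fun h => hv (h ▸ hsK a ha), h3 (hμx _ (hsK a ha)), h4⟩
  choose! θ hθx hθA hθμ hθu using key'
  set ν : V → T.Label := fun v =>
    if v ∈ K then x else (Finset.univ.filter (· ∈ K)).inf fun a => θ a v with hν
  have hνθ : ∀ a ∈ K, ν ≤ θ a := by
    intro a ha v
    simp only [hν]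
    split_ifs
    · exact hθx a ha v
    · exact Finset.inf_le (f := fun a => θ a v) (by simpa using ha)
  have hwK : w ∈ K := ReflTransGen.refl
  have hνst : ∀ v, ∃ u, A v u ∧ T.NonViolated (G.prio v) (ν v) (ν u) := by
    intro v
    by_cases hv : v ∈ K
    · obtain ⟨u, hu, hn⟩ := hθu v hv
      refine ⟨u, hu, ?_⟩
      have : ν v = x := by simp [hν, hv]
      rw [this]
      exact hn.anti (hνθ v hv u)
    · obtain ⟨a, ha, he⟩ := Finset.exists_mem_eq_inf (Finset.univ.filter (· ∈ K))
        ⟨w, by simpa using hwK⟩ fun a => θ a v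
      have haK : a ∈ K := by simpa using ha
      have hva : ν v = θ a v := by simp only [hν, if_neg hv]; exact he
      by_cases hfin : θ a v = ⊤
      · obtain ⟨u, hu⟩ := hA v
        exact ⟨u, hu, by rw [hva, hfin]; exact nonViolated_top _ _⟩
      · obtain ⟨u, hu, hn⟩ := hθA a haK v hv hfin
        exact ⟨u, hu, by rw [hva]; exact hn.anti (hνθ a haK u)⟩
  have hμν : μ ≤ ν := by
    intro v
    simp only [hν]
    split_ifs with hv
    · exact hμx v hv
    · exact Finset.le_inf fun a ha => hθμ a (by simpa using ha) v
  refine (hμ' ⟨hμν, hνst⟩ w).trans ?_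
  simp [hν, hwK]

end ParityGame


/-! ### Initial labels are small enough -/

/-- Every orbit of a self-map of a finite set reaches a periodic point at which a given function
attains its maximum over the orbit of this point. -/
theorem exists_periodic_iterate_max {V : Type*} [Finite V] (σ : V → V) (f : V → ℕ) (v : V) :
    ∃ m n, 0 < n ∧ σ^[n] (σ^[m] v) = σ^[m] v ∧ ∀ i, f (σ^[i] (σ^[m] v)) ≤ f (σ^[m] v) := by
  obtain ⟨a, b, hab, he⟩ : ∃ a b, a < b ∧ σ^[a] v = σ^[b] v := by
    obtain ⟨a, b, hne, he⟩ := Finite.exists_ne_map_eq_of_infinite fun i : ℕ => σ^[i] v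
    rcases lt_or_gt_of_ne hne with h | h
    · exact ⟨a, b, h, he⟩
    · exact ⟨b, a, h, he.symm⟩
  set z := σ^[a] v with hz
  have hzper : σ^[b - a] z = z := by
    rw [hz, ← Function.iterate_add_apply, Nat.sub_add_cancel hab.le, ← he]
  obtain ⟨i₀, hi₀⟩ : ∃ i₀, ∀ i, f (σ^[i] z) ≤ f (σ^[i₀] z) := by
    have hfin : (Set.range fun i => f (σ^[i] z)).Finite :=
      (Set.toFinite (Set.range f)).subset (by rintro _ ⟨i, rfl⟩; exact ⟨_, rfl⟩)
    obtain ⟨_, ⟨i₀, rfl⟩, hmax⟩ := Set.exists_max_image _ id hfin (Set.range_nonempty _)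
    exact ⟨i₀, fun i => hmax _ ⟨i, rfl⟩⟩
  refine ⟨i₀ + a, b - a, by omega, ?_, fun i => ?_⟩
  · rw [Function.iterate_add_apply, ← hz, ← Function.iterate_add_apply, Nat.add_comm,
      Function.iterate_add_apply, hzper]
  · rw [Function.iterate_add_apply σ i₀ a, ← hz, ← Function.iterate_add_apply]
    exact hi₀ _

namespace ParityGame

open OrderedTree Relation

variable {V : Type*} {M : Type*} [LinearOrder M] {G : ParityGame V}
  {A : V → V → Prop} {T S : OrderedTree M}

/-- A cycle (the orbit of a periodic point `w` of `σ`) dominated by the node `w` of even priority,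
with a finite labeling without violated arcs by labels of the `i`-th tree of a chain, gives rise to
a closed walk of `D` through `w` whose arcs have upper bounds at most `i`: it visits the nodes of
highest priority of the cycle. -/
theorem transGen_auxArc_of_periodic {σ : V → V} {w : V} {n : ℕ} (hn : 0 < n)
    (hper : σ^[n] w = w) (hmax : ∀ i, G.prio (σ^[i] w) ≤ G.prio w) (heven : Even (G.prio w))
    (hσ : ∀ i, A (σ^[i] w) (σ (σ^[i] w))) {ch : List (OrderedTree M)} {i : ℕ}
    (hS : ch[i]? = some S) {κ : V → S.Label} (hκ : ∀ v, κ v ≠ ⊤)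
    (hκn : ∀ i, S.NonViolated (G.prio (σ^[i] w)) (κ (σ^[i] w)) (κ (σ (σ^[i] w)))) :
    TransGen (fun a b => G.auxArc A a b ∧ G.costUpper A ch a b ≤ i) w w := by
  set p := G.prio w with hp
  set O : Set V := Set.range fun i => σ^[i] w with hO
  have hwO : w ∈ O := ⟨0, rfl⟩
  have hOσ : ∀ x ∈ O, σ x ∈ O := by
    rintro _ ⟨i, rfl⟩
    exact ⟨i + 1, Function.iterate_succ_apply' σ i w⟩
  have hOp : ∀ x ∈ O, G.prio x ≤ p := by
    rintro _ ⟨i, rfl⟩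
    exact hmax i
  have hOA : ∀ x ∈ O, A x (σ x) := by
    rintro _ ⟨i, rfl⟩
    exact hσ i
  have hOn : ∀ x ∈ O, S.NonViolated (G.prio x) (κ x) (κ (σ x)) := by
    rintro _ ⟨i, rfl⟩
    exact hκn i
  have hstep : ∀ k x, x ∈ O → ReflTransGen (fun a b => a ∈ O ∧ b = σ a) x (σ^[k] x) := by
    intro k
    induction k with
    | zero => intro x _; exact .refl
    | succ k ih => intro x hx; exact .head ⟨hx, rfl⟩ (ih _ (hOσ x hx))
  have hlow : ∀ a ∈ O, ∀ b ∈ O, ReflTransGen (G.lowArc A p) a b := by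
    have H : ∀ a b, ReflTransGen (fun a b => a ∈ O ∧ b = σ a) a b →
        ReflTransGen (G.lowArc A p) a b := fun a b h => by
      refine ReflTransGen.mono (fun x y hxy => ?_) _ _ h
      obtain ⟨hx, rfl⟩ := hxy
      exact ⟨hOA x hx, hOp x hx, hOp _ (hOσ x hx)⟩
    rintro _ ⟨i, rfl⟩ _ ⟨k, rfl⟩
    refine (H _ w ?_).trans (H _ _ (hstep k w hwO))
    -- go around the cycle until `w` is met again
    have := hstep (n * (i + 1) - i) (σ^[i] w) ⟨i, rfl⟩
    rwa [← Function.iterate_add_apply, Nat.sub_add_cancel (by nlinarith), Function.iterate_mul,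
      Function.iterate_fixed hper] at this
  have hscc : ∀ b ∈ O, G.prio b = p → ∀ a ∈ O, a ∈ G.sccNode A b := fun b hb hbp a ha =>
    ⟨by rw [hbp]; exact hlow b hb a ha, by rw [hbp]; exact hlow a ha b hb⟩
  have hbase : ∀ b ∈ O, G.prio b = p → G.IsBase A b := fun b hb hbp => by
    rw [isBase_iff, hbp]
    exact ⟨heven, .head' ⟨hOA b hb, hOp b hb, hOp _ (hOσ b hb)⟩ (hlow _ (hOσ b hb) b hb)⟩
  -- steps of the cycle which do not enter a node of highest priority other than `b`
  let Q : V → V → V → Prop := fun b x y => x ∈ O ∧ y = σ x ∧ (G.prio y < p ∨ y = b)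
  have hQ : ∀ b ∈ O, G.prio b = p → ∀ x y, Q b x y → G.sccArc' A b x y := by
    rintro b hb hbp x _ ⟨hx, rfl, h⟩
    refine ⟨hscc b hb hbp x hx, hscc b hb hbp _ (hOσ x hx), hOA x hx, fun htop => ?_⟩
    rw [mem_topNodes_sccNode, hbp] at htop
    exact h.resolve_left (by rw [htop.2]; exact lt_irrefl p)
  have hQarc : ∀ a ∈ O, ∀ b ∈ O, G.prio a = p → G.prio b = p → TransGen (Q b) a b →
      G.auxArc A a b ∧ G.costUpper A ch a b ≤ i := by
    intro a ha b hb hap hbp hab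
    obtain ⟨u, hau, hub⟩ := TransGen.head'_iff.1 hab
    have hj : ∀ x y, Q b x y → ReflTransGen (Q b) y b → G.jArc A b x y := fun x y h h' =>
      jArc_of_sccArc' (hQ b hb hbp x y h) (ReflTransGen.mono (hQ b hb hbp) _ _ h')
    have haux : G.auxArc A a b :=
      auxArc_iff.2 ⟨hbase a ha hap, hbase b hb hbp, hap.trans hbp.symm, u, hj a u hau hub⟩
    refine ⟨haux, ?_⟩
    have hpath : ReflTransGen (fun x y => G.jArc A b x y ∧ x ∈ O ∧ y = σ x) u b := by
      clear hau
      induction hub using ReflTransGen.head_induction_on with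
      | refl => exact .refl
      | head h h' ih => exact .head ⟨hj _ _ h h', h.1, h.2.1⟩ ih
    obtain ⟨P, hP⟩ := exists_path_of_reflTransGen hpath
    have hPσ : ∀ x y, pathArc P x y → x ∈ O ∧ y = σ x := fun x y h => (rel_of_pathArc hP.2.1 h).2
    have hwidth : G.width ch (pathArc P) ≤ i := by
      refine sInf_le ⟨i, rfl, S, hS, κ, hκ, σ, ?_, ?_⟩
      · rintro v _ ⟨y, hy⟩
        exact (hPσ v y hy).2 ▸ hy
      · intro v y hvy _
        obtain ⟨hv, rfl⟩ := hPσ v y hvy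
        exact hOn v hv
    refine le_trans (sInf_le ?_) hwidth
    exact ⟨u, P, hj a u hau hub, ⟨hP.1, hP.2.1.imp fun _ _ h => h.1, hP.2.2⟩, rfl⟩
  -- follow the cycle, keeping track of the last node of highest priority
  have hwalk : ∀ k a x, a ∈ O → G.prio a = p → x ∈ O →
      ReflTransGen (fun x y => x ∈ O ∧ y = σ x ∧ G.prio y < p) a x → σ^[k + 1] x = w →
      TransGen (fun a b => G.auxArc A a b ∧ G.costUpper A ch a b ≤ i) a w := by
    intro k
    induction k with
    | zero =>
      rintro a x ha hap hx hax rfl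
      exact .single (hQarc a ha _ hwO hap rfl (.tail' (ReflTransGen.mono
        (fun u v h => ⟨h.1, h.2.1, .inl h.2.2⟩) _ _ hax) ⟨hx, rfl, .inr rfl⟩))
    | succ k ih =>
      intro a x ha hap hx hax hk
      rw [Function.iterate_succ_apply] at hk
      rcases (hOp _ (hOσ x hx)).lt_or_eq with hlt | heq
      · exact ih a (σ x) ha hap (hOσ x hx) (hax.tail ⟨hx, rfl, hlt⟩) hk
      · refine .head (hQarc a ha _ (hOσ x hx) hap heq (.tail' (ReflTransGen.mono
          (fun u v h => ⟨h.1, h.2.1, .inl h.2.2⟩) _ _ hax) ⟨hx, rfl, .inr rfl⟩)) ?_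
        exact ih (σ x) (σ x) (hOσ x hx) heq (hOσ x hx) .refl hk
  obtain ⟨k, rfl⟩ := Nat.exists_eq_succ_of_ne_zero hn.ne'
  exact hwalk k w w hwO rfl hwO .refl hper

/-- Change of arc costs along a closed walk of `D`; only arcs between nodes with the priority of
`w` matter, since arcs of `D` join nodes of the same priority. -/
theorem transGen_auxArc_mono {f g : V → V → ℕ∞} {c c' : ℕ∞} {w : V}
    (h : ∀ a b, G.auxArc A a b → G.prio b = G.prio w → f a b ≤ c → g a b ≤ c')
    (hw : TransGen (fun a b => G.auxArc A a b ∧ f a b ≤ c) w w) :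
    TransGen (fun a b => G.auxArc A a b ∧ g a b ≤ c') w w := by
  suffices H : ∀ b, TransGen (fun a b => G.auxArc A a b ∧ f a b ≤ c) b w →
      G.prio b = G.prio w ∧ TransGen (fun a b => G.auxArc A a b ∧ g a b ≤ c') b w from (H w hw).2
  intro b hb
  induction hb using TransGen.head_induction_on with
  | single hab => exact ⟨(auxArc_iff.1 hab.1).2.2.1, .single ⟨hab.1, h _ _ hab.1 rfl hab.2⟩⟩
  | head hab _ ih =>
    exact ⟨(auxArc_iff.1 hab.1).2.2.1.trans ih.1, .head ⟨hab.1, h _ _ hab.1 ih.1 hab.2⟩ ih.2⟩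

/-- Around a cycle without violated arcs, with finite labels and dominated by `w`, the priority
of `w` is even, and all labels have the same truncation. -/
theorem even_prio_of_periodic {σ : V → V} {w : V} {n : ℕ} (hn : 0 < n)
    (hper : σ^[n] w = w) (hmax : ∀ i, G.prio (σ^[i] w) ≤ G.prio w) {κ : V → T.Label}
    (hfin : κ w ≠ ⊤)
    (hκ : ∀ i, T.NonViolated (G.prio (σ^[i] w)) (κ (σ^[i] w)) (κ (σ (σ^[i] w)))) :
    Even (G.prio w) ∧
      ∀ i, T.trunc (G.prio w) (κ (σ^[i] w)) = T.trunc (G.prio w) (κ w) := by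
  have hanti : Antitone fun i => T.trunc (G.prio w) (κ (σ^[i] w)) := by
    refine antitone_nat_of_succ_le fun i => ?_
    rw [Function.iterate_succ_apply']
    exact (hκ i).trunc_le (hmax i)
  have hconst : ∀ i, T.trunc (G.prio w) (κ (σ^[i] w)) = T.trunc (G.prio w) (κ w) := by
    intro i
    refine le_antisymm (hanti (Nat.zero_le i)) ?_
    have h1 : i ≤ n * (i + 1) := by nlinarith
    have h2 := hanti h1
    simp only [Function.iterate_mul, Function.iterate_fixed hper] at h2
    exact h2
  refine ⟨?_, hconst⟩
  by_contra hodd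
  have h := hκ 0
  rw [Function.iterate_zero_apply, NonViolated, if_neg hodd] at h
  rcases h with h | h
  · exact h.ne (hconst 1)
  · exact hfin h.1

/-- If `σ` selects an outgoing tight arc of every node with respect to `μ'`, then every node with a
finite label is taken by `σ` to a base node whose initial label is at most `μ'`. -/
theorem exists_initialLabel_le [Finite V] {μ μ' : V → T.Label} (hμ : μ ≤ μ') {σ : V → V}
    (hσ : ∀ v, A v (σ v)) (hσt : ∀ v, μ' v = T.tighten (G.prio v) (μ' (σ v)))
    (hprio : ∀ v, G.prio v / 2 ≤ T.height) {C : T.Cover} {cost : ℕ → V → V → ℕ∞}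
    (hcost : ∀ v w, G.auxArc A v w → ∀ k ch, (C.chain (G.prio w / 2))[k]? = some ch →
      cost k v w ≤ G.costUpper A ch v w) {v : V} (hv : μ' v ≠ ⊤) :
    ∃ m, G.initialLabel A T C μ cost (σ^[m] v) ≤ μ' (σ^[m] v) := by
  classical
  have hnon : ∀ v, T.NonViolated (G.prio v) (μ' v) (μ' (σ v)) := fun v =>
    nonViolated_iff.2 (hσt v).ge
  have hfin : ∀ i x, μ' x ≠ ⊤ → μ' (σ^[i] x) ≠ ⊤ := by
    intro i
    induction i with
    | zero => exact fun _ h => h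
    | succ i ih => exact fun x hx => ih _ ((hnon x).ne_top hx)
  obtain ⟨m, n, hn, hper, hmax⟩ := exists_periodic_iterate_max σ G.prio v
  refine ⟨m, ?_⟩
  have hwfin := hfin m v hv
  generalize σ^[m] v = w at *
  obtain ⟨heven, htrunc⟩ := even_prio_of_periodic hn hper hmax hwfin fun i => hnon _
  obtain ⟨x, hx⟩ := WithTop.ne_top_iff_exists.1 hwfin
  set r := x.1.take (T.height - G.prio w / 2) with hr
  have hrT : r ∈ T.verts := take_mem_verts (mem_leaves.1 x.2).1 _
  have hrlen : r.length = T.height - G.prio w / 2 := by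
    rw [hr, List.length_take, (mem_leaves.1 x.2).2]
    omega
  -- all labels on the cycle lie in the subtree rooted at `r`
  have hlab : ∀ i, ∃ l : {l // l ∈ T.leaves}, μ' (σ^[i] w) = l ∧ r <+: l.1 := by
    intro i
    obtain ⟨l, hl⟩ := WithTop.ne_top_iff_exists.1 (hfin i w hwfin)
    refine ⟨l, hl.symm, ?_⟩
    have h := htrunc i
    rw [← hl, ← hx] at h
    simp only [trunc, WithTop.map_coe, WithTop.coe_inj] at h
    rw [hr, ← h]
    exact List.take_prefix _ _
  obtain ⟨ch, hch, S, hS, hSr⟩ := C.covers _ (hprio w) r hrT hrlen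
  obtain ⟨k, hk⟩ := List.mem_iff_getElem?.1 hch
  obtain ⟨i, hi⟩ := List.mem_iff_getElem?.1 hS
  obtain ⟨g, hg⟩ := hSr.2.exists_isLabelMap hSr.height_eq.symm
  -- the labels on the cycle, transported to the tree of the chain
  have hκ : ∀ u, ∃ a : (T.subtree r hrT).Label, a ≠ ⊤ ∧
      ((∃ i, u = σ^[i] w) → T.subtreeLabel r hrT a = μ' u) := by
    intro u
    by_cases hu : ∃ i, u = σ^[i] w
    · obtain ⟨i, rfl⟩ := hu
      obtain ⟨l, hl, hrl⟩ := hlab i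
      obtain ⟨a, ha, hal⟩ := exists_subtreeLabel_eq hrT hrl
      exact ⟨a, ha, fun _ => hal.trans hl.symm⟩
    · obtain ⟨l, hl, hrl⟩ := hlab 0
      obtain ⟨a, ha, -⟩ := exists_subtreeLabel_eq hrT hrl
      exact ⟨a, ha, fun h => absurd h hu⟩
  choose κ hκfin hκμ using hκ
  have hwalk := transGen_auxArc_of_periodic (A := A) hn hper hmax heven (fun i => hσ _) hi
    (κ := fun u => g (κ u)) (fun u h => hκfin u ((hg 0).eq_top.1 h)) (fun i => by
      refine (hg (G.prio w)).nonViolated (hmax i) (nonViolated_of_subtreeLabel hrT ?_ (hκfin _)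
        (hκfin _) ?_)
      · have := Nat.div_le_div_right (c := 2) (hmax i)
        have := hprio w
        omega
      · rw [hκμ _ ⟨i, rfl⟩, hκμ _ ⟨i + 1, (Function.iterate_succ_apply' σ i w).symm⟩]
        exact hnon _)
  have hbase : G.IsBase A w := by
    obtain ⟨u, hu, -⟩ := TransGen.head'_iff.1 hwalk
    exact hu.1.1
  have hcyc : G.minCycleCost A (cost k) w ≤ i := by
    rw [minCycleCost_le_iff]
    refine transGen_auxArc_mono (fun a b hab hb h => ?_) hwalk
    exact (hcost a b hab k ch (by rwa [hb])).trans h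
  have hfinc : G.minCycleCost A (cost k) w ≠ ⊤ :=
    ne_top_of_le_ne_top (ENat.natCast_ne_top i) hcyc
  rw [initialLabel, if_pos hbase]
  refine (Finset.inf_le (b := k) (Finset.mem_range.2 (List.getElem?_eq_some_iff.1 hk).1)).trans ?_
  rw [if_neg hfinc]
  refine Finset.inf_le (f := id) (Finset.mem_filter.2 ⟨Finset.mem_univ _, hμ w, r, hrT, ?_, ch, hk,
    i, ?_, S, hi, hSr⟩)
  -- the arc leaving `w` is tight, so its label is the smallest leaf below `r`
  · obtain ⟨l, hl, hrl⟩ := hlab 1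
    rw [hσt w, show μ' (σ w) = l from hl]
    exact tighten_isLeast_prefix heven hrlen hrl
  · obtain ⟨c, hc⟩ := ENat.ne_top_iff_exists.1 hfinc
    rw [← hc] at hcyc ⊢
    exact_mod_cast hcyc

/-- Every run of the label-correcting algorithm returns the least stable labeling above `μ`. -/
theorem IsLabelCorrectingOutput.eq [Fintype V] (hA : ∀ v, ∃ w, A v w) {μ μ' ν : V → T.Label}
    (hμ : G.NoLooseArcs A T μ)
    (hμ' : IsLeast {ν | μ ≤ ν ∧ ∀ v, ∃ w, A v w ∧ T.NonViolated (G.prio v) (ν v) (ν w)} μ')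
    (hloose : G.NoLooseArcs A T μ') (hprio : ∀ v, G.prio v / 2 ≤ T.height) {C : T.Cover}
    (h : G.IsLabelCorrectingOutput A T C μ ν) : ν = μ' := by
  classical
  obtain ⟨cost, hcost, passes, hlen, henum, rfl⟩ := h
  change G.relaxAll T passes _ = μ'
  rw [noLooseArcs_iff] at hloose
  apply le_antisymm
  · intro v
    by_cases hv : μ' v = ⊤
    · rw [hv]; exact le_top
    choose σ hσ hσn using hμ'.1.2
    have hσt : ∀ v, μ' v = T.tighten (G.prio v) (μ' (σ v)) := fun v =>
      le_antisymm (hloose v _ (hσ v)) (nonViolated_iff.1 (hσn v))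
    obtain ⟨m, hm⟩ := exists_initialLabel_le hμ'.1.1 hσ hσt hprio
      (fun v w h k ch hk => (hcost v w h k ch hk).2) hv
    have hreach : ReflTransGen (fun x y => y = σ x) v (σ^[m] v) := by
      clear hm hv
      induction m generalizing v with
      | zero => exact .refl
      | succ m ih => exact .head rfl (ih _)
    obtain ⟨P, hnd, hch, hu, hw⟩ := exists_path_of_reflTransGen hreach
    refine relaxAll_apply_le (hch.imp fun x y hxy => ⟨fun l hl => ?_, ?_⟩) hu hw hm ?_
    · exact ((henum l hl).2 (x, y)).2 (by rw [hxy]; exact hσ x)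
    · rw [hxy]; exact hσn x
    · have := hnd.length_le_card
      omega
  · refine le_relaxAll (fun w => ?_) fun l hl e he => hloose _ _ (((henum l hl).2 e).1 he)
    unfold initialLabel
    split_ifs with hw
    · refine Finset.le_inf fun k hk => ?_
      have hk' := Finset.mem_range.1 hk
      split_ifs with hc
      · exact le_top
      · refine Finset.le_inf fun x hx => ?_
        obtain ⟨-, hwx, r, hr, hleast, ch, hch, i', hi', S, hS, hSr⟩ := Finset.mem_filter.1 hx
        obtain ⟨c, hc'⟩ := ENat.ne_top_iff_exists.1 hc
        rw [← hc', ENat.toNat_natCast] at hi'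
        refine apply_le_of_transGen_costLower hA hμ hμ'.2 hw.1 (hprio w)
          (List.mem_of_getElem? hch) hS hSr hleast hwx ?_
        refine transGen_auxArc_mono (fun a b hab hb h => ?_) (minCycleCost_le_iff.1 hc'.symm.le)
        exact ((hcost a b hab k ch (by rwa [hb])).1.trans h).trans (by exact_mod_cast hi')
    · exact le_top

end ParityGame


/-! ### Values of loops, Bellman–Ford and closures -/

namespace Timed

variable {α β ι σ : Type}

@[simp] theorem bind_val (x : Timed α) (f : α → Timed β) : (x >>= f).val = (f x.val).val := rfl

@[simp] theorem bind_time (x : Timed α) (f : α → Timed β) :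
    (x >>= f).time = x.time + (f x.val).time := rfl

@[simp] theorem pure_val (a : α) : (pure a : Timed α).val = a := rfl

@[simp] theorem pure_time (a : α) : (pure a : Timed α).time = 0 := rfl

@[simp] theorem charge_val (c : ℕ) (a : α) : (charge c a).val = a := rfl

@[simp] theorem charge_time (c : ℕ) (a : α) : (charge c a).time = c := rfl

@[simp] theorem step_val (a : α) : (step a).val = a := rfl

@[simp] theorem step_time (a : α) : (step a).time = 1 := rfl

@[simp] theorem read_val (f : ι → α) (i : ι) : (read f i).val = f i := rfl

@[simp] theorem read_time (f : ι → α) (i : ι) : (read f i).time = 1 := rfl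

@[simp] theorem write_val [DecidableEq ι] (f : ι → α) (i : ι) (a : α) :
    (write f i a).val = Function.update f i a := rfl

@[simp] theorem write_time [DecidableEq ι] (f : ι → α) (i : ι) (a : α) :
    (write f i a).time = 1 := rfl

@[simp] theorem alloc_val (l : List ι) (a : α) : (alloc l a).val = fun _ => a := rfl

@[simp] theorem alloc_time (l : List ι) (a : α) : (alloc l a).time = l.length + 1 := rfl

@[simp] theorem ite_val (b : Prop) [Decidable b] (x y : Timed α) :
    (if b then x else y).val = if b then x.val else y.val := by split_ifs <;> rfl

@[simp] theorem ite_time (b : Prop) [Decidable b] (x y : Timed α) :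
    (if b then x else y).time = if b then x.time else y.time := by split_ifs <;> rfl

theorem loop_val (l : List ι) (s : σ) (body : ι → σ → Timed σ) :
    (loop l s body).val = l.foldl (fun s i => (body i s).val) s := by
  induction l generalizing s with
  | nil => rfl
  | cons i l ih => exact ih _

theorem select_val (l : List ι) (test : ι → Timed Bool) :
    (select l test).val = l.filter fun i => (test i).val := by
  induction l with
  | nil => rfl
  | cons i l ih =>
    simp only [select, bind_val, ite_val, step_val, ih, List.filter_cons]

end Timed

theorem List.foldl_invariant {ι σ : Type*} {f : σ → ι → σ} {l : List ι} {s : σ} (Inv : σ → Prop)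
    (h0 : Inv s) (hf : ∀ i ∈ l, ∀ s, Inv s → Inv (f s i)) : Inv (l.foldl f s) := by
  induction l generalizing s with
  | nil => exact h0
  | cons i l ih => exact ih (hf i (by simp) s h0) fun i hi => hf i (by simp [hi])

/-- The result of a loop which writes an entry computed from the index into every visited cell. -/
theorem List.foldl_update_apply {V α : Type*} [DecidableEq V] (l : List V) (f : V → α) (s : V → α)
    (x : V) :
    (l.foldl (fun s i => Function.update s i (f i)) s) x = if x ∈ l then f x else s x := by
  induction l generalizing s with
  | nil => simp
  | cons a l ih =>
    rw [List.foldl_cons, ih]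
    by_cases hx : x ∈ l
    · simp [hx]
    · by_cases hxa : x = a
      · subst hxa; simp
      · simp [hx, hxa]

namespace LabelCorrecting

open Timed ParityGame OrderedTree Relation

variable {V M : Type} [DecidableEq V] [LinearOrder M]

/-- The program for Bellman–Ford computes the passes `ParityGame.relaxAll` over the same list of
arcs. -/
theorem bellmanFord_val (G : ParityGame V) (γ n : ℕ) (arcs : List (V × V)) (T : OrderedTree M)
    (ν : V → T.Label) : (bellmanFord γ n G.prio arcs T ν).val =
      G.relaxAll T (List.replicate (n - 1) arcs) ν := by
  have hpass : ∀ ν : V → T.Label, arcs.foldl (fun ν e => (do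
      let p ← read G.prio e.1
      let a ← read ν e.1
      let b ← read ν e.2
      let t ← charge γ (T.tighten p b)
      let lt ← labelLt γ t a
      if lt then write ν e.1 t else step ν : Timed _).val) ν = G.relax T arcs ν := by
    intro ν
    unfold relax
    congr 1
    funext ν e
    funext x
    by_cases hx : x = e.1
    · subst hx
      rw [dropArc_self]
      by_cases h : T.tighten (G.prio e.1) (ν e.2) < ν e.1
      · simp [labelLt, h, h.le]
      · simp [labelLt, h, not_lt.1 h]
    · rw [dropArc_of_ne hx]
      by_cases h : T.tighten (G.prio e.1) (ν e.2) < ν e.1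
      · simp [labelLt, h, Function.update_of_ne hx]
      · simp [labelLt, h]
  unfold bellmanFord relaxAll
  simp only [loop_val, hpass]
  generalize n - 1 = m
  induction m generalizing ν with
  | zero => rfl
  | succ m ih =>
    rw [List.range_succ, List.foldl_append, ih, List.replicate_succ', List.foldl_append]
    rfl

/-- If the number of passes is at least the number of arcs of each path, then the marked nodes are
in the end those from which a node marked initially can be reached. -/
theorem closure_val (n : ℕ) (arcs : List (V × V)) (mark : V → Bool) (x : V)
    (h : ∀ u v P, IsPathFromTo (fun a b => (a, b) ∈ arcs) u v P → P.length ≤ n + 1) :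
    (closure n arcs mark).val x = true ↔
      ∃ y, mark y = true ∧ ReflTransGen (fun a b => (a, b) ∈ arcs) x y := by
  have hbody : ∀ (mark : V → Bool) (e : V × V), (do
      let b ← read mark e.2
      if b then write mark e.1 true else step mark : Timed _).val =
        fun x => mark x || (decide (x = e.1) && mark e.2) := by
    intro mark e
    funext x
    by_cases hb : mark e.2 = true
    · by_cases hx : x = e.1
      · subst hx; simp [hb]
      · simp [hb, hx]
    · simp [hb]
  unfold closure
  simp only [loop_val, hbody]
  set pass : (V → Bool) → V → Bool := fun mark =>
    arcs.foldl (fun mark e x => mark x || (decide (x = e.1) && mark e.2)) mark with hpass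
  have hmono : ∀ (l : List (V × V)) (mark : V → Bool) x, mark x = true →
      l.foldl (fun mark e x => mark x || (decide (x = e.1) && mark e.2)) mark x = true := by
    intro l
    induction l with
    | nil => exact fun _ _ h => h
    | cons e l ih => exact fun mark x h => ih _ _ (by simp [h])
  have hstep : ∀ (l : List (V × V)) (mark : V → Bool) u v, (u, v) ∈ l → mark v = true →
      l.foldl (fun mark e x => mark x || (decide (x = e.1) && mark e.2)) mark u = true := by
    intro l
    induction l with
    | nil => intro _ _ _ h; simp at h
    | cons e l ih =>
      intro mark u v huv hv
      rcases List.mem_cons.1 huv with rfl | huv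
      · refine hmono l _ _ ?_
        simp [hv]
      · refine ih _ u v huv ?_
        simp [hv]
  constructor
  · have : ∀ z, (List.range n).foldl (fun mark _ => pass mark) mark z = true →
        ∃ y, mark y = true ∧ ReflTransGen (fun a b => (a, b) ∈ arcs) z y := by
      refine List.foldl_invariant (Inv := fun m : V → Bool => ∀ z, m z = true →
        ∃ y, mark y = true ∧ ReflTransGen (fun a b => (a, b) ∈ arcs) z y)
        (fun z hz => ⟨z, hz, .refl⟩) fun _ _ m hm => ?_
      refine List.foldl_invariant (Inv := fun m : V → Bool => ∀ z, m z = true →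
        ∃ y, mark y = true ∧ ReflTransGen (fun a b => (a, b) ∈ arcs) z y) hm ?_
      intro e he m hm z hz
      simp only [Bool.or_eq_true, Bool.and_eq_true, decide_eq_true_eq] at hz
      rcases hz with hz | ⟨rfl, hz⟩
      · exact hm z hz
      · obtain ⟨y, hy, h⟩ := hm _ hz
        exact ⟨y, hy, .head he h⟩
    exact this x
  · rintro ⟨y, hy, hxy⟩
    obtain ⟨P, hP⟩ := exists_path_of_reflTransGen hxy
    have hlen := h _ _ _ hP
    obtain ⟨-, hch, hu, hv⟩ := hP
    clear h hxy
    induction P generalizing x n with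
    | nil => simp at hu
    | cons a P ih =>
      obtain rfl : a = x := by simpa using hu
      cases P with
      | nil =>
        obtain rfl : a = y := by simpa using hv
        exact List.foldl_invariant (Inv := fun m : V → Bool => m a = true) hy
          fun _ _ m hm => hmono _ _ _ hm
      | cons b P =>
        obtain ⟨h1, h2⟩ := List.isChain_cons_cons.1 hch
        cases n with
        | zero => simp at hlen
        | succ n =>
          rw [List.range_succ, List.foldl_append]
          exact hstep _ _ _ b h1 (ih n b (by simpa using hlen) h2 rfl (by simpa using hv))

end LabelCorrecting


/-! ### Construction of the auxiliary digraph -/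

theorem List.mem_foldl_swap_cons {V : Type*} {l r : List (V × V)} {a b : V} :
    (a, b) ∈ l.foldl (fun l e => (e.2, e.1) :: l) r ↔ (b, a) ∈ l ∨ (a, b) ∈ r := by
  induction l generalizing r with
  | nil => simp
  | cons e l ih =>
    rw [List.foldl_cons, ih]
    obtain ⟨x, y⟩ := e
    simp only [List.mem_cons, Prod.mk.injEq]
    tauto

theorem List.foldl_or_eq_true {α : Type*} {l : List α} {f : α → Bool} {b : Bool} :
    l.foldl (fun b e => b || f e) b = true ↔ b = true ∨ ∃ e ∈ l, f e = true := by
  induction l generalizing b with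
  | nil => simp
  | cons e l ih =>
    rw [List.foldl_cons, ih]
    simp [or_assoc]

namespace LabelCorrecting

open Timed ParityGame OrderedTree Relation

variable {V M : Type} [DecidableEq V] [LinearOrder M]

/-- `a` describes correctly the base node property, the component `K_w` and the digraph `J_w`. -/
structure IsAuxData (G : ParityGame V) (A : V → V → Prop) (w : V) (a : AuxData V) : Prop where
  isBase : a.isBase = true ↔ G.IsBase A w
  scc : ∀ v, a.scc v = true ↔ v ∈ G.sccNode A w
  jArcs : ∀ e, e ∈ a.jArcs ↔ G.jArc A w e.1 e.2

theorem auxData_val [Fintype V] (G : ParityGame V) {A : V → V → Prop} {nodes : List V}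
    (hnodes : ∀ v, v ∈ nodes) {arcs : List (V × V)} (harcs : ∀ e, e ∈ arcs ↔ A e.1 e.2) {n : ℕ}
    (hn : Fintype.card V ≤ n) (w : V) :
    IsAuxData G A w (auxData n nodes arcs G.prio w).val := by
  have hlen : ∀ B : V → V → Prop, ∀ u v P, IsPathFromTo B u v P → P.length ≤ n + 1 :=
    fun B u v P hP => hP.1.length_le_card.trans (by omega)
  unfold auxData
  dsimp +instances only [bind_val, read_val, alloc_val, write_val, step_val]
  simp only [select_val, loop_val]
  dsimp +instances only [bind_val, read_val, alloc_val, write_val, step_val]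
  set low := arcs.filter fun e =>
    decide (G.prio e.1 ≤ G.prio w) && decide (G.prio e.2 ≤ G.prio w) with hlow
  set mark := Function.update (fun _ : V => false) w true with hmark
  have hmark' : ∀ y, mark y = true ↔ y = w := by
    intro y
    by_cases hy : y = w
    · simp [hmark, hy]
    · simp [hmark, hy]
  set bwd := (closure n low mark).val with hbwd
  set rev := low.foldl (fun l e => (e.2, e.1) :: l) [] with hrev
  set fwd := (closure n rev mark).val with hfwd
  have hlow' : ∀ a b, (a, b) ∈ low ↔ G.lowArc A (G.prio w) a b := by
    intro a b
    simp only [hlow, List.mem_filter, harcs, Bool.and_eq_true, decide_eq_true_eq]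
    rfl
  have hbwd' : ∀ x, bwd x = true ↔ ReflTransGen (G.lowArc A (G.prio w)) x w := by
    intro x
    rw [hbwd, closure_val _ _ _ _ (hlen _)]
    simp only [hmark', exists_eq_left, hlow']
  have hfwd' : ∀ x, fwd x = true ↔ ReflTransGen (G.lowArc A (G.prio w)) w x := by
    intro x
    rw [hfwd, closure_val _ _ _ _ (hlen _), ← reflTransGen_swap]
    simp only [hmark', exists_eq_left, hrev, List.mem_foldl_swap_cons, List.not_mem_nil, or_false,
      hlow']
  set scc := nodes.foldl (fun s i => Function.update s i (bwd i && fwd i)) (fun _ => false)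
    with hscc
  have hscc' : ∀ x, scc x = true ↔ x ∈ G.sccNode A w := by
    intro x
    rw [hscc, List.foldl_update_apply, if_pos (hnodes x), Bool.and_eq_true, hbwd', hfwd', and_comm]
    rfl
  set arcs' := low.filter fun e => (scc e.1 && scc e.2) &&
    (decide (G.prio e.2 < G.prio w) || decide (e.2 = w)) with harcs'
  have harcs'' : ∀ a b, (a, b) ∈ arcs' ↔ G.sccArc' A w a b := by
    intro a b
    simp only [harcs', List.mem_filter, hlow', Bool.and_eq_true, Bool.or_eq_true,
      decide_eq_true_eq, hscc', sccArc', mem_topNodes_sccNode, lowArc]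
    constructor
    · rintro ⟨⟨h1, -, -⟩, ⟨h2, h3⟩, h4⟩
      exact ⟨h2, h3, h1, fun h => h4.resolve_left h.2.not_lt⟩
    · rintro ⟨h1, h2, h3, h4⟩
      refine ⟨⟨h3, prio_le_of_mem_sccNode h1, prio_le_of_mem_sccNode h2⟩, ⟨h1, h2⟩, ?_⟩
      exact (prio_le_of_mem_sccNode h2).lt_or_eq.imp_right fun h => h4 ⟨h2, h⟩
  refine ⟨?_, hscc', ?_⟩
  · simp only [Bool.and_eq_true, decide_eq_true_eq, List.foldl_or_eq_true, hbwd', isBase_iff,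
      Nat.even_iff, TransGen.head'_iff, Bool.false_eq_true, false_or]
    refine and_congr_right fun _ => ⟨?_, ?_⟩
    · rintro ⟨⟨a, b⟩, hab, rfl, hb⟩
      exact ⟨b, (hlow' _ _).1 hab, hb⟩
    · rintro ⟨b, hb, h⟩
      exact ⟨(w, b), (hlow' _ _).2 hb, rfl, h⟩
  · rintro ⟨a, b⟩
    simp only [List.mem_filter, harcs'', closure_val _ _ _ _ (hlen _), hmark', exists_eq_left]
    constructor
    · rintro ⟨h1, h2⟩
      exact jArc_of_sccArc' h1 h2
    · intro h
      exact ⟨h.2.2, h.2.1.2⟩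

theorem length_jArcs_le (n : ℕ) (nodes : List V) (arcs : List (V × V)) (prio : V → ℕ) (w : V) :
    (auxData n nodes arcs prio w).val.jArcs.length ≤ arcs.length := by
  unfold auxData
  dsimp +instances only [bind_val, read_val, alloc_val, write_val, step_val]
  simp only [select_val, loop_val]
  dsimp +instances only [bind_val, read_val, alloc_val, write_val, step_val]
  exact (List.length_filter_le _ _).trans
    ((List.length_filter_le _ _).trans (List.length_filter_le _ _))

theorem construct_val (n : ℕ) {nodes : List V} (hnodes : ∀ v, v ∈ nodes) (arcs : List (V × V))
    (prio : V → ℕ) (w : V) :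
    (construct n nodes arcs prio).val w = (auxData n nodes arcs prio w).val := by
  unfold construct
  simp only [bind_val, loop_val, alloc_val, write_val]
  rw [List.foldl_update_apply, if_pos (hnodes w)]

/-! ### Arc costs -/

section Costs

variable {G : ParityGame V} {A : V → V → Prop} {nodes : List V} {jArcs : List (V × V)}
  {ch : List (OrderedTree M)} {w : V} {n γ : ℕ}

theorem probe_val_none (i : ℕ) (hi : ch[i]? = none) (u : V) :
    (probe γ n nodes G.prio jArcs w ch i).val u = false := by
  unfold probe
  simp [hi]

theorem probe_val (hnodes : ∀ v, v ∈ nodes) {i : ℕ} {S : OrderedTree M} (hi : ch[i]? = some S)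
    (u : V) : (probe γ n nodes G.prio jArcs w ch i).val u = true ↔
      G.relaxAll S (List.replicate (n - 1) jArcs) (Function.update (fun _ => ⊤) w S.minLabel) u ≠
        ⊤ := by
  unfold probe
  dsimp only [bind_val, step_val, alloc_val]
  rw [hi]
  dsimp +instances only [bind_val, read_val, alloc_val, write_val, step_val, charge_val]
  simp only [loop_val, bellmanFord_val]
  dsimp +instances only [bind_val, read_val, alloc_val, write_val, step_val]
  rw [List.foldl_update_apply, if_pos (hnodes u), decide_eq_true_iff]

end Costs

end LabelCorrecting


/-- The result of a loop over distinct indices whose body changes the visited cell only, depending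
on its contents. -/
theorem List.foldl_update_self_apply {V α : Type*} [DecidableEq V] {l : List V} (hl : l.Nodup)
    (f : V → α → α) (s : V → α) (x : V) :
    (l.foldl (fun s i => Function.update s i (f i (s i))) s) x =
      if x ∈ l then f x (s x) else s x := by
  induction l generalizing s with
  | nil => simp
  | cons a l ih =>
    obtain ⟨ha, hl⟩ := List.nodup_cons.1 hl
    rw [List.foldl_cons, ih hl]
    by_cases hxa : x = a
    · subst hxa; simp [ha]
    · simp [hxa]

namespace LabelCorrecting

open Timed ParityGame OrderedTree Relation

variable {V M : Type} [DecidableEq V] [LinearOrder M]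

section Costs

variable {G : ParityGame V} {A : V → V → Prop} {nodes : List V} {jArcs : List (V × V)}
  {ch : List (OrderedTree M)} {w : V} {n γ : ℕ}

/-- As the trees of a chain embed into one another, finiteness is monotone along the chain. -/
theorem probe_mono (hnodes : ∀ v, v ∈ nodes) (hch : ch.Pairwise StrictEmbeds)
    (hheight : ∀ S ∈ ch, ∀ S' ∈ ch, S.height = S'.height) {i i' : ℕ} (hi : i ≤ i')
    (hlen : i' < ch.length) {u : V} (h : (probe γ n nodes G.prio jArcs w ch i).val u = true) :
    (probe γ n nodes G.prio jArcs w ch i').val u = true := by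
  have hS := List.getElem?_eq_getElem (hi.trans_lt hlen)
  have hS' := List.getElem?_eq_getElem hlen
  rw [probe_val hnodes hS] at h
  rw [probe_val hnodes hS']
  obtain ⟨g, hg⟩ := (embeds_of_pairwise hch hi hS hS').exists_isLabelMap
    (hheight _ (List.getElem_mem _) _ (List.getElem_mem _))
  have hle := relaxAll_le_comp (G := G) (hg ((jArcs.map fun e => G.prio e.1).sum))
    (ps := List.replicate (n - 1) jArcs) (fun l hl e he => by
      rw [List.eq_of_mem_replicate hl] at he
      exact List.le_sum_of_mem (List.mem_map_of_mem he))
    (ν := Function.update (fun _ => ⊤) w ch[i].minLabel)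
    (ν' := Function.update (fun _ => ⊤) w ch[i'].minLabel) (by
      rw [update_le_iff]
      refine ⟨minLabel_le _, fun x hx => ?_⟩
      rw [Function.comp, Function.update_of_ne hx, (hg 0).eq_top.2 rfl])
  exact fun htop => h ((hg 0).eq_top.1 (top_le_iff.1 (htop ▸ hle u)))

/-- The binary search finds the least index in `[lo, hi)` with a finite label, or `hi` if there is
none. -/
theorem binarySearch_val (hmono : ∀ i i', i ≤ i' → i' < ch.length → ∀ u,
      (probe γ n nodes G.prio jArcs w ch i).val u = true →
        (probe γ n nodes G.prio jArcs w ch i').val u = true) (u : V) (fuel lo hi : ℕ)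
    (hlohi : lo ≤ hi) (hhi : hi ≤ ch.length) (hfuel : hi - lo < 2 ^ fuel) :
    let r := (binarySearch γ n nodes G.prio jArcs w ch u fuel lo hi).val
    r ≤ hi ∧ (r < hi → (probe γ n nodes G.prio jArcs w ch r).val u = true) ∧
      ∀ i, lo ≤ i → i < hi → (probe γ n nodes G.prio jArcs w ch i).val u = true → r ≤ i := by
  induction fuel generalizing lo hi with
  | zero =>
    obtain rfl : lo = hi := by simp at hfuel; omega
    refine ⟨le_rfl, fun h => absurd h (lt_irrefl _), fun i h1 h2 => by omega⟩
  | succ fuel ih =>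
    intro r
    rw [pow_succ] at hfuel
    by_cases hlt : lo < hi
    · by_cases hf : (probe γ n nodes G.prio jArcs w ch ((lo + hi) / 2)).val u = true
      · have hr : r = (binarySearch γ n nodes G.prio jArcs w ch u fuel lo ((lo + hi) / 2)).val := by
          simp [r, binarySearch, hlt, hf]
        obtain ⟨h1, h2, h3⟩ := ih lo ((lo + hi) / 2) (by omega) (by omega) (by omega)
        rw [← hr] at h1 h2 h3
        refine ⟨by omega, fun _ => ?_, fun i hi1 hi2 hi3 => ?_⟩
        · rcases h1.lt_or_eq with h | h
          · exact h2 h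
          · rw [h]; exact hf
        · by_cases h : i < (lo + hi) / 2
          · exact h3 i hi1 h hi3
          · omega
      · have hr : r =
            (binarySearch γ n nodes G.prio jArcs w ch u fuel ((lo + hi) / 2 + 1) hi).val := by
          simp [r, binarySearch, hlt, hf]
        obtain ⟨h1, h2, h3⟩ := ih ((lo + hi) / 2 + 1) hi (by omega) hhi (by omega)
        rw [← hr] at h1 h2 h3
        refine ⟨h1, h2, fun i hi1 hi2 hi3 => h3 i ?_ hi2 hi3⟩
        by_contra hlt'
        exact hf (hmono i _ (by omega) (by omega) u hi3)
    · have hr : r = lo := by simp [r, binarySearch, hlt]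
      exact ⟨by omega, by omega, by omega⟩

/-- Both search methods return the least index of a tree for which the label is finite. -/
theorem firstFinite_val (hnodes : ∀ v, v ∈ nodes) (hnd : nodes.Nodup)
    (hmono : ∀ i i', i ≤ i' → i' < ch.length → ∀ u,
      (probe γ n nodes G.prio jArcs w ch i).val u = true →
        (probe γ n nodes G.prio jArcs w ch i').val u = true) (u : V) :
    let x := (firstFinite γ n nodes G.prio jArcs w ch).val u
    (∀ i : ℕ, x = i → (probe γ n nodes G.prio jArcs w ch i).val u = true) ∧
      ∀ i < ch.length, (probe γ n nodes G.prio jArcs w ch i).val u = true → x ≤ i := by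
  intro x
  by_cases hshort : ch.length ≤ n * (Nat.log 2 ch.length + 1)
  · have hbody : ∀ (i : ℕ) (idx : V → ℕ∞) (u : V), (do
        let f ← read (probe γ n nodes G.prio jArcs w ch i).val u
        let x ← read idx u
        let new ← step (decide (x = ⊤))
        let b ← step (f && new)
        if b then write idx u (i : ℕ∞) else step idx : Timed _).val =
          Function.update idx u
            (if (probe γ n nodes G.prio jArcs w ch i).val u = true ∧ idx u = ⊤ then (i : ℕ∞)
              else idx u) := by
      intro i idx u
      by_cases h1 : (probe γ n nodes G.prio jArcs w ch i).val u = true <;>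
        by_cases h2 : idx u = ⊤ <;> simp [h1, h2]
    have hx : x = (List.range ch.length).foldl (fun (idx : V → ℕ∞) i => nodes.foldl (fun idx u =>
        Function.update idx u
            (if (probe γ n nodes G.prio jArcs w ch i).val u = true ∧ idx u = ⊤ then (i : ℕ∞)
              else idx u)) idx) (fun _ => ⊤) u := by
      simp only [← hbody]
      simp [x, firstFinite, hshort, loop_val]
    suffices H : ∀ m, (∀ i : ℕ, (List.range m).foldl (fun (idx : V → ℕ∞) i => nodes.foldl
        (fun idx u => Function.update idx u
            (if (probe γ n nodes G.prio jArcs w ch i).val u = true ∧ idx u = ⊤ then (i : ℕ∞)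
              else idx u)) idx) (fun _ => ⊤) u = i →
          i < m ∧ (probe γ n nodes G.prio jArcs w ch i).val u = true) ∧
        ∀ i < m, (probe γ n nodes G.prio jArcs w ch i).val u = true →
          (List.range m).foldl (fun (idx : V → ℕ∞) i => nodes.foldl (fun idx u =>
            Function.update idx u
              (if (probe γ n nodes G.prio jArcs w ch i).val u = true ∧ idx u = ⊤ then (i : ℕ∞)
                else idx u)) idx) (fun _ => ⊤) u ≤ i by
      rw [hx]
      exact ⟨fun i hi => ((H _).1 i hi).2, (H _).2⟩
    clear hx x hshort
    intro m
    induction m with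
    | zero =>
      refine ⟨fun i hi => ?_, fun i hi => by omega⟩
      exact absurd hi (ENat.top_ne_natCast i)
    | succ m ih =>
      obtain ⟨h1, h2⟩ := ih
      rw [List.range_succ, List.foldl_append, List.foldl_cons, List.foldl_nil]
      set idx : V → ℕ∞ := (List.range m).foldl (fun (idx : V → ℕ∞) i => nodes.foldl (fun idx u =>
        Function.update idx u
            (if (probe γ n nodes G.prio jArcs w ch i).val u = true ∧ idx u = ⊤ then (i : ℕ∞)
              else idx u)) idx) (fun _ => ⊤)
      rw [List.foldl_update_self_apply hnd (fun u x =>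
        if (probe γ n nodes G.prio jArcs w ch m).val u = true ∧ x = ⊤ then (m : ℕ∞) else x),
        if_pos (hnodes u)]
      split_ifs with h
      · refine ⟨fun i hi => ?_, fun i hi hf => ?_⟩
        · obtain rfl : m = i := by exact_mod_cast hi
          exact ⟨by omega, h.1⟩
        · rcases Nat.lt_succ_iff_lt_or_eq.1 hi with hlt | rfl
          · have := h2 i hlt hf
            rw [h.2] at this
            exact absurd (top_le_iff.1 this) (ENat.natCast_ne_top i)
          · exact le_rfl
      · refine ⟨fun i hi => ⟨((h1 i hi).1).trans (Nat.lt_succ_self m), (h1 i hi).2⟩,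
          fun i hi hf => ?_⟩
        rcases Nat.lt_succ_iff_lt_or_eq.1 hi with hlt | rfl
        · exact h2 i hlt hf
        · obtain ⟨c, hc⟩ := ENat.ne_top_iff_exists.1 fun h' => h ⟨hf, h'⟩
          rw [← hc]
          exact_mod_cast (h1 c hc.symm).1.le
  · set bits := Nat.log 2 ch.length + 1 with hbits
    set r := (binarySearch γ n nodes G.prio jArcs w ch u bits 0 ch.length).val with hr
    have hx : x = if r < ch.length then (r : ℕ∞) else ⊤ := by
      have hbody : ∀ (idx : V → ℕ∞) (u : V), (do
          let i ← binarySearch γ n nodes G.prio jArcs w ch u bits 0 ch.length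
          let b ← step (decide (i < ch.length))
          if b then write idx u (i : ℕ∞) else step idx : Timed _).val =
          Function.update idx u
            (if (binarySearch γ n nodes G.prio jArcs w ch u bits 0 ch.length).val < ch.length then
              ((binarySearch γ n nodes G.prio jArcs w ch u bits 0 ch.length).val : ℕ∞)
              else idx u) := by
        intro idx u
        by_cases h : (binarySearch γ n nodes G.prio jArcs w ch u bits 0 ch.length).val < ch.length
          <;> simp [h]
      have hx : x = nodes.foldl (fun (idx : V → ℕ∞) u => Function.update idx u
            (if (binarySearch γ n nodes G.prio jArcs w ch u bits 0 ch.length).val < ch.length then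
              ((binarySearch γ n nodes G.prio jArcs w ch u bits 0 ch.length).val : ℕ∞)
              else idx u)) (fun _ => ⊤) u := by
        simp only [← hbody]
        rw [← loop_val, hbits]
        rw [hbits] at hshort
        change (firstFinite γ n nodes G.prio jArcs w ch).val u = _
        unfold firstFinite
        dsimp +instances only [bind_val, step_val, charge_val, alloc_val]
        rw [decide_eq_false hshort, if_neg Bool.false_ne_true]
      rw [hx, List.foldl_update_self_apply hnd (fun u x =>
        if (binarySearch γ n nodes G.prio jArcs w ch u bits 0 ch.length).val < ch.length then
          ((binarySearch γ n nodes G.prio jArcs w ch u bits 0 ch.length).val : ℕ∞) else x),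
        if_pos (hnodes u)]
    obtain ⟨h1, h2, h3⟩ := binarySearch_val hmono u bits 0 ch.length (Nat.zero_le _) le_rfl
      (by rw [Nat.sub_zero]; exact Nat.lt_pow_succ_log_self (by norm_num) _)
    rw [← hr] at h1 h2 h3
    rw [hx]
    refine ⟨fun i hi => ?_, fun i hi hf => ?_⟩
    · split_ifs at hi with h
      · obtain rfl : r = i := by exact_mod_cast hi
        exact h2 h
      · exact absurd hi (ENat.top_ne_natCast i)
    · have := h3 i (Nat.zero_le _) hi hf
      rw [if_pos (this.trans_lt hi)]
      exact_mod_cast this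

/-- The cost of `vw` is the minimum of the indices found for the heads of the arcs of `J_w` leaving
`v`. -/
theorem arcCosts_val (v : V) :
    let col := (arcCosts γ n nodes G.prio jArcs w ch).val
    let idx := (firstFinite γ n nodes G.prio jArcs w ch).val
    (∀ u, (v, u) ∈ jArcs → col v ≤ idx u) ∧ (col v = ⊤ ∨ ∃ u, (v, u) ∈ jArcs ∧ col v = idx u) := by
  intro col idx
  have hbody : ∀ (cost : V → ℕ∞) (e : V × V), (do
      let x ← read idx e.2
      let y ← read cost e.1
      let b ← step (decide (x < y))
      if b then write cost e.1 x else step cost : Timed _).val =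
        Function.update cost e.1 (min (idx e.2) (cost e.1)) := by
    intro cost e
    by_cases h : idx e.2 < cost e.1
    · simp [h, h.le]
    · simp [h, not_lt.1 h]
  have hcol : col = jArcs.foldl
      (fun cost e => Function.update cost e.1 (min (idx e.2) (cost e.1))) (fun _ => ⊤) := by
    simp only [← hbody]
    simp [col, arcCosts, loop_val, idx]
  rw [hcol]
  clear hcol
  generalize jArcs = l
  induction l using List.reverseRecOn with
  | nil => simp
  | append_singleton l e ih =>
    obtain ⟨a, b⟩ := e
    rw [List.foldl_append, List.foldl_cons, List.foldl_nil]
    set c : V → ℕ∞ := l.foldl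
      (fun cost e => Function.update cost e.1 (min (idx e.2) (cost e.1))) (fun _ => ⊤)
    obtain ⟨h1, h2⟩ := ih
    by_cases hv : v = a
    · subst hv
      rw [Function.update_self]
      refine ⟨fun u hu => ?_, ?_⟩
      · rcases List.mem_append.1 hu with hu | hu
        · exact (min_le_right _ _).trans (h1 u hu)
        · obtain rfl : u = b := by simpa using hu
          exact min_le_left _ _
      · rcases min_choice (idx b) (c v) with h | h
        · exact Or.inr ⟨b, by simp, h⟩
        · rw [h]
          exact h2.imp_right fun ⟨u, hu, h⟩ => ⟨u, by simp [hu], h⟩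
    · rw [Function.update_of_ne hv]
      refine ⟨fun u hu => h1 u ?_, h2.imp_right fun ⟨u, hu, h⟩ => ⟨u, by simp [hu], h⟩⟩
      simpa [hv] using hu

/-- The computed arc costs are admissible.  The passes of Bellman–Ford on `J_w` suffice to
discover paths, hence the upper bound; the labels never fall below the greatest labeling, hence the
lower bound. -/
theorem arcCosts_bounds [Fintype V] (hnodes : ∀ v, v ∈ nodes) (hnd : nodes.Nodup)
    (hn : n = Fintype.card V) (hj : ∀ e, e ∈ jArcs ↔ G.jArc A w e.1 e.2)
    (hch : ch.Pairwise StrictEmbeds) (hheight : ∀ S ∈ ch, ∀ S' ∈ ch, S.height = S'.height)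
    (v : V) :
    G.costLower A ch v w ≤ (arcCosts γ n nodes G.prio jArcs w ch).val v ∧
      (arcCosts γ n nodes G.prio jArcs w ch).val v ≤ G.costUpper A ch v w := by
  have hff := firstFinite_val (n := n) (γ := γ) (w := w) (jArcs := jArcs) hnodes hnd
    fun i i' hi hlen u h => probe_mono (G := G) hnodes hch hheight hi hlen h
  obtain ⟨h1, h2⟩ := arcCosts_val (G := G) (jArcs := jArcs) (w := w) (ch := ch) (n := n) (γ := γ)
    (nodes := nodes) v
  constructor
  · rcases h2 with h2 | ⟨u, hu, h2⟩
    · rw [h2]; exact le_top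
    by_cases htop : (arcCosts γ n nodes G.prio jArcs w ch).val v = ⊤
    · rw [htop]; exact le_top
    obtain ⟨i, hi⟩ := ENat.ne_top_iff_exists.1 htop
    have hfin := (hff u).1 i (h2.symm.trans hi.symm)
    rw [← hi]
    cases hS : ch[i]? with
    | none => rw [probe_val_none i hS] at hfin; exact absurd hfin Bool.false_ne_true
    | some S =>
      rw [probe_val hnodes hS] at hfin
      obtain ⟨ν, hν⟩ := exists_isLam (G := G) A S w
      refine sInf_le ⟨i, rfl, S, hS, ν, hν, u, (hj _).1 hu, ne_top_of_le_ne_top hfin ?_⟩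
      rw [isLam_iff] at hν
      refine le_relaxAll (G := G) ?_ (fun l hl e he => ?_) u
      · rw [le_update_iff]
        exact ⟨hν.1.2.le, fun _ _ => le_top⟩
      · rw [List.eq_of_mem_replicate hl] at he
        exact hν.1.1 _ _ ((hj e).1 he)
  · refine le_sInf ?_
    rintro _ ⟨u, P, hvu, hP, rfl⟩
    refine le_sInf ?_
    rintro _ ⟨i, rfl, S, hS, ν, hν, σ, hσ, hn'⟩
    refine (h1 u ((hj _).2 hvu)).trans ((hff u).2 i (List.getElem?_eq_some_iff.1 hS).1 ?_)
    rw [probe_val hnodes hS]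
    refine ne_top_of_le_ne_top (hν u)
      (relaxAll_apply_le (P := P) (w := w) ?_ hP.2.2.1 hP.2.2.2 ?_ ?_)
    · refine (hP.2.1.and (isChain_pathArc P)).imp fun x y hxy => ⟨fun l hl => ?_, ?_⟩
      · rw [List.eq_of_mem_replicate hl]
        exact (hj _).2 hxy.1
      · exact hn' x y hxy.2 fun hx => pathArc_unique hP.1 hxy.2 (hσ x hx ⟨y, hxy.2⟩)
    · rw [Function.update_self]
      exact minLabel_le _
    · have := hP.1.length_le_card
      simp only [List.length_replicate]
      omega

end Costs

end LabelCorrecting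


/-! ### Minimum bottleneck costs and the processing of a chain -/

section Foldl

variable {ι σ : Type*} [Preorder σ] {f : σ → ι → σ}

theorem List.foldl_le_of_forall_le (hf : ∀ s i, f s i ≤ s) (l : List ι) (s : σ) :
    l.foldl f s ≤ s := by
  induction l generalizing s with
  | nil => exact le_rfl
  | cons i l ih => exact (ih _).trans (hf s i)

/-- If a loop only decreases its state, then what a single iteration achieves persists. -/
theorem List.foldl_of_mem (hf : ∀ s i, f s i ≤ s) {Q : σ → Prop}
    (hQ : ∀ s t, t ≤ s → Q s → Q t) {l : List ι} {i : ι} (hi : i ∈ l) {s₀ : σ}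
    (h : ∀ s ≤ s₀, Q (f s i)) : Q (l.foldl f s₀) := by
  induction l generalizing s₀ with
  | nil => simp at hi
  | cons a l ih =>
    rcases List.mem_cons.1 hi with rfl | hi
    · exact hQ _ _ (List.foldl_le_of_forall_le hf l _) (h s₀ le_rfl)
    · exact ih hi fun s hs => h s (hs.trans (hf _ _))

end Foldl

/-- There is a walk of length at least one all of whose inner nodes lie in `X`. -/
inductive WalkVia {V : Type*} (E : V → V → Prop) (X : V → Prop) : V → V → Prop
  | single {v w : V} : E v w → WalkVia E X v w
  | head {v y w : V} : E v y → X y → WalkVia E X y w → WalkVia E X v w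

/-- If the inner nodes of a walk lie in `X` or are equal to `x`, then they all lie in `X`, or those
before the first visit of `x` and those after the last one do. -/
theorem WalkVia.split {V : Type*} {E : V → V → Prop} {X Y : V → Prop} {x : V}
    (hY : ∀ y, Y y → X y ∨ y = x) {v w : V} (h : WalkVia E Y v w) :
    WalkVia E X v w ∨ (WalkVia E X v x ∧ WalkVia E X x w) := by
  induction h with
  | single h => exact .inl (.single h)
  | head h hy _ ih =>
    rcases hY _ hy with hy | rfl
    · exact ih.imp (.head h hy) fun ih => ⟨.head h hy ih.1, ih.2⟩
    · exact .inr ⟨.single h, ih.elim id fun ih => ih.2⟩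

namespace LabelCorrecting

open Timed ParityGame OrderedTree Relation

variable {V M : Type} [DecidableEq V] [LinearOrder M]

/-- The elementary step of the Floyd–Warshall method: allow the walks from `v` to `w` to pass
through `x`. The first index of `dist` is the end of the walk. -/
noncomputable def shortcut (x w v : V) (dist : V → V → ℕ∞) : V → V → ℕ∞ :=
  Function.update dist w (Function.update (dist w) v
    (min (dist w v) (max (dist w x) (dist x v))))

theorem shortcut_self (x w v : V) (dist : V → V → ℕ∞) :
    shortcut x w v dist w v = min (dist w v) (max (dist w x) (dist x v)) := by
  simp [shortcut]

theorem shortcut_of_ne {x w v a b : V} (h : ¬ (a = w ∧ b = v)) (dist : V → V → ℕ∞) :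
    shortcut x w v dist a b = dist a b := by
  unfold shortcut
  by_cases ha : a = w
  · subst ha
    rw [Function.update_self, Function.update_of_ne fun hb => h ⟨rfl, hb⟩]
  · rw [Function.update_of_ne ha]

theorem shortcut_le (x w v : V) (dist : V → V → ℕ∞) : shortcut x w v dist ≤ dist := by
  intro a b
  by_cases h : a = w ∧ b = v
  · obtain ⟨rfl, rfl⟩ := h
    rw [shortcut_self]
    exact min_le_left _ _
  · rw [shortcut_of_ne h]

theorem bottleneck_val (H : List V) (dist : V → V → ℕ∞) :
    (bottleneck H dist).val = H.foldl (fun dist x => H.foldl (fun dist w =>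
      H.foldl (fun dist v => shortcut x w v dist) dist) dist) dist := by
  unfold bottleneck
  simp only [loop_val]
  congr 1
  funext dist x
  congr 1
  funext dist w
  congr 1
  funext dist v
  unfold shortcut
  by_cases h : max (dist w x) (dist x v) < dist w v
  · rw [min_eq_right h.le]
    simp [h]
  · rw [min_eq_left (not_lt.1 h), Function.update_eq_self, Function.update_eq_self]
    simp [h]

/-- After the Floyd–Warshall computation, the diagonal entry of `w` is at most `c` if and only if
there is a closed walk through `w` whose arcs have cost at most `c`. -/
theorem bottleneck_le_iff {H : List V} {dist : V → V → ℕ∞} {c : ℕ} {E : V → V → Prop}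
    (hE : ∀ v ∈ H, ∀ w ∈ H, dist w v ≤ c ↔ E v w) (hH : ∀ v w, E v w → w ∈ H → v ∈ H)
    {w : V} (hw : w ∈ H) : (bottleneck H dist).val w w ≤ c ↔ TransGen E w w := by
  rw [bottleneck_val]
  constructor
  · have : ∀ v ∈ H, ∀ w ∈ H, H.foldl (fun dist x => H.foldl (fun dist w =>
        H.foldl (fun dist v => shortcut x w v dist) dist) dist) dist w v ≤ c → TransGen E v w := by
      refine List.foldl_invariant
        (Inv := fun D : V → V → ℕ∞ => ∀ v ∈ H, ∀ w ∈ H, D w v ≤ c → TransGen E v w)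
        (fun v hv w hw h => .single ((hE v hv w hw).1 h)) fun x hx D hD => ?_
      refine List.foldl_invariant
        (Inv := fun D : V → V → ℕ∞ => ∀ v ∈ H, ∀ w ∈ H, D w v ≤ c → TransGen E v w)
        hD fun w hw D hD => ?_
      refine List.foldl_invariant
        (Inv := fun D : V → V → ℕ∞ => ∀ v ∈ H, ∀ w ∈ H, D w v ≤ c → TransGen E v w)
        hD fun v hv D hD => ?_
      intro b hb a ha hab
      by_cases h : a = w ∧ b = v
      · obtain ⟨rfl, rfl⟩ := h
        rw [shortcut_self, min_le_iff, max_le_iff] at hab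
        rcases hab with hab | ⟨h1, h2⟩
        · exact hD b hb a ha hab
        · exact (hD b hb x hx h2).trans (hD x hx a ha h1)
      · rw [shortcut_of_ne h] at hab
        exact hD b hb a ha hab
    exact this w hw w hw
  · intro h
    have hvia : ∀ v, TransGen E v w → WalkVia E (· ∈ H) v w ∧ v ∈ H := by
      intro v hv
      induction hv using TransGen.head_induction_on with
      | single h => exact ⟨.single h, hH _ _ h hw⟩
      | head h _ ih => exact ⟨.head h ih.2 ih.1, hH _ _ h ih.2⟩
    -- after the iterations for the nodes in `l`, walks via `l` have been taken into account
    suffices Hs : ∀ l : List V, (∀ x ∈ l, x ∈ H) → ∀ v ∈ H, ∀ w ∈ H, WalkVia E (· ∈ l) v w →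
        l.foldl (fun dist x => H.foldl (fun dist w =>
          H.foldl (fun dist v => shortcut x w v dist) dist) dist) dist w v ≤ c from
      Hs H (fun _ h => h) w hw w hw (hvia w h).1
    intro l
    induction l using List.reverseRecOn with
    | nil =>
      intro _ v hv w hw hvw
      cases hvw with
      | single h => exact (hE v hv w hw).2 h
      | head _ h _ => simp at h
    | append_singleton l x ih =>
      intro hl v hv w hw hvw
      rw [List.foldl_append, List.foldl_cons, List.foldl_nil]
      set D := l.foldl (fun dist x => H.foldl (fun dist w =>
          H.foldl (fun dist v => shortcut x w v dist) dist) dist) dist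
      have ih' := ih fun x hx => hl x (by simp [hx])
      have hx : x ∈ H := hl x (by simp)
      have hrow : ∀ w (D : V → V → ℕ∞), H.foldl (fun dist v => shortcut x w v dist) D ≤ D :=
        fun w D => List.foldl_le_of_forall_le (fun s v => shortcut_le x w v s) H D
      rcases hvw.split (X := (· ∈ l)) (x := x) (fun y hy => by simpa using hy) with h | ⟨h1, h2⟩
      · exact (List.foldl_le_of_forall_le (fun s w => hrow w s) H D w v).trans (ih' v hv w hw h)
      · have h1' := ih' v hv x hx h1
        have h2' := ih' x hx w hw h2
        refine List.foldl_of_mem (Q := fun D : V → V → ℕ∞ => D w v ≤ c) (fun s w => hrow w s)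
          (fun s t hst hs => (hst w v).trans hs) hw fun s hs => ?_
        refine List.foldl_of_mem (Q := fun D : V → V → ℕ∞ => D w v ≤ c)
          (fun s v => shortcut_le x w v s) (fun s t hst hs => (hst w v).trans hs) hv fun t ht => ?_
        rw [shortcut_self]
        exact (min_le_right _ _).trans (max_le (((ht.trans hs) w x).trans h2')
          (((ht.trans hs) x v).trans h1'))

/-- The label offered to a node with the label `a` by a chain with the minimum cycle cost `i`; no
cycle, that is `i = ⊤`, offers top. -/
noncomputable def offer {T : OrderedTree M} (C : T.Cover) (a : T.Label) (i : ℕ∞) (j k : ℕ) :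
    T.Label :=
  if i = ⊤ then ⊤ else T.raise C a i.toNat j k

variable {T : OrderedTree M} {C : T.Cover} {μ : V → T.Label} {γ ρ n : ℕ} {nodes : List V}
  {prio : V → ℕ} {aux : V → AuxData V} {H : List V}

theorem processChain_val (hH : H.Nodup) (j k : ℕ) (ch : List (OrderedTree M)) (ν : V → T.Label)
    (w : V) :
    (processChain γ ρ n nodes prio aux T C μ H j k ch ν).val w =
      if w ∈ H then min (ν w) (offer C (μ w) ((bottleneck H fun w => if w ∈ H then
        (arcCosts γ n nodes prio (aux w).jArcs w ch).val else fun _ => ⊤).val w w) j k)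
      else ν w := by
  have hdist : (H.foldl (fun dist w => Function.update dist w
      (arcCosts γ n nodes prio (aux w).jArcs w ch).val) (fun _ _ => ⊤)) = fun w => if w ∈ H then
        (arcCosts γ n nodes prio (aux w).jArcs w ch).val else fun _ => ⊤ := by
    funext x
    rw [List.foldl_update_apply]
  unfold processChain
  dsimp +instances only [bind_val, alloc_val, read_val, write_val]
  simp only [loop_val]
  dsimp +instances only [bind_val, alloc_val, read_val, write_val]
  rw [hdist]
  set D := (bottleneck H fun w => if w ∈ H then
        (arcCosts γ n nodes prio (aux w).jArcs w ch).val else fun _ => ⊤).val with hD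
  rw [← List.foldl_update_self_apply hH (fun w a => min a (offer C (μ w) (D w w) j k))]
  refine congr_fun (congrArg (fun f => H.foldl f ν) ?_) w
  funext ν w
  cases D w w with
  | top =>
    change ν = _
    simp [offer]
  | coe i =>
    have hi : ((i : ℕ) : ℕ∞) ≠ ⊤ := ENat.natCast_ne_top i
    by_cases h : T.raise C (μ w) i j k < ν w
    · simp [offer, labelLt, h, h.le]
    · simp [offer, labelLt, h, not_lt.1 h]

end LabelCorrecting


/-! ### The program is a run of the algorithm -/

theorem Finset.inf_range_succ_eq_min {α : Type*} [LinearOrder α] [OrderTop α] (f : ℕ → α) (n : ℕ) :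
    (Finset.range (n + 1)).inf f = min (f 0) ((Finset.range n).inf fun i => f (i + 1)) := by
  apply le_antisymm
  · refine le_min (Finset.inf_le (by simp)) (Finset.le_inf fun i hi => Finset.inf_le ?_)
    have := Finset.mem_range.1 hi
    simpa using this
  · refine Finset.le_inf fun i hi => ?_
    cases i with
    | zero => exact min_le_left _ _
    | succ i =>
      refine (min_le_right _ _).trans (Finset.inf_le (f := fun i => f (i + 1)) ?_)
      simpa using hi

theorem ENat.eq_of_forall_le_natCast_iff {a b : ℕ∞} (h : ∀ c : ℕ, a ≤ c ↔ b ≤ c) : a = b := by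
  apply le_antisymm
  · cases b with
    | top => exact le_top
    | coe c => exact (h c).2 le_rfl
  · cases a with
    | top => exact le_top
    | coe c => exact (h c).1 le_rfl

namespace LabelCorrecting

open Timed ParityGame OrderedTree Relation

section Components

variable {V : Type} {G : ParityGame V} {A : V → V → Prop} {nodes H : List V} {aux : V → AuxData V}

/-- `H` lists the nodes of highest priority of the component `K_w` of a base node `w`, that is, the
nodes which the program treats as the component of `D` containing `w`. -/
def IsComponent (G : ParityGame V) (A : V → V → Prop) (w : V) (H : List V) : Prop :=
  G.IsBase A w ∧ H.Nodup ∧ ∀ v, v ∈ H ↔ v ∈ G.sccNode A w ∧ G.prio v = G.prio w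

theorem sccNode_eq {v w : V} (hv : v ∈ G.sccNode A w) (hp : G.prio v = G.prio w) :
    G.sccNode A v = G.sccNode A w := by
  ext u
  simp only [sccNode, hp, Set.mem_ofPred_eq]
  exact ⟨fun h => ⟨hv.1.trans h.1, h.2.trans hv.2⟩, fun h => ⟨hv.2.trans h.1, h.2.trans hv.1⟩⟩

theorem isBase_of_mem_sccNode {v w : V} (hw : G.IsBase A w) (hv : v ∈ G.sccNode A w)
    (hp : G.prio v = G.prio w) : G.IsBase A v := by
  rw [isBase_iff] at hw ⊢
  rw [hp]
  exact ⟨hw.1, (TransGen.trans_right hv.2 hw.2).trans_left hv.1⟩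

theorem IsComponent.self_mem {w : V} (h : IsComponent G A w H) : w ∈ H :=
  (h.2.2 w).2 ⟨mem_sccNode_self w, rfl⟩

theorem IsComponent.of_mem {v w : V} (h : IsComponent G A w H) (hv : v ∈ H) :
    IsComponent G A v H := by
  obtain ⟨h1, h2⟩ := (h.2.2 v).1 hv
  refine ⟨isBase_of_mem_sccNode h.1 h1 h2, h.2.1, fun u => ?_⟩
  rw [h.2.2, sccNode_eq h1 h2, h2]

/-- The list of these nodes which the program computes. -/
def component (nodes : List V) (prio : V → ℕ) (aux : V → AuxData V) (w : V) : List V :=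
  nodes.filter fun v => (aux w).scc v && decide (prio v = prio w)

theorem isComponent_component (hnodes : ∀ v, v ∈ nodes) (hnd : nodes.Nodup)
    (haux : ∀ w, IsAuxData G A w (aux w)) {w : V} (hw : G.IsBase A w) :
    IsComponent G A w (component nodes G.prio aux w) := by
  refine ⟨hw, hnd.filter _, fun v => ?_⟩
  simp [component, hnodes, (haux w).scc]

end Components

variable {V M : Type} [DecidableEq V] [LinearOrder M]
variable {G : ParityGame V} {A : V → V → Prop} {T : OrderedTree M} {C : T.Cover} {μ : V → T.Label}
  {γ ρ n : ℕ} {nodes : List V} {prio : V → ℕ} {aux : V → AuxData V} {H : List V}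

/-- The costs of the arcs of `D` with respect to the `k`th chain which the program computes; they
are infinite if there is no `k`th chain. -/
noncomputable def runCost (γ n : ℕ) (nodes : List V) (prio : V → ℕ) (aux : V → AuxData V)
    (C : T.Cover) (k : ℕ) (v w : V) : ℕ∞ :=
  match (C.chain (prio w / 2))[k]? with
  | none => ⊤
  | some ch => (arcCosts γ n nodes prio (aux w).jArcs w ch).val v

theorem runCost_eq {k : ℕ} {w : V} {ch : List (OrderedTree M)}
    (h : (C.chain (prio w / 2))[k]? = some ch) (v : V) : runCost γ n nodes prio aux C k v w =
      (arcCosts γ n nodes prio (aux w).jArcs w ch).val v := by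
  unfold runCost
  rw [h]

theorem runCost_bounds [Fintype V] (hnodes : ∀ v, v ∈ nodes) (hnd : nodes.Nodup)
    (hn : n = Fintype.card V) (haux : ∀ w, IsAuxData G A w (aux w)) {w : V}
    (hw : G.prio w / 2 ≤ T.height) {k : ℕ} {ch : List (OrderedTree M)}
    (h : (C.chain (G.prio w / 2))[k]? = some ch) (v : V) :
    G.costLower A ch v w ≤ runCost γ n nodes G.prio aux C k v w ∧
      runCost γ n nodes G.prio aux C k v w ≤ G.costUpper A ch v w := by
  rw [runCost_eq h]
  have hch := List.mem_of_getElem? h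
  exact arcCosts_bounds hnodes hnd hn (haux w).jArcs (C.isChain _ hw ch hch)
    (fun S hS S' hS' => (C.height_eq hw hch hS).trans (C.height_eq hw hch hS').symm) v

/-- All arcs of `D` into `H` start in `H`, so a cycle of `D` through a node of `H` stays in `H`. -/
theorem bottleneck_eq_minCycleCost (haux : ∀ w, IsAuxData G A w (aux w)) {w : V}
    (hH : IsComponent G A w H) {k : ℕ} {ch : List (OrderedTree M)}
    (h : (C.chain (G.prio w / 2))[k]? = some ch) {v : V} (hv : v ∈ H) :
    (bottleneck H fun w => if w ∈ H then
      (arcCosts γ n nodes G.prio (aux w).jArcs w ch).val else fun _ => ⊤).val v v =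
      G.minCycleCost A (runCost γ n nodes G.prio aux C k) v := by
  refine ENat.eq_of_forall_le_natCast_iff fun c => ?_
  rw [minCycleCost_le_iff]
  refine bottleneck_le_iff (fun x hx y hy => ?_) (fun x y hxy hy => ?_) hv
  · rw [if_pos hy, runCost_eq (by rwa [((hH.2.2 y).1 hy).2])]
    refine ⟨fun hc => ⟨?_, hc⟩, fun hc => hc.2⟩
    rcases (arcCosts_val (G := G) (jArcs := (aux y).jArcs) (w := y) (ch := ch) (n := n) (γ := γ)
      (nodes := nodes) x).2 with htop | ⟨u, hu, -⟩
    · rw [htop] at hc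
      exact absurd (top_le_iff.1 hc) (ENat.natCast_ne_top c)
    · exact auxArc_iff.2 ⟨(hH.of_mem hx).1, (hH.of_mem hy).1,
        ((hH.2.2 x).1 hx).2.trans ((hH.2.2 y).1 hy).2.symm, u, ((haux y).jArcs _).1 hu⟩
  · obtain ⟨-, -, hp, u, hu⟩ := auxArc_iff.1 hxy.1
    exact ((hH.of_mem hy).2.2 x).2 ⟨hu.1.1, hp⟩

theorem processChains_val (haux : ∀ w, IsAuxData G A w (aux w)) {w : V}
    (hH : IsComponent G A w H) (k : ℕ) (chs : List (List (OrderedTree M)))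
    (h : ∀ i ch, chs[i]? = some ch → (C.chain (G.prio w / 2))[k + i]? = some ch)
    (ν : V → T.Label) (v : V) :
    (processChains γ ρ n nodes G.prio aux T C μ H (G.prio w / 2) k chs ν).val v =
      if v ∈ H then min (ν v) ((Finset.range chs.length).inf fun i =>
        offer C (μ v) (G.minCycleCost A (runCost γ n nodes G.prio aux C (k + i)) v)
          (G.prio w / 2) (k + i))
      else ν v := by
  induction chs generalizing k ν with
  | nil => simp [processChains]
  | cons ch chs ih =>
    unfold processChains
    simp only [bind_val, step_val]
    rw [ih (k + 1) (fun i ch' hi => by rw [add_assoc, add_comm 1 i]; exact h (i + 1) ch' hi),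
      processChain_val hH.2.1, List.length_cons, Finset.inf_range_succ_eq_min]
    split_ifs with hv
    · rw [bottleneck_eq_minCycleCost haux hH (h 0 ch rfl) hv, min_assoc]
      simp only [add_zero, add_assoc, add_comm 1]
    · rfl

/-- The iteration of the main loop for the node `w`: unless `w` has been visited, the component of
`D` which contains `w` is processed. -/
noncomputable def mainStep (γ ρ n : ℕ) (nodes : List V) (prio : V → ℕ) (aux : V → AuxData V)
    (T : OrderedTree M) (C : T.Cover) (μ : V → T.Label) (w : V) :
    (V → T.Label) × (V → Bool) → Timed ((V → T.Label) × (V → Bool)) := fun (ν, visited) => do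
  let a ← read aux w
  let seen ← read visited w
  let unseen ← step (!seen)
  let b ← step (a.isBase && unseen)
  if b then
    let p ← read prio w
    let H ← select nodes fun v => do
      let b₁ ← read a.scc v
      let q ← read prio v
      let b₂ ← step (decide (q = p))
      step (b₁ && b₂)
    let visited ← loop H visited fun v visited => write visited v true
    let j ← step (p / 2)
    let chains ← step (C.chain j)
    let ν ← processChains γ ρ n nodes prio aux T C μ H j 0 chains ν
    step (ν, visited)
  else step (ν, visited)

theorem run_eq (nodes : List V) (arcs : List (V × V)) (prio : V → ℕ) (μ : V → T.Label) :
    run γ ρ nodes arcs prio T C μ = (do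
      let n ← charge (nodes.length + 1) nodes.length
      let ν ← alloc nodes (⊤ : T.Label)
      let aux ← construct n nodes arcs prio
      let visited ← alloc nodes false
      let s ← loop nodes (ν, visited) (mainStep γ ρ n nodes prio aux T C μ)
      bellmanFord γ n prio arcs T s.1) := rfl

theorem mainStep_val (w : V) (ν : V → T.Label) (visited : V → Bool) :
    (mainStep γ ρ n nodes prio aux T C μ w (ν, visited)).val =
      if ((aux w).isBase && !visited w) = true then
        ((processChains γ ρ n nodes prio aux T C μ (component nodes prio aux w) (prio w / 2) 0
            (C.chain (prio w / 2)) ν).val,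
          (component nodes prio aux w).foldl (fun s v => Function.update s v true) visited)
      else (ν, visited) := by
  unfold mainStep
  dsimp +instances only [bind_val, read_val, step_val]
  rw [ite_val]
  dsimp +instances only [bind_val, read_val, step_val]
  rw [select_val, loop_val]
  rfl

/-- The label correcting algorithm, as a program, performs a run of the nondeterministic
procedure. -/
theorem isLabelCorrectingOutput_run [Fintype V] (hnodes : ∀ v, v ∈ nodes) (hnd : nodes.Nodup)
    {arcs : List (V × V)} (harcs : EnumeratesArcs A arcs) (hprio : ∀ v, G.prio v / 2 ≤ T.height) :
    G.IsLabelCorrectingOutput A T C μ (run γ ρ nodes arcs G.prio T C μ).val := by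
  have hlen : nodes.length = Fintype.card V := by
    rw [← List.toFinset_card_of_nodup hnd, ← Finset.card_univ]
    congr 1
    ext v
    simp [hnodes]
  rw [run_eq]
  simp only [bind_val, charge_val, alloc_val, bellmanFord_val]
  set n := nodes.length with hn
  set aux := (construct n nodes arcs G.prio).val with hauxdef
  have haux : ∀ w, IsAuxData G A w (aux w) := fun w => by
    rw [hauxdef, construct_val n hnodes]
    exact auxData_val G hnodes harcs.2 hlen.ge w
  refine ⟨runCost γ n nodes G.prio aux C, fun v w _ k ch hch =>
    runCost_bounds hnodes hnd hlen haux (hprio w) hch v, List.replicate (n - 1) arcs, ?_, ?_, ?_⟩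
  · rw [List.length_replicate, hlen]
  · intro l hl
    rwa [List.eq_of_mem_replicate hl]
  change G.relaxAll T _ _ = G.relaxAll T _ _
  congr 1
  set F := G.initialLabel A T C μ (runCost γ n nodes G.prio aux C) with hF
  rw [loop_val]
  -- the visited nodes form components, and exactly they carry their initial labels
  have key : ∀ l : List V, let s := l.foldl (fun s i =>
      (mainStep γ ρ n nodes G.prio aux T C μ i s).val) (fun _ => ⊤, fun _ => false)
      (∀ v ∈ l, G.IsBase A v → s.2 v = true) ∧
      (∀ v, s.2 v = true → G.IsBase A v ∧
        ∀ u ∈ G.sccNode A v, G.prio u = G.prio v → s.2 u = true) ∧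
      ∀ v, s.1 v = if s.2 v = true then F v else ⊤ := by
    intro l
    induction l using List.reverseRecOn with
    | nil => simp
    | append_singleton l w ih =>
      rw [List.foldl_append, List.foldl_cons, List.foldl_nil]
      generalize l.foldl (fun s i =>
        (mainStep γ ρ n nodes G.prio aux T C μ i s).val) (fun _ => ⊤, fun _ => false) = s at ih ⊢
      obtain ⟨ν, visited⟩ := s
      obtain ⟨h1, h2, h3⟩ := ih
      dsimp only at h1 h2 h3
      rw [mainStep_val]
      split_ifs with hw
      · simp only [Bool.and_eq_true, Bool.not_eq_true', (haux w).isBase] at hw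
        have hH := isComponent_component hnodes hnd haux hw.1
        set H := component nodes G.prio aux w
        have hvis : ∀ v, H.foldl (fun s v => Function.update s v true) visited v = true ↔
            v ∈ H ∨ visited v = true := by
          intro v
          rw [List.foldl_update_apply H (fun _ => true)]
          by_cases hv : v ∈ H <;> simp [hv]
        have hnew : ∀ v ∈ H, visited v = false := by
          intro v hv
          by_contra hvis'
          rw [Bool.not_eq_false] at hvis'
          have := (h2 v hvis').2 w (((hH.of_mem hv).2.2 w).1 hH.self_mem).1
            ((hH.2.2 v).1 hv).2.symm
          rw [hw.2] at this
          exact Bool.false_ne_true this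
        refine ⟨fun v hv hbv => ?_, fun v hv => ?_, fun v => ?_⟩
        · rw [hvis]
          rcases List.mem_append.1 hv with hv | hv
          · exact Or.inr (h1 v hv hbv)
          · obtain rfl : v = w := by simpa using hv
            exact Or.inl hH.self_mem
        · rw [hvis] at hv
          rcases hv with hv | hv
          · refine ⟨(hH.of_mem hv).1, fun u hu hp => (hvis u).2 (Or.inl ?_)⟩
            exact ((hH.of_mem hv).2.2 u).2 ⟨hu, hp⟩
          · exact ⟨(h2 v hv).1, fun u hu hp => (hvis u).2 (Or.inr ((h2 v hv).2 u hu hp))⟩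
        · dsimp only
          rw [processChains_val haux hH 0 _ (fun i ch hi => by rwa [Nat.zero_add]), h3]
          by_cases hv : v ∈ H
          · rw [if_pos hv, if_neg (by simp [hnew v hv]), if_pos ((hvis v).2 (Or.inl hv)),
              min_top_left, hF, initialLabel, if_pos (hH.of_mem hv).1, ((hH.2.2 v).1 hv).2]
            simp only [Nat.zero_add, offer]
          · rw [if_neg hv]
            by_cases hv' : visited v = true
            · rw [if_pos hv', if_pos ((hvis v).2 (Or.inr hv'))]
            · rw [if_neg hv', if_neg fun h => ((hvis v).1 h).elim hv hv']
      · simp only [Bool.and_eq_true, Bool.not_eq_true', (haux w).isBase, not_and,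
          Bool.not_eq_false] at hw
        refine ⟨fun v hv hbv => ?_, h2, h3⟩
        rcases List.mem_append.1 hv with hv | hv
        · exact h1 v hv hbv
        · obtain rfl : v = w := by simpa using hv
          exact hw hbv
  obtain ⟨h1, h2, h3⟩ := key nodes
  funext v
  rw [h3]
  by_cases hv : G.IsBase A v
  · rw [if_pos (h1 v (hnodes v) hv)]
  · rw [if_neg fun h => hv (h2 v h).1, hF, initialLabel, if_neg hv]

end LabelCorrecting


/-! ### Running time of the parts of the program -/

namespace Timed

variable {ι σ : Type}

theorem loop_time_le {l : List ι} {s : σ} {body : ι → σ → Timed σ} {c : ℕ}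
    (h : ∀ i s, (body i s).time ≤ c) : (loop l s body).time ≤ l.length * (c + 1) + 1 := by
  induction l generalizing s with
  | nil => simp [loop]
  | cons i l ih =>
    have h1 := h i s
    have h2 := ih (s := (body i s).val)
    simp only [loop, bind_time, step_time, step_val, List.length_cons, Nat.succ_mul]
    omega

/-- Amortized analysis of a loop: the cost of an iteration may exceed `c` by the decrease of a
potential `Φ`. -/
theorem loop_time_le_of_potential {l : List ι} {s : σ} {body : ι → σ → Timed σ} {c : ℕ}
    (Inv : σ → Prop) (Φ : σ → ℕ) (hs : Inv s)
    (h : ∀ i s, Inv s → Inv (body i s).val ∧ (body i s).time + Φ (body i s).val ≤ c + Φ s) :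
    (loop l s body).time ≤ l.length * (c + 1) + 1 + Φ s := by
  induction l generalizing s with
  | nil => simp [loop]
  | cons i l ih =>
    obtain ⟨h1, h1'⟩ := h i s hs
    have h2 := ih h1
    simp only [loop, bind_time, step_time, step_val, List.length_cons, Nat.succ_mul]
    omega

/-- The cost of a sequence of two computations, the second of which depends on a value about which
only `P` is known. -/
theorem bind_time_le {α β : Type} {x : Timed α} {f : α → Timed β} {a b : ℕ} (P : α → Prop)
    (hP : P x.val) (hx : x.time ≤ a) (hf : ∀ v, P v → (f v).time ≤ b) :
    (x >>= f).time ≤ a + b :=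
  Nat.add_le_add hx (hf _ hP)

theorem select_time_le {l : List ι} {test : ι → Timed Bool} {c : ℕ}
    (h : ∀ i, (test i).time ≤ c) : (select l test).time ≤ l.length * (c + 1) + 1 := by
  induction l with
  | nil => simp [select]
  | cons i l ih =>
    have h1 := h i
    simp only [select, bind_time, ite_time, step_time, List.length_cons, Nat.succ_mul, ite_self]
    omega

end Timed

namespace LabelCorrecting

open Timed OrderedTree

variable {V M : Type} [DecidableEq V] [LinearOrder M]
variable {n m γ ρ : ℕ} {nodes : List V} {arcs : List (V × V)} {prio : V → ℕ}

theorem bellmanFord_time_le (hn : 1 ≤ n) (hm : 1 ≤ m) (hγ : 1 ≤ γ) (ha : arcs.length ≤ m)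
    (T : OrderedTree M) (ν : V → T.Label) :
    (bellmanFord γ n prio arcs T ν).time ≤ 9 * (n * m * γ) := by
  unfold bellmanFord
  refine (loop_time_le (c := arcs.length * (2 * γ + 4 + 1) + 1) fun _ ν =>
    loop_time_le (c := 2 * γ + 4) fun e ν => ?_).trans ?_
  · simp only [bind_time, read_time, charge_time, labelLt, ite_time, write_time, step_time,
      ite_self]
    omega
  · obtain ⟨k, rfl⟩ := Nat.exists_eq_add_of_le' hn
    simp only [List.length_range, Nat.add_sub_cancel]
    have h1 : arcs.length * (2 * γ + 4 + 1) ≤ m * (7 * γ) := Nat.mul_le_mul ha (by omega)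
    have h2 : 1 ≤ m * γ := Nat.mul_pos hm hγ
    have h3 : arcs.length * (2 * γ + 4 + 1) + 1 + 1 ≤ 9 * (m * γ) := by
      calc _ ≤ m * (7 * γ) + 1 + 1 := by omega
        _ = 7 * (m * γ) + 2 := by ring
        _ ≤ _ := by omega
    calc k * (arcs.length * (2 * γ + 4 + 1) + 1 + 1) + 1 ≤ k * (9 * (m * γ)) + 9 * (m * γ) := by
          have := Nat.mul_le_mul_left k h3
          omega
      _ = _ := by ring

theorem closure_time_le (hn : 1 ≤ n) (hm : 1 ≤ m) (ha : arcs.length ≤ m) (mark : V → Bool) :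
    (closure n arcs mark).time ≤ 6 * (n * m) := by
  unfold closure
  refine (loop_time_le (c := arcs.length * (2 + 1) + 1) fun _ mark =>
    loop_time_le (c := 2) fun e mark => ?_).trans ?_
  · simp only [bind_time, read_time, ite_time, write_time, step_time, ite_self]
    omega
  · rw [List.length_range]
    have h1 : arcs.length * (2 + 1) + 1 + 1 ≤ 5 * m := by omega
    have h2 : 1 ≤ n * m := Nat.mul_pos hn hm
    calc n * (arcs.length * (2 + 1) + 1 + 1) + 1 ≤ n * (5 * m) + 1 := by
          have := Nat.mul_le_mul_left n h1
          omega
      _ = 5 * (n * m) + 1 := by ring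
      _ ≤ _ := by omega

theorem auxData_time_le (hn : nodes.length = n) (hn1 : 1 ≤ n) (hm : 1 ≤ m) (ha : arcs.length ≤ m)
    (w : V) : (auxData n nodes arcs prio w).time ≤ 70 * (n * m) := by
  have hrev : ∀ l r : List (V × V),
      (l.foldl (fun l e => (e.2, e.1) :: l) r).length = l.length + r.length := by
    intro l
    induction l with
    | nil => simp
    | cons e l ih => intro r; rw [List.foldl_cons, ih]; simp; omega
  have hmul : ∀ {l : List (V × V)} (c : ℕ), l.length ≤ m →
      l.length * (c + 1) + 1 ≤ m * (c + 1) + 1 := fun c hl =>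
    Nat.succ_le_succ (Nat.mul_le_mul_right _ hl)
  have hsel : ∀ {l : List (V × V)} {test : V × V → Timed Bool}, l.length ≤ m →
      (select l test).val.length ≤ m := fun hl => by
    rw [select_val]; exact (List.length_filter_le _ _).trans hl
  have hcl : ∀ {l : List (V × V)} (mark : V → Bool), l.length ≤ m →
      (closure n l mark).time ≤ 6 * (n * m) := fun mark hl => closure_time_le hn1 hm hl mark
  have key : (auxData n nodes arcs prio w).time ≤ 1 + ((m * (5 + 1) + 1) + ((m * (1 + 1) + 1) +
      ((n + 1) + (1 + (6 * (n * m) + (6 * (n * m) + ((n + 1) + ((n * (4 + 1) + 1) +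
      ((m * (8 + 1) + 1) + (6 * (n * m) + ((m * (1 + 1) + 1) + ((m * (4 + 1) + 1) +
      (1 + (1 + 1)))))))))))))) := by
    unfold auxData
    refine bind_time_le (fun _ => True) trivial le_rfl fun p _ => ?_
    refine bind_time_le (fun l => l.length ≤ m) (hsel ha)
      ((select_time_le (c := 5) fun i => ?_).trans (hmul 5 ha)) fun low hlow => ?_
    · simp
    refine bind_time_le (fun l => l.length ≤ m)
      (by rw [loop_val]; exact (hrev low []).trans_le hlow)
      ((loop_time_le (c := 1) fun i s => ?_).trans (hmul 1 hlow)) fun rev hrev' => ?_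
    · simp
    refine bind_time_le (fun _ => True) trivial (by rw [alloc_time, hn]) fun mark _ => ?_
    refine bind_time_le (fun _ => True) trivial le_rfl fun mark _ => ?_
    refine bind_time_le (fun _ => True) trivial (hcl mark hlow) fun bwd _ => ?_
    refine bind_time_le (fun _ => True) trivial (hcl mark hrev') fun fwd _ => ?_
    refine bind_time_le (fun _ => True) trivial (by rw [alloc_time, hn]) fun scc _ => ?_
    refine bind_time_le (fun _ => True) trivial
      ((loop_time_le (c := 4) fun i s => ?_).trans (by rw [hn])) fun scc _ => ?_
    · simp
    refine bind_time_le (fun l => l.length ≤ m) (hsel hlow)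
      ((select_time_le (c := 8) fun i => ?_).trans (hmul 8 hlow)) fun arcs' harcs' => ?_
    · simp
    refine bind_time_le (fun _ => True) trivial (hcl mark harcs') fun jNode _ => ?_
    refine bind_time_le (fun _ => True) trivial
      ((select_time_le (c := 1) fun i => ?_).trans (hmul 1 harcs')) fun jArcs _ => ?_
    · simp
    refine bind_time_le (fun _ => True) trivial
      ((loop_time_le (c := 4) fun i s => ?_).trans (hmul 4 hlow)) fun onCycle _ => ?_
    · simp
    refine bind_time_le (fun _ => True) trivial le_rfl fun ev _ => ?_
    exact bind_time_le (fun _ => True) trivial le_rfl fun isBase _ => le_rfl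
  have h1 : 1 ≤ n * m := Nat.mul_pos hn1 hm
  have h2 : n ≤ n * m := Nat.le_mul_of_pos_right n hm
  have h3 : m ≤ n * m := Nat.le_mul_of_pos_left m hn1
  omega

theorem construct_time_le (hn : nodes.length = n) (hn1 : 1 ≤ n) (hm : 1 ≤ m)
    (ha : arcs.length ≤ m) : (construct n nodes arcs prio).time ≤ 75 * (n * (n * m)) := by
  have key : (construct n nodes arcs prio).time ≤ (n + 1) + (n * (70 * (n * m) + 1 + 1) + 1) := by
    unfold construct
    refine bind_time_le (fun _ => True) trivial (by rw [alloc_time, hn]) fun aux _ => ?_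
    refine (loop_time_le (c := 70 * (n * m) + 1) fun i s => ?_).trans (by rw [hn])
    exact bind_time_le (fun _ => True) trivial (auxData_time_le hn hn1 hm ha i) fun _ _ => le_rfl
  have h1 : 1 ≤ n * m := Nat.mul_pos hn1 hm
  have h2 : n ≤ n * (n * m) := Nat.le_mul_of_pos_right n h1
  calc _ ≤ _ := key
    _ = 70 * (n * (n * m)) + 3 * n + 2 := by ring
    _ ≤ _ := by omega

section Costs

variable {jArcs : List (V × V)} {w : V} {ch : List (OrderedTree M)}

theorem probe_time_le (hn : nodes.length = n) (hn1 : 1 ≤ n) (hm : 1 ≤ m) (hγ : 1 ≤ γ)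
    (ha : jArcs.length ≤ m) (i : ℕ) :
    (probe γ n nodes prio jArcs w ch i).time ≤ 21 * (n * m * γ) := by
  have key : (probe γ n nodes prio jArcs w ch i).time ≤ 1 + ((n + 1) + ((n + 1) + (γ + (1 +
      (9 * (n * m * γ) + (n * (3 + 1) + 1)))))) := by
    unfold probe
    refine bind_time_le (fun _ => True) trivial le_rfl fun S _ => ?_
    refine bind_time_le (fun _ => True) trivial (by rw [alloc_time, hn]) fun fin _ => ?_
    cases S with
    | none => simp only [step_time]; omega
    | some S =>
      refine bind_time_le (fun _ => True) trivial (by rw [alloc_time, hn]) fun ν _ => ?_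
      refine bind_time_le (fun _ => True) trivial le_rfl fun bot _ => ?_
      refine bind_time_le (fun _ => True) trivial le_rfl fun ν _ => ?_
      refine bind_time_le (fun _ => True) trivial (bellmanFord_time_le hn1 hm hγ ha S ν)
        fun ν _ => ?_
      refine (loop_time_le (c := 3) fun i s => ?_).trans (by rw [hn])
      simp
  have h1 : 1 ≤ n * m * γ := Nat.mul_pos (Nat.mul_pos hn1 hm) hγ
  have h2 : n ≤ n * m * γ := by
    rw [mul_assoc]; exact Nat.le_mul_of_pos_right n (Nat.mul_pos hm hγ)
  have h3 : γ ≤ n * m * γ := Nat.le_mul_of_pos_left γ (Nat.mul_pos hn1 hm)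
  omega

theorem binarySearch_time_le {P : ℕ} (hP : 1 ≤ P)
    (hprobe : ∀ i, (probe γ n nodes prio jArcs w ch i).time ≤ 21 * P) (u : V) (fuel lo hi : ℕ) :
    (binarySearch γ n nodes prio jArcs w ch u fuel lo hi).time ≤ fuel * (26 * P) + 2 := by
  induction fuel generalizing lo hi with
  | zero => simp [binarySearch]
  | succ fuel ih =>
    have h1 := hprobe ((lo + hi) / 2)
    have h2 := ih lo ((lo + hi) / 2)
    have h3 := ih ((lo + hi) / 2 + 1) hi
    rw [Nat.succ_mul]
    by_cases h : lo < hi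
    · by_cases hf : (probe γ n nodes prio jArcs w ch ((lo + hi) / 2)).val u = true
      · simp only [binarySearch, bind_time, step_time, step_val, read_time, read_val, h, hf,
          decide_true, if_true]
        omega
      · simp only [binarySearch, bind_time, step_time, step_val, read_time, read_val, h, hf,
          decide_true, if_true]
        simp only [bind_time, step_time, step_val, Bool.false_eq_true, if_false]
        omega
    · simp [binarySearch, h]

/-- The number of trees of the chain `ch` which are probed, up to a constant factor: all of them, or
one binary search for each node. -/
def probes (n : ℕ) (ch : List (OrderedTree M)) : ℕ :=
  min ch.length (n * max 1 (Nat.log 2 ch.length))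

theorem firstFinite_time_le (hn : nodes.length = n) (hn1 : 1 ≤ n) (hm : 1 ≤ m) (hγ : 1 ≤ γ)
    (ha : jArcs.length ≤ m) : (firstFinite γ n nodes prio jArcs w ch).time ≤
      75 * (n * m * γ * (probes n ch + 1)) := by
  set P := n * m * γ with hPdef
  have hP : 1 ≤ P := Nat.mul_pos (Nat.mul_pos hn1 hm) hγ
  have hnP : n ≤ P := by
    rw [hPdef, mul_assoc]; exact Nat.le_mul_of_pos_right n (Nat.mul_pos hm hγ)
  have hprobe : ∀ i, (probe γ n nodes prio jArcs w ch i).time ≤ 21 * P := fun i =>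
    probe_time_le hn hn1 hm hγ ha i
  set bits := Nat.log 2 ch.length + 1 with hbits
  have hbits2 : n * bits ≤ 2 * (n * max 1 (Nat.log 2 ch.length)) := by
    rw [← mul_left_comm]
    exact Nat.mul_le_mul_left n (by omega)
  have hbitsn : bits ≤ n * bits := Nat.le_mul_of_pos_left _ hn1
  have hbitsl : bits ≤ ch.length + 1 := Nat.succ_le_succ (Nat.log_le_self 2 _)
  -- the number of probes of either method
  obtain ⟨B, hB, hB'⟩ : ∃ B, B ≤ 2 * probes n ch ∧
      (if ch.length ≤ n * bits then ch.length else n * bits) ≤ B := by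
    refine ⟨_, ?_, le_rfl⟩
    unfold probes
    split_ifs <;> omega
  have hbitsB : bits ≤ 2 * probes n ch + 1 := by
    unfold probes
    omega
  have key : (firstFinite γ n nodes prio jArcs w ch).time ≤ 1 + (bits + (1 + (1 + ((n + 1) +
      (B * (31 * P) + (n + 1)))))) := by
    unfold firstFinite
    refine bind_time_le (fun len => len = ch.length) rfl le_rfl fun len hlen => ?_
    refine bind_time_le (fun b => b = bits) (by rw [hlen]; rfl) (by rw [hlen]; exact le_rfl)
      fun b hb => ?_
    refine bind_time_le (fun x => x = n * b) rfl le_rfl fun bound hbound => ?_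
    refine bind_time_le (fun b => b = decide (len ≤ bound)) rfl le_rfl fun short hshort => ?_
    refine bind_time_le (fun _ => True) trivial (by rw [alloc_time, hn]) fun idx _ => ?_
    subst hbound hlen hb hshort
    split_ifs with h
    · rw [decide_eq_true_iff] at h
      rw [if_pos h] at hB'
      refine (loop_time_le (c := 21 * P + (n * (5 + 1) + 1)) fun i idx => ?_).trans ?_
      · refine bind_time_le (fun _ => True) trivial (hprobe i) fun fin _ => ?_
        refine (loop_time_le (c := 5) fun u idx => ?_).trans (by rw [hn])
        simp
      · rw [List.length_range]
        have h1 : ch.length * (21 * P + (n * (5 + 1) + 1) + 1) ≤ B * (31 * P) :=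
          Nat.mul_le_mul hB' (by omega)
        omega
    · rw [decide_eq_true_iff] at h
      rw [if_neg h] at hB'
      refine (loop_time_le (c := bits * (26 * P) + 2 + (1 + 1)) fun u idx => ?_).trans ?_
      · refine bind_time_le (fun _ => True) trivial (binarySearch_time_le hP hprobe u _ _ _)
          fun i _ => ?_
        refine bind_time_le (fun _ => True) trivial le_rfl fun b _ => ?_
        simp
      · rw [hn]
        have h1 : n * (bits * (26 * P) + 2 + (1 + 1) + 1) ≤ n * (bits * (31 * P)) := by
          refine Nat.mul_le_mul_left n ?_
          have : 1 ≤ bits * P := Nat.mul_pos (Nat.succ_pos _) hP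
          calc bits * (26 * P) + 2 + (1 + 1) + 1 = 26 * (bits * P) + 5 := by ring
            _ ≤ 31 * (bits * P) := by omega
            _ = _ := by ring
        have h2 : n * (bits * (31 * P)) ≤ B * (31 * P) := by
          rw [← mul_assoc]
          exact Nat.mul_le_mul_right _ hB'
        omega
  have h1 : B * (31 * P) ≤ 62 * (P * probes n ch) := by
    calc B * (31 * P) ≤ (2 * probes n ch) * (31 * P) := Nat.mul_le_mul_right _ hB
      _ = _ := by ring
  have h2 : probes n ch ≤ P * probes n ch := Nat.le_mul_of_pos_left _ hP
  rw [mul_add, mul_one]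
  omega

theorem arcCosts_time_le (hn : nodes.length = n) (hn1 : 1 ≤ n) (hm : 1 ≤ m) (hγ : 1 ≤ γ)
    (ha : jArcs.length ≤ m) : (arcCosts γ n nodes prio jArcs w ch).time ≤
      83 * (n * m * γ * (probes n ch + 1)) := by
  have key : (arcCosts γ n nodes prio jArcs w ch).time ≤
      75 * (n * m * γ * (probes n ch + 1)) + ((n + 1) + (m * (4 + 1) + 1)) := by
    unfold arcCosts
    refine bind_time_le (fun _ => True) trivial (firstFinite_time_le hn hn1 hm hγ ha)
      fun idx _ => ?_
    refine bind_time_le (fun _ => True) trivial (by rw [alloc_time, hn]) fun cost _ => ?_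
    refine (loop_time_le (c := 4) fun e cost => ?_).trans
      (Nat.succ_le_succ (Nat.mul_le_mul_right _ ha))
    simp only [bind_time, read_time, step_time]
    split_ifs <;> simp
  have h0 : 1 ≤ γ * (probes n ch + 1) := Nat.mul_pos hγ (Nat.succ_pos _)
  have h1 : n * m ≤ n * m * γ * (probes n ch + 1) := by
    rw [mul_assoc (n * m)]; exact Nat.le_mul_of_pos_right _ h0
  have h2 : n ≤ n * m := Nat.le_mul_of_pos_right n hm
  have h3 : m ≤ n * m := Nat.le_mul_of_pos_left m hn1
  omega

end Costs

theorem bottleneck_time_le {H : List V} {h : ℕ} (hH : H.length = h) (hh : 1 ≤ h) (hhn : h ≤ n)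
    (dist : V → V → ℕ∞) : (bottleneck H dist).time ≤ 16 * (h * (n * n)) := by
  have key : (bottleneck H dist).time ≤ h * (h * (h * (9 + 1) + 1 + 1) + 1 + 1) + 1 := by
    unfold bottleneck
    refine (loop_time_le (c := h * (h * (9 + 1) + 1 + 1) + 1) fun x dist => ?_).trans (by rw [hH])
    refine (loop_time_le (c := h * (9 + 1) + 1) fun w dist => ?_).trans (by rw [hH])
    refine (loop_time_le (c := 9) fun v dist => ?_).trans (by rw [hH])
    simp only [bind_time, read_time, ite_time, write_time, step_time]
    split_ifs <;> omega
  have h1 : h * h ≤ n * n := Nat.mul_le_mul hhn hhn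
  have h2 : 1 ≤ h * (n * n) := Nat.mul_pos hh (Nat.mul_pos (hh.trans hhn) (hh.trans hhn))
  calc _ ≤ _ := key
    _ = 10 * (h * (h * h)) + 2 * (h * h) + 2 * h + 1 := by ring
    _ ≤ 10 * (h * (n * n)) + 2 * (h * (n * n)) + 2 * (h * (n * n)) + 1 := by
      have e1 := Nat.mul_le_mul_left h h1
      have e2 : h * h ≤ h * (n * n) := Nat.mul_le_mul_left h (hhn.trans (Nat.le_mul_self n))
      have e3 : h ≤ h * (n * n) :=
        Nat.le_mul_of_pos_right h (Nat.mul_pos (hh.trans hhn) (hh.trans hhn))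
      omega
    _ ≤ _ := by omega

end LabelCorrecting


/-! ### Running time of the main loop -/

namespace LabelCorrecting

open Timed ParityGame OrderedTree

variable {V M : Type} [DecidableEq V] [LinearOrder M]
variable {n m γ ρ : ℕ} {nodes : List V} {arcs : List (V × V)} {prio : V → ℕ}
  {T : OrderedTree M} {C : T.Cover} {μ : V → T.Label} {aux : V → AuxData V} {H : List V}

theorem processChain_time_le (hn : nodes.length = n) (hm : n ≤ m) (hγ : 1 ≤ γ)
    (haux : ∀ w, (aux w).jArcs.length ≤ m) (hH : 1 ≤ H.length) (hHn : H.length ≤ n) (j k : ℕ)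
    {ch : List (OrderedTree M)} {B : ℕ} (hB : probes n ch ≤ B) (ν : V → T.Label) :
    (processChain γ ρ n nodes prio aux T C μ H j k ch ν).time ≤
      H.length * (120 * (n * m * γ * (B + 1)) + ρ) := by
  set h := H.length with hh
  have hn1 : 1 ≤ n := hH.trans hHn
  have hm1 : 1 ≤ m := hn1.trans hm
  set Q := n * m * γ * (B + 1) with hQ
  have key : (processChain γ ρ n nodes prio aux T C μ H j k ch ν).time ≤
      (n + 1) + ((n + 1) + ((h * (1 + (83 * Q + 1) + 1) + 1) + (16 * (h * (n * n)) +
        (h * (1 + (1 + (1 + (ρ + (1 + (γ + 1))))) + 1) + 1)))) := by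
    unfold processChain
    refine bind_time_le (fun _ => True) trivial (by rw [alloc_time, hn]) fun noCost _ => ?_
    refine bind_time_le (fun _ => True) trivial (by rw [alloc_time, hn]) fun dist _ => ?_
    refine bind_time_le (fun _ => True) trivial
      (loop_time_le (c := 1 + (83 * Q + 1)) fun w dist => ?_) fun dist _ => ?_
    · refine bind_time_le (fun a => a = aux w) rfl le_rfl fun a ha => ?_
      refine bind_time_le (fun _ => True) trivial ?_ fun col _ => le_rfl
      refine (arcCosts_time_le hn hn1 hm1 hγ (ha ▸ haux w)).trans (Nat.mul_le_mul_left _ ?_)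
      exact Nat.mul_le_mul_left _ (by omega)
    refine bind_time_le (fun _ => True) trivial (bottleneck_time_le hh.symm hH hHn _)
      fun dist _ => ?_
    refine loop_time_le fun w ν => ?_
    refine bind_time_le (fun _ => True) trivial le_rfl fun row _ => ?_
    refine bind_time_le (fun _ => True) trivial le_rfl fun i _ => ?_
    cases i with
    | top => exact le_trans (le_refl 1) (by omega)
    | coe i =>
      refine bind_time_le (fun _ => True) trivial le_rfl fun a _ => ?_
      refine bind_time_le (fun _ => True) trivial le_rfl fun r _ => ?_
      refine bind_time_le (fun _ => True) trivial le_rfl fun cur _ => ?_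
      refine bind_time_le (fun _ => True) trivial le_rfl fun lt _ => ?_
      split_ifs <;> simp
  have hγB : 1 ≤ γ * (B + 1) := Nat.mul_pos hγ (Nat.succ_pos _)
  have hnn : n * n ≤ Q := by
    rw [hQ, mul_assoc (n * m)]
    exact (Nat.mul_le_mul_left n hm).trans (Nat.le_mul_of_pos_right _ hγB)
  have hQ1 : 1 ≤ Q := Nat.le_trans (Nat.mul_pos hn1 hn1) hnn
  have hγQ : γ ≤ Q := by
    have h1 : 1 ≤ n * m * (B + 1) := Nat.mul_pos (Nat.mul_pos hn1 hm1) (Nat.succ_pos _)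
    calc γ ≤ γ * (n * m * (B + 1)) := Nat.le_mul_of_pos_right _ h1
      _ = Q := by rw [hQ]; ring
  have hnQ : n ≤ h * Q := (Nat.le_mul_self n).trans (hnn.trans (Nat.le_mul_of_pos_left _ hH))
  have h1 : 1 ≤ h * Q := Nat.mul_pos hH hQ1
  have h2 : h * (n * n) ≤ h * Q := Nat.mul_le_mul_left h hnn
  have h3 : h * γ ≤ h * Q := Nat.mul_le_mul_left h hγQ
  have h4 : h ≤ h * Q := Nat.le_mul_of_pos_right h hQ1
  calc _ ≤ _ := key
    _ = 2 * n + 4 + 83 * (h * Q) + 9 * h + 16 * (h * (n * n)) + h * γ + h * ρ := by ring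
    _ ≤ 120 * (h * Q) + h * ρ := by omega
    _ = _ := by ring

theorem processChains_time_le (hn : nodes.length = n) (hm : n ≤ m) (hγ : 1 ≤ γ)
    (haux : ∀ w, (aux w).jArcs.length ≤ m) (hH : 1 ≤ H.length) (hHn : H.length ≤ n) (j k : ℕ)
    {chs : List (List (OrderedTree M))} {B : ℕ} (hB : ∀ ch ∈ chs, probes n ch ≤ B)
    (ν : V → T.Label) : (processChains γ ρ n nodes prio aux T C μ H j k chs ν).time ≤
      chs.length * (H.length * (122 * (n * m * γ * (B + 1)) + ρ)) + 1 := by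
  induction chs generalizing k ν with
  | nil => simp [processChains]
  | cons ch chs ih =>
    have h1 := processChain_time_le (ρ := ρ) (prio := prio) (C := C) (μ := μ) hn hm hγ haux hH hHn
      j k (hB ch (by simp)) ν
    have h2 := ih (k + 1) (fun ch hch => hB ch (by simp [hch]))
      (processChain γ ρ n nodes prio aux T C μ H j k ch ν).val
    have h3 : H.length * (120 * (n * m * γ * (B + 1)) + ρ) + 1 ≤
        H.length * (122 * (n * m * γ * (B + 1)) + ρ) := by
      have hn1 : 1 ≤ n := hH.trans hHn
      have : 1 ≤ H.length * (n * m * γ * (B + 1)) :=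
        Nat.mul_pos hH (Nat.mul_pos (Nat.mul_pos (Nat.mul_pos hn1 (hn1.trans hm)) hγ)
          (Nat.succ_pos _))
      calc _ = 120 * (H.length * (n * m * γ * (B + 1))) + H.length * ρ + 1 := by ring
        _ ≤ 122 * (H.length * (n * m * γ * (B + 1))) + H.length * ρ := by omega
        _ = _ := by ring
    simp only [processChains, bind_time, step_time, step_val, List.length_cons]
    rw [Nat.succ_mul]
    generalize H.length * (122 * (n * m * γ * (B + 1)) + ρ) = X at h2 h3 ⊢
    generalize H.length * (120 * (n * m * γ * (B + 1)) + ρ) = Y at h1 h3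
    omega

/-- The maximum over the chains of the cover in the time bound. -/
def maxProbes (n : ℕ) (C : T.Cover) : ℕ :=
  (Finset.range (T.height + 1)).sup fun j =>
    (Finset.univ : Finset (Fin (C.chain j).length)).sup fun k =>
      (C.chain j).length *
        min (C.chain j)[k].length (n * max 1 (Nat.log 2 (C.chain j)[k].length))

/-- The maximum number of chains of a subcover. -/
def maxChains (C : T.Cover) : ℕ := (Finset.range (T.height + 1)).sup fun j => (C.chain j).length

theorem timeBound_eq : timeBound n m γ ρ T C =
    m * n ^ 2 * γ * maxProbes n C + n * ρ * maxChains C := rfl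

theorem length_mul_probes_le {j : ℕ} (hj : j ≤ T.height) {ch : List (OrderedTree M)}
    (hch : ch ∈ C.chain j) : (C.chain j).length * probes n ch ≤ maxProbes n C := by
  obtain ⟨k, hk, rfl⟩ := List.getElem_of_mem hch
  refine le_trans ?_ (Finset.le_sup (Finset.mem_range.2 (Nat.lt_succ_of_le hj)))
  exact Finset.le_sup (f := fun k : Fin (C.chain j).length => (C.chain j).length *
    min (C.chain j)[k].length (n * max 1 (Nat.log 2 (C.chain j)[k].length)))
    (Finset.mem_univ ⟨k, hk⟩)

theorem length_le_maxChains {j : ℕ} (hj : j ≤ T.height) : (C.chain j).length ≤ maxChains C :=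
  Finset.le_sup (f := fun j => (C.chain j).length) (Finset.mem_range.2 (Nat.lt_succ_of_le hj))

theorem exists_chain_ne_nil {j : ℕ} (hj : j ≤ T.height) : ∃ ch ∈ C.chain j, ch ≠ [] := by
  obtain ⟨u, hu⟩ := T.exists_leaf_append T.root_mem
  obtain ⟨hu1, hu2⟩ := mem_leaves.1 hu
  rw [List.nil_append] at hu1 hu2
  obtain ⟨ch, hch, S, hS, -⟩ := C.covers j hj (u.take (T.height - j)) (take_mem_verts hu1 _)
    (by rw [List.length_take, hu2]; omega)
  exact ⟨ch, hch, List.ne_nil_of_mem hS⟩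

/-- As some chain of each subcover is non-empty, the maximum in the time bound is at least the
number of chains. -/
theorem length_le_maxProbes (hn : 1 ≤ n) {j : ℕ} (hj : j ≤ T.height) :
    (C.chain j).length ≤ maxProbes n C := by
  obtain ⟨ch, hch, hne⟩ := exists_chain_ne_nil (C := C) hj
  refine le_trans (Nat.le_mul_of_pos_right _ ?_) (length_mul_probes_le hj hch)
  exact lt_min (List.length_pos_iff.2 hne) (Nat.mul_pos hn (by simp))

theorem one_le_maxProbes (hn : 1 ≤ n) : 1 ≤ maxProbes n C := by
  obtain ⟨ch, hch, -⟩ := exists_chain_ne_nil (C := C) (Nat.zero_le T.height)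
  exact Nat.le_trans (List.length_pos_of_mem hch) (length_le_maxProbes hn (Nat.zero_le _))

theorem processChains_time_le_maxProbes (hn : nodes.length = n) (hm : n ≤ m) (hγ : 1 ≤ γ)
    (haux : ∀ w, (aux w).jArcs.length ≤ m) (hH : 1 ≤ H.length) (hHn : H.length ≤ n) {j : ℕ}
    (hj : j ≤ T.height) (ν : V → T.Label) :
    (processChains γ ρ n nodes prio aux T C μ H j 0 (C.chain j) ν).time ≤
      H.length * (244 * (n * m * γ * maxProbes n C) + maxChains C * ρ) + 1 := by
  set q := (C.chain j).length with hq
  have hqpos : 0 < q := by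
    obtain ⟨ch, hch, -⟩ := exists_chain_ne_nil (C := C) hj
    exact List.length_pos_of_mem hch
  -- with `q` chains, none needs more than `maxProbes / q` probes; rounding costs a factor of two
  refine (processChains_time_le (B := maxProbes n C / q) hn hm hγ haux hH hHn j 0
    (fun ch hch => ?_) ν).trans (Nat.succ_le_succ ?_)
  · rw [Nat.le_div_iff_mul_le hqpos, mul_comm]
    exact length_mul_probes_le hj hch
  · have h1 : q * (maxProbes n C / q + 1) ≤ 2 * maxProbes n C := by
      have := Nat.mul_div_le (maxProbes n C) q
      have := length_le_maxProbes (C := C) (hH.trans hHn) hj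
      rw [mul_add, mul_one]
      omega
    have h2 : q * ρ ≤ maxChains C * ρ := Nat.mul_le_mul_right ρ (length_le_maxChains hj)
    calc q * (H.length * (122 * (n * m * γ * (maxProbes n C / q + 1)) + ρ))
        = H.length * (122 * (n * m * γ) * (q * (maxProbes n C / q + 1)) + q * ρ) := by ring
      _ ≤ H.length * (122 * (n * m * γ) * (2 * maxProbes n C) + maxChains C * ρ) :=
        Nat.mul_le_mul_left _ (Nat.add_le_add (Nat.mul_le_mul_left _ h1) h2)
      _ = _ := by ring

/-- Looking at a node costs `O(n)`; unless it is an unvisited base node, this is all. -/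
theorem mainStep_time_le (hn : nodes.length = n) (hm : n ≤ m) (hγ : 1 ≤ γ)
    (haux : ∀ w, (aux w).jArcs.length ≤ m) (hprio : ∀ w, prio w / 2 ≤ T.height) {w : V}
    (hw : w ∈ component nodes prio aux w) (s : (V → T.Label) × (V → Bool)) :
    (mainStep γ ρ n nodes prio aux T C μ w s).time ≤ 30 * n +
      if ((aux w).isBase && !s.2 w) = true then (component nodes prio aux w).length *
        (244 * (n * m * γ * maxProbes n C) + maxChains C * ρ) else 0 := by
  obtain ⟨ν, visited⟩ := s
  set H := component nodes prio aux w with hHdef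
  have hH : 1 ≤ H.length := List.length_pos_of_mem hw
  have hHn : H.length ≤ n := (List.length_filter_le _ _).trans hn.le
  set X := H.length * (244 * (n * m * γ * maxProbes n C) + maxChains C * ρ) with hX
  have key : (mainStep γ ρ n nodes prio aux T C μ w (ν, visited)).time ≤ 1 + (1 + (1 + (1 +
      if ((aux w).isBase && !visited w) = true then 1 + ((n * (4 + 1) + 1) +
        ((H.length * (1 + 1) + 1) + (1 + (1 + ((X + 1) + 1))))) else 1))) := by
    unfold mainStep
    refine bind_time_le (fun a => a = aux w) rfl le_rfl fun a ha => ?_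
    refine bind_time_le (fun b => b = visited w) rfl le_rfl fun seen hseen => ?_
    refine bind_time_le (fun b => b = !visited w) (by rw [hseen]; rfl) le_rfl fun unseen hun => ?_
    refine bind_time_le (fun b => b = ((aux w).isBase && !visited w)) (by rw [ha, hun]; rfl) le_rfl
      fun b hb => ?_
    subst hb
    split_ifs with h
    · refine bind_time_le (fun p => p = prio w) rfl le_rfl fun p hp => ?_
      refine bind_time_le (fun l => l = H) ?_ ((select_time_le (c := 4) fun v => ?_).trans
        (by rw [hn])) fun H' hH' => ?_
      · rw [select_val, hHdef, component, ha, hp]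
        rfl
      · simp
      subst hH'
      refine bind_time_le (fun _ => True) trivial (loop_time_le (c := 1) fun v visited => le_rfl)
        fun visited _ => ?_
      refine bind_time_le (fun j => j = prio w / 2) (by rw [hp]; rfl) le_rfl fun j hj => ?_
      refine bind_time_le (fun chs => chs = C.chain j) rfl le_rfl fun chs hchs => ?_
      subst hj hchs
      exact bind_time_le (fun _ => True) trivial
        (processChains_time_le_maxProbes hn hm hγ haux hH hHn (hprio w) ν) fun ν _ => le_rfl
    · exact le_rfl
  refine key.trans ?_
  dsimp only
  split_ifs <;> omega

/-- The time bound, with an explicit constant. Apart from the processing of the components, the main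
loop costs `O(n²)`, the construction of the auxiliary digraph `O(n²m)` and the final Bellman–Ford
`O(nmγ)`, all of which the first summand dominates. -/
theorem run_time_le [Fintype V] {G : ParityGame V} {A : V → V → Prop} (hnodes : ∀ v, v ∈ nodes)
    (hnd : nodes.Nodup) (hn : nodes.length = n) (hn1 : 1 ≤ n) (hcard : n = Fintype.card V)
    (hm : n ≤ m) (hγ : 1 ≤ γ) (harcs : EnumeratesArcs A arcs) (ham : arcs.length ≤ m)
    (hprio : ∀ v, G.prio v / 2 ≤ T.height) :
    (run γ ρ nodes arcs G.prio T C μ).time ≤ 500 * timeBound n m γ ρ T C := by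
  classical
  have hm1 := hn1.trans hm
  obtain ⟨W, hW⟩ : ∃ W, W = 244 * (n * m * γ * maxProbes n C) + maxChains C * ρ := ⟨_, rfl⟩
  set aux := (construct n nodes arcs G.prio).val with hauxdef
  have haux' : ∀ w, aux w = (auxData n nodes arcs G.prio w).val := fun w =>
    construct_val n hnodes arcs G.prio w
  have haux : ∀ w, IsAuxData G A w (aux w) := fun w => by
    rw [haux']
    exact auxData_val G hnodes harcs.2 hcard.ge w
  have hlen : ∀ w, (aux w).jArcs.length ≤ m := fun w => by
    rw [haux']
    exact (length_jArcs_le n nodes arcs G.prio w).trans ham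
  have hself : ∀ w, w ∈ component nodes G.prio aux w := fun w => by
    simp [component, hnodes, (haux w).scc, mem_sccNode_self]
  -- the potential is the number of unvisited nodes, weighted with the cost per node
  let Φ : (V → T.Label) × (V → Bool) → ℕ := fun s =>
    W * (Finset.univ.filter fun v => s.2 v = false).card
  -- the visited nodes form components, so all nodes of a component processed now are unvisited
  let Inv : (V → T.Label) × (V → Bool) → Prop := fun s =>
    ∀ v, s.2 v = true → ∀ u ∈ G.sccNode A v, G.prio u = G.prio v → s.2 u = true
  have hstep : ∀ w s, Inv s → Inv (mainStep γ ρ n nodes G.prio aux T C μ w s).val ∧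
      (mainStep γ ρ n nodes G.prio aux T C μ w s).time +
        Φ (mainStep γ ρ n nodes G.prio aux T C μ w s).val ≤ 30 * n + Φ s := by
    rintro w ⟨ν, visited⟩ hs
    have htime := mainStep_time_le (ρ := ρ) (C := C) (μ := μ) hn hm hγ hlen hprio (hself w)
      (ν, visited)
    rw [mainStep_val]
    dsimp only at htime
    rw [← hW] at htime
    split_ifs at htime ⊢ with hw
    · simp only [Bool.and_eq_true, Bool.not_eq_true', (haux w).isBase] at hw
      have hH := isComponent_component hnodes hnd haux hw.1
      set H := component nodes G.prio aux w
      have hvis : ∀ v, H.foldl (fun s v => Function.update s v true) visited v = true ↔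
          v ∈ H ∨ visited v = true := by
        intro v
        rw [List.foldl_update_apply H (fun _ => true)]
        by_cases hv : v ∈ H <;> simp [hv]
      have hnew : ∀ v ∈ H, visited v = false := by
        intro v hv
        by_contra hvis'
        rw [Bool.not_eq_false] at hvis'
        have := hs v hvis' w (((hH.of_mem hv).2.2 w).1 hH.self_mem).1 ((hH.2.2 v).1 hv).2.symm
        dsimp only at this
        rw [hw.2] at this
        exact Bool.false_ne_true this
      constructor
      · intro v hv u hu hp
        dsimp only at hv ⊢
        rw [hvis] at hv ⊢
        rcases hv with hv | hv
        · exact Or.inl (((hH.of_mem hv).2.2 u).2 ⟨hu, hp⟩)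
        · exact Or.inr (hs v hv u hu hp)
      · have hcard : (Finset.univ.filter fun v => visited v = false).card = H.length +
            (Finset.univ.filter fun v =>
              H.foldl (fun s v => Function.update s v true) visited v = false).card := by
          rw [← List.toFinset_card_of_nodup hH.2.1, ← Finset.card_union_of_disjoint]
          · congr 1
            ext v
            have := hvis v
            have := hnew v
            simp only [Finset.mem_filter, Finset.mem_univ, true_and, Finset.mem_union,
              List.mem_toFinset]
            grind
          · rw [Finset.disjoint_left]
            intro v hv hv'
            have := (hvis v).2 (Or.inl (List.mem_toFinset.1 hv))
            rw [(Finset.mem_filter.1 hv').2] at this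
            exact Bool.false_ne_true this
        simp only [Φ]
        rw [hcard, mul_add, mul_comm W H.length]
        omega
    · exact ⟨hs, by omega⟩
  have hloop := loop_time_le_of_potential (l := nodes) (s := (fun _ => ⊤, fun _ => false)) Inv Φ
    (by intro v hv; exact absurd hv Bool.false_ne_true) hstep
  have hΦ : Φ (fun _ => ⊤, fun _ => false) = W * n := by
    simp [Φ, hcard]
  rw [hn, hΦ] at hloop
  have key : (run γ ρ nodes arcs G.prio T C μ).time ≤ (n + 1) + ((n + 1) +
      (75 * (n * (n * m)) + ((n + 1) + ((n * (30 * n + 1) + 1 + W * n) + 9 * (n * m * γ))))) := by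
    rw [run_eq]
    refine bind_time_le (fun x => x = n) hn (by rw [hn]; exact le_rfl) fun x hx => ?_
    subst hx
    refine bind_time_le (fun ν => ν = fun _ => ⊤) rfl (by rw [alloc_time, hn]) fun ν hν => ?_
    refine bind_time_le (fun a => a = aux) rfl (construct_time_le hn hn1 hm1 ham) fun a ha => ?_
    refine bind_time_le (fun v => v = fun _ => false) rfl (by rw [alloc_time, hn])
      fun visited hvis => ?_
    subst hν ha hvis
    exact bind_time_le (fun _ => True) trivial hloop fun s _ =>
      bellmanFord_time_le hn1 hm1 hγ ham T s.1
  have hP1 : 1 ≤ maxProbes n C := one_le_maxProbes hn1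
  have hnm : n * (n * m) ≤ m * n ^ 2 * γ * maxProbes n C := by
    calc n * (n * m) ≤ n * (n * m) * (γ * maxProbes n C) :=
          Nat.le_mul_of_pos_right _ (Nat.mul_pos hγ hP1)
      _ = _ := by ring
  have hnn : n * n ≤ n * (n * m) := Nat.mul_le_mul_left n (Nat.le_mul_of_pos_right n hm1)
  have hn2 : n ≤ n * n := Nat.le_mul_self n
  have hbf : n * m * γ ≤ m * n ^ 2 * γ * maxProbes n C := by
    calc n * m * γ ≤ n * m * γ * (n * maxProbes n C) :=
          Nat.le_mul_of_pos_right _ (Nat.mul_pos hn1 hP1)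
      _ = _ := by ring
  have hWn : W * n = 244 * (m * n ^ 2 * γ * maxProbes n C) + n * ρ * maxChains C := by
    rw [hW]; ring
  have h30 : n * (30 * n + 1) = 30 * (n * n) + n := by ring
  rw [timeBound_eq]
  rw [hWn, h30] at key
  omega

end LabelCorrecting


/-! ### Numbers of arcs, and the theorem -/

namespace ParityGame

theorem EnumeratesArcs.length_le {V : Type} [Finite V] {G : ParityGame V} {τ : V → V}
    {arcs : List (V × V)} (h : EnumeratesArcs (G.strategyArc τ) arcs) :
    arcs.length ≤ G.numArcs := by
  classical
  rw [← List.toFinset_card_of_nodup h.1, ← Set.ncard_coe_finset]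
  refine Set.ncard_le_ncard (fun e he => ?_) (Set.toFinite _)
  exact ((h.2 e).1 (List.mem_toFinset.1 (Finset.mem_coe.1 he))).1

theorem card_le_numArcs {V : Type} [Fintype V] (G : ParityGame V) :
    Fintype.card V ≤ G.numArcs := by
  choose σ hσ using G.sinkless
  rw [← Nat.card_eq_fintype_card, ← Set.ncard_univ]
  exact Set.ncard_le_ncard_of_injOn (fun v => (v, σ v)) (fun v _ => hσ v)
    (fun v _ w _ h => congrArg Prod.fst h) (Set.toFinite _)

end ParityGame

theorem mainTheorem4 :
    ∃ K : ℕ, ∀ (V : Type) [Fintype V] [DecidableEq V] [Nonempty V] (M : Type) [LinearOrder M]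
      (G : ParityGame V) (τ : V → V) (_ : G.IsOddStrategy τ)
      (T : OrderedTree M) (_ : T.height = G.d / 2) (_ : T.IsUniversal (Fintype.card V))
      (C : T.Cover) (μ : V → T.Label) (_ : G.NoLooseArcs (G.strategyArc τ) T μ),
      ∃ μ' : V → T.Label,
        -- `μ'` is the least simultaneous fixed point above `μ`
        IsLeast {ν | μ ≤ ν ∧ ∀ φ ∈ G.liftOps (G.strategyArc τ) T, φ ν = ν} μ' ∧
        -- it is the result of every run of the algorithm
        (∀ ν, G.IsLabelCorrectingOutput (G.strategyArc τ) T C μ ν → ν = μ') ∧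
        -- the algorithm runs within the time bound
        ∀ (γ ρ : ℕ) (_ : 1 ≤ γ) (nodes : List V) (_ : nodes.Nodup) (_ : ∀ v, v ∈ nodes)
          (arcs : List (V × V)) (_ : ParityGame.EnumeratesArcs (G.strategyArc τ) arcs),
          G.IsLabelCorrectingOutput (G.strategyArc τ) T C μ
              (LabelCorrecting.run γ ρ nodes arcs G.prio T C μ).val ∧
          (LabelCorrecting.run γ ρ nodes arcs G.prio T C μ).val = μ' ∧
          (LabelCorrecting.run γ ρ nodes arcs G.prio T C μ).time ≤
            K * LabelCorrecting.timeBound (Fintype.card V) G.numArcs γ ρ T C := by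
  refine ⟨500, ?_⟩
  intro V _ _ _ M _ G τ hτ T hT _ C μ hμ
  have hA := G.exists_strategyArc hτ
  have hprio : ∀ v, G.prio v / 2 ≤ T.height := fun v =>
    hT ▸ Nat.div_le_div_right (G.prio_le v)
  obtain ⟨μ', hμ', hloose⟩ := ParityGame.exists_isLeast_stable hA hμ
  have huniq : ∀ ν, G.IsLabelCorrectingOutput (G.strategyArc τ) T C μ ν → ν = μ' :=
    fun ν hν => hν.eq hA hμ hμ' hloose hprio
  refine ⟨μ', by simpa only [ParityGame.fixed_liftOps_iff hτ] using hμ', huniq, ?_⟩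
  intro γ ρ hγ nodes hnd hnodes arcs harcs
  have hn : nodes.length = Fintype.card V := by
    rw [← List.toFinset_card_of_nodup hnd, ← Finset.card_univ]
    congr 1
    ext v
    simp [hnodes]
  have hout := LabelCorrecting.isLabelCorrectingOutput_run (C := C) (μ := μ) (γ := γ) (ρ := ρ)
    hnodes hnd harcs hprio
  exact ⟨hout, huniq _ hout, LabelCorrecting.run_time_le hnodes hnd hn Fintype.card_pos rfl
    G.card_le_numArcs hγ harcs harcs.length_le hprio⟩
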